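/- Maps. A genus-$g$ map is a connected multigraph with at least one edge, embedded in a closed oriented surface of genus $g$ so that the complement is a disjoint union of topological disks (the faces), viewed up to orientation-preserving homeomorphism. A planar (genus-$0$) map, or an infinite map of the plane, is $2b$-irreducible ($b\ge 0$) if it contains no simple cycle of length smaller than $2b$ and every simple cycle of length $2b$ is the boundary of a face of degree $2b$. A genus-$g$ map with $g\ge 1$ is essentially $2b$-irreducible if its universal cover, an infinite planar map, is $2b$-irreducible; for $g=0$ essentially $2b$-irreducible means $2b$-irreducible. For $g,b\ge 0$ let $\mathcal M^{(b)}_g$ be the set of essentially $2b$-irreducible genus-$g$ maps all of whose faces have even degree, where for $g=0$ the maps with one or two faces are excluded, and let $\hat{\mathcal M}^{(b)}_g\subset\mathcal M^{(b)}_g$ be the subset of maps without vertices of degree $1$. Let $\operatorname{Aut}(\mathfrak m)$ be the group of orientation-preserving automorphisms of the map $\mathfrak m$, and let $\mathcal V(\mathfrak m)$ and $\mathcal F(\mathfrak m)$ be its sets of vertices and faces. For $b\ge 1$ define the formal power series $$F^{(b)}_g(x_b,x_{b+1},\ldots)=\sum_{\mathfrak m\in\mathcal M^{(b)}_g}\frac{1}{|\operatorname{Aut}(\mathfrak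 m)|}\prod_{f\in\mathcal F(\mathfrak m)}x_{\deg(f)/2},\qquad \hat F^{(b)}_g(\hat x_b,\hat x_{b+1},\ldots)=\sum_{\mathfrak m\in\hat{\mathcal M}^{(b)}_g}\frac{1}{|\operatorname{Aut}(\mathfrak m)|}\prod_{f\in\mathcal F(\mathfrak m)}\hat x_{\deg(f)/2},$$ and for $b=0$ define $$F^{(0)}_g(x_0,x_1,\ldots)=\sum_{\mathfrak m\in\mathcal M^{(0)}_g}\frac{1}{|\operatorname{Aut}(\mathfrak m)|}(1+x_0)^{|\mathcal V(\mathfrak m)|}\prod_{f\in\mathcal F(\mathfrak m)}x_{\deg(f)/2},$$ $$\hat F^{(0)}_g(\hat x_0,\hat x_1,\ldots)=\sum_{\mathfrak m\in\mathcal M^{(0)}_g}\frac{1}{|\operatorname{Aut}(\mathfrak m)|}\prod_{v\in\mathcal V(\mathfrak m)}\bigl(\hat x_0+\mathbf 1_{\{\deg(v)\ge 2\}}\bigr)\prod_{f\in\mathcal F(\mathfrak m)}\hat x_{\deg(f)/2}.$$ Proposition. For all $g\ge 0$ and $b\ge 0$ one has the identities of formal power series $$F^{(b)}_g(x_b,x_{b+1},\ldots)=\hat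 F^{(b)}_g(\hat x_b,\hat x_{b+1},\ldots)\Big|_{\hat x_p=\sum_{\ell=p}^\infty x_\ell A^{(b)}_{\ell,p}},\qquad A^{(b)}_{\ell,p}=\mathbf 1_{\ell=p=b}+\frac{p}{\ell}\binom{2\ell}{\ell-p}\mathbf 1_{\ell\ge p>b},$$ $$\hat F^{(b)}_g(\hat x_b,\hat x_{b+1},\ldots)=F^{(b)}_g(x_b,x_{b+1},\ldots)\Big|_{x_\ell=\sum_{p=\ell}^\infty \hat x_p B^{(b)}_{p,\ell}},\qquad B^{(b)}_{p,\ell}=\mathbf 1_{p=\ell=b}+(-1)^{p-\ell}\binom{p+\ell-1}{p-\ell}\mathbf 1_{p\ge\ell>b},$$ both substitutions being well defined on formal power series. Moreover, for every $m\ge b$ the matrices $(A^{(b)}_{\ell,p})_{\ell,p=b}^m$ and $(B^{(b)}_{p,\ell})_{p,\ell=b}^m$ are inverse to each other. -/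

import Mathlib

/-- A map drawn on an oriented surface, encoded by its set `D` of darts (oriented edges):
`σ` sends a dart to the next dart in the cyclic order around its origin, and `α` reverses a dart.
The set of darts may be infinite and the map may be disconnected. -/
structure RibbonMap (D : Type) where
  σ : Equiv.Perm D
  α : Equiv.Perm D
  α_α : ∀ d, α (α d) = d
  α_ne : ∀ d, α d ≠ d

namespace RibbonMap

section General

variable {D : Type} (M : RibbonMap D)

/-- The face permutation: it sends a dart to the next dart along the contour of the same face. -/
def φ : Equiv.Perm D := M.σ * M.α

/-- Vertices are the cycles of `σ`: the class of `d` is the origin of `d`. -/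
def Vertex : Type := Quotient (Equiv.Perm.SameCycle.setoid M.σ)

/-- Faces are the cycles of `φ`. -/
def Face : Type := Quotient (Equiv.Perm.SameCycle.setoid M.φ)

/-- The origin of a dart. -/
def origin (d : D) : M.Vertex := Quotient.mk _ d

/-- The face whose contour contains a given dart. -/
def face (d : D) : M.Face := Quotient.mk _ d

/-- The degree of a vertex. -/
noncomputable def vdeg (v : M.Vertex) : ℕ := Nat.card {d : D // M.origin d = v}

/-- The degree of a face. -/
noncomputable def fdeg (f : M.Face) : ℕ := Nat.card {d : D // M.face d = f}

/-- Two darts belong to the same connected component. -/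
def Reachable (x y : D) : Prop := ∃ p ∈ Subgroup.closure {M.σ, M.α}, p x = y

/-- A map is connected if it is nonempty and any two darts can be joined. -/
def Connected : Prop := Nonempty D ∧ ∀ x y, M.Reachable x y

/-- A simple cycle of length `k ≥ 1`: a closed walk along darts `c 0, …, c (k-1)` that visits `k`
distinct vertices and does not run back along the edge it has just traversed
(the last condition matters only for `k = 2`). -/
def IsSimpleCycle (k : ℕ) (c : ZMod k → D) : Prop :=
  0 < k ∧ (∀ i, M.origin (M.α (c i)) = M.origin (c (i + 1))) ∧
    Function.Injective (fun i => M.origin (c i)) ∧ ∀ i, c (i + 1) ≠ M.α (c i)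

/-- The cycle `c` is the boundary of a face: it is the contour of a face, on one of its sides.
For a simple cycle of length `k`, such a face has degree `k`. -/
def IsFaceBoundary (k : ℕ) (c : ZMod k → D) : Prop :=
  ∃ f : M.Face, {d | M.face d = f} = Set.range c ∨
    {d | M.face d = f} = Set.range (fun i => M.α (c i))

/-- `2b`-irreducibility of a (possibly infinite) map: no simple cycle is shorter than `2b`, and
each simple cycle of length `2b` is the boundary of a face (of degree `2b`). -/
def Irreducible (b : ℕ) : Prop :=
  (∀ (k : ℕ) (c : ZMod k → D), M.IsSimpleCycle k c → 2 * b ≤ k) ∧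
    ∀ c : ZMod (2 * b) → D, M.IsSimpleCycle (2 * b) c → M.IsFaceBoundary (2 * b) c

/-- The word in the darts read along the contour of the face of `d`, starting at `d`. -/
noncomputable def contourWord (d : D) : FreeGroup D :=
  (List.ofFn fun i : Fin (Function.minimalPeriod M.φ d) =>
    FreeGroup.of ((M.φ)^[(i : ℕ)] d)).prod

/-- The relations of homotopy: running back and forth along an edge is trivial, and so is
running around a face. -/
def homotopyRels : Set (FreeGroup D) :=
  Set.range (fun d => FreeGroup.of d * FreeGroup.of (M.α d)) ∪ Set.range M.contourWord

/-- The universal group of the fundamental groupoid of the surface, based at the vertices of the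
map: it is generated by the darts, subject to the relations of homotopy. As a connected groupoid
embeds in its universal group, two walks with the same starting point are homotopic (with fixed
end points) if and only if they have the same class in this group. -/
abbrev HomotopyGroup : Type := PresentedGroup M.homotopyRels

/-- The class of a dart. -/
def cls (d : D) : M.HomotopyGroup := PresentedGroup.of d

theorem cls_mul_cls_α (d : D) : M.cls d * M.cls (M.α d) = 1 := by
  have h : PresentedGroup.mk M.homotopyRels (FreeGroup.of d * FreeGroup.of (M.α d)) = 1 :=
    PresentedGroup.one_of_mem (Or.inl ⟨d, rfl⟩)
  rw [map_mul] at h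
  exact h

/-- All lifts of all darts: `(d, w)` is the lift of the dart `d` at the end of a walk of class `w`.
Following the lift of `d` multiplies the class by the class of `d`. -/
def lifts : RibbonMap (D × M.HomotopyGroup) where
  σ := M.σ.prodCongr (Equiv.refl _)
  α :=
    { toFun := fun x => (M.α x.1, x.2 * M.cls x.1)
      invFun := fun x => (M.α x.1, x.2 * M.cls x.1)
      left_inv := by
        rintro ⟨d, w⟩
        simp [M.α_α, mul_assoc, M.cls_mul_cls_α]
      right_inv := by
        rintro ⟨d, w⟩
        simp [M.α_α, mul_assoc, M.cls_mul_cls_α] }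
  α_α := by
    rintro ⟨d, w⟩
    simp [M.α_α, mul_assoc, M.cls_mul_cls_α]
  α_ne := by
    rintro ⟨d, w⟩ h
    exact M.α_ne d (congrArg Prod.fst h)

theorem reachable_iff_of_mem {p : Equiv.Perm D} (hp : p ∈ Subgroup.closure {M.σ, M.α}) (x y : D) :
    M.Reachable x (p y) ↔ M.Reachable x y := by
  constructor
  · rintro ⟨q, hq, h⟩
    exact ⟨p⁻¹ * q, mul_mem (inv_mem hp) hq, by simp [h]⟩
  · rintro ⟨q, hq, h⟩
    exact ⟨p * q, mul_mem hp hq, by simp [h]⟩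

/-- The connected component of the dart `x`. -/
def component (x : D) : RibbonMap {y : D // M.Reachable x y} where
  σ := M.σ.subtypePerm fun y =>
    M.reachable_iff_of_mem (Subgroup.subset_closure (Set.mem_insert _ _)) x y
  α := M.α.subtypePerm fun y =>
    M.reachable_iff_of_mem (Subgroup.subset_closure (Set.mem_insert_of_mem _ rfl)) x y
  α_α := fun d => Subtype.ext (M.α_α d)
  α_ne := fun d h => M.α_ne d (congrArg Subtype.val h)

/-- The universal cover of the (finite, connected) map `M`, pointed at a lift of the dart `d₀`:
its darts are the pairs `(d, w)` where `w` is the homotopy class of a walk from the origin of `d₀`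
to the origin of `d`. -/
def universalCover (d₀ : D) :
    RibbonMap {y : D × M.HomotopyGroup // M.lifts.Reachable (d₀, 1) y} :=
  M.lifts.component (d₀, 1)

/-- Essential `2b`-irreducibility of a map of genus `g`: a planar map has to be `2b`-irreducible,
for `g ≥ 1` the universal cover has to be so. -/
def EssIrreducible (g b : ℕ) : Prop :=
  (g = 0 → M.Irreducible b) ∧ (g ≠ 0 → ∀ d₀ : D, (M.universalCover d₀).Irreducible b)

/-- Isomorphisms of maps on the same set of darts (orientation-preserving homeomorphisms). -/
def IsIso (M N : RibbonMap D) (p : Equiv.Perm D) : Prop :=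
  (∀ d, p (M.σ d) = N.σ (p d)) ∧ ∀ d, p (M.α d) = N.α (p d)

/-- The order of the automorphism group. -/
noncomputable def autCard : ℕ := Nat.card {p : Equiv.Perm D // IsIso M M p}

end General

theorem ext' {D : Type} {M N : RibbonMap D} (h₁ : M.σ = N.σ) (h₂ : M.α = N.α) : M = N := by
  cases M; cases N; simp_all

instance {D : Type} [Finite D] : Finite (RibbonMap D) :=
  Finite.of_injective (fun M : RibbonMap D => (M.σ, M.α)) fun _ _ h =>
    ext' (congrArg Prod.fst h) (congrArg Prod.snd h)

instance {D : Type} [Finite D] (M : RibbonMap D) : Finite M.Vertex :=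
  inferInstanceAs (Finite (Quotient _))

instance {D : Type} [Finite D] (M : RibbonMap D) : Finite M.Face :=
  inferInstanceAs (Finite (Quotient _))

noncomputable instance {D : Type} [Finite D] (M : RibbonMap D) : Fintype M.Vertex :=
  Fintype.ofFinite _

noncomputable instance {D : Type} [Finite D] (M : RibbonMap D) : Fintype M.Face :=
  Fintype.ofFinite _

end RibbonMap

/-- Membership in the set `𝓜_g^{(b)}` for a map with `n` edges, whose darts are labelled by
`Fin (2 * n)`: the map is connected and of genus `g` (Euler's formula), all its faces have even
degree, it is essentially `2b`-irreducible, and if it is planar it has at least three faces. -/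
def InMaps (g b n : ℕ) (M : RibbonMap (Fin (2 * n))) : Prop :=
  M.Connected ∧ Nat.card M.Vertex + Nat.card M.Face + 2 * g = n + 2 ∧
    (∀ f : M.Face, Even (M.fdeg f)) ∧ M.EssIrreducible g b ∧ (g = 0 → 3 ≤ Nat.card M.Face)

/-- Membership in the subset of maps without vertices of degree one. -/
def InHatMaps (g b n : ℕ) (M : RibbonMap (Fin (2 * n))) : Prop :=
  InMaps g b n M ∧ ∀ v : M.Vertex, M.vdeg v ≠ 1

/-- Isomorphism of maps, on a set `P` of maps with labelled darts. -/
def isoSetoid {n : ℕ} (P : RibbonMap (Fin (2 * n)) → Prop) : Setoid {M // P M} where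
  r M N := ∃ p, RibbonMap.IsIso M.1 N.1 p
  iseqv :=
    { refl := fun _ => ⟨1, fun _ => rfl, fun _ => rfl⟩
      symm := by
        rintro M N ⟨p, h₁, h₂⟩
        exact ⟨p⁻¹, fun d => p.injective (by simp [h₁]),
          fun d => p.injective (by simp [h₂])⟩
      trans := by
        rintro M N K ⟨p, h₁, h₂⟩ ⟨q, h₃, h₄⟩
        exact ⟨q * p, fun d => by simp [h₁, h₃], fun d => by simp [h₂, h₄]⟩ }

/-- The isomorphism classes of the maps with `n` edges in `P`, that is, unlabelled maps. -/
def MapClass {n : ℕ} (P : RibbonMap (Fin (2 * n)) → Prop) : Type := Quotient (isoSetoid P)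

instance {n : ℕ} (P : RibbonMap (Fin (2 * n)) → Prop) : Finite (MapClass P) :=
  inferInstanceAs (Finite (Quotient _))

noncomputable instance {n : ℕ} (P : RibbonMap (Fin (2 * n)) → Prop) : Fintype (MapClass P) :=
  Fintype.ofFinite _

/-- A representative of an isomorphism class. -/
noncomputable def MapClass.rep {n : ℕ} {P : RibbonMap (Fin (2 * n)) → Prop} (c : MapClass P) :
    RibbonMap (Fin (2 * n)) := (Quotient.out c).1

/-- `∏_f x_{deg(f)/2}`, the product over the faces of a map. -/
noncomputable def faceWeight {n : ℕ} (M : RibbonMap (Fin (2 * n))) : MvPolynomial ℕ ℚ :=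
  ∏ f : M.Face, MvPolynomial.X (M.fdeg f / 2)

/-- The part of the partition function that comes from the maps with `n` edges. -/
noncomputable def sumMaps (n : ℕ) (P : RibbonMap (Fin (2 * n)) → Prop)
    (w : RibbonMap (Fin (2 * n)) → MvPolynomial ℕ ℚ) : MvPolynomial ℕ ℚ :=
  ∑ c : MapClass P, MvPolynomial.C (1 / (c.rep.autCard : ℚ)) * w c.rep

/-- The contribution of the maps with `n` edges to `F_g^{(b)}`. If `b = 0`, each vertex has the
additional weight `1 + x_0`. -/
noncomputable def partitionPart (g b n : ℕ) : MvPolynomial ℕ ℚ :=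
  if b = 0 then
    sumMaps n (InMaps g 0 n) fun M => (1 + MvPolynomial.X 0) ^ Nat.card M.Vertex * faceWeight M
  else sumMaps n (InMaps g b n) faceWeight

/-- The contribution of the maps with `n` edges to `F̂_g^{(b)}`. If `b = 0`, vertices of degree one
are allowed and each vertex `v` has the additional weight `x_0 + 1_{deg(v) ≥ 2}`. -/
noncomputable def hatPartitionPart (g b n : ℕ) : MvPolynomial ℕ ℚ :=
  if b = 0 then
    sumMaps n (InMaps g 0 n) fun M =>
      (∏ v : M.Vertex, (MvPolynomial.X 0 + if 2 ≤ M.vdeg v then 1 else 0)) * faceWeight M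
  else sumMaps n (InHatMaps g b n) faceWeight

/-- The partition function `F_g^{(b)}(x_b, x_{b+1}, …)`, as a formal power series over `ℚ` in
variables `x_ℓ`, `ℓ ∈ ℕ`. Each coefficient is a finite sum, see `partitionPart_support_finite`. -/
noncomputable def partitionF (g b : ℕ) : MvPowerSeries ℕ ℚ :=
  fun d => ∑ᶠ n : ℕ, (partitionPart g b n).coeff d

/-- The partition function `F̂_g^{(b)}(x̂_b, x̂_{b+1}, …)`, as a formal power series over `ℚ` in
variables `x̂_ℓ`, `ℓ ∈ ℕ`. Each coefficient is a finite sum, see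
`hatPartitionPart_support_finite`. -/
noncomputable def hatPartitionF (g b : ℕ) : MvPowerSeries ℕ ℚ :=
  fun d => ∑ᶠ n : ℕ, (hatPartitionPart g b n).coeff d

theorem sum_fdeg {n : ℕ} (M : RibbonMap (Fin (2 * n))) : ∑ f : M.Face, M.fdeg f = 2 * n := by
  classical
  have h := Finset.card_eq_sum_card_fiberwise (s := (Finset.univ : Finset (Fin (2 * n))))
    (t := (Finset.univ : Finset M.Face)) (f := M.face) (fun _ _ => Finset.mem_univ _)
  rw [Finset.card_univ, Fintype.card_fin] at h
  refine Eq.trans ?_ h.symm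
  refine Finset.sum_congr rfl fun f _ => ?_
  rw [RibbonMap.fdeg, Nat.card_eq_fintype_card, Fintype.card_subtype]

theorem faceWeight_homogeneous {g b n : ℕ} {M : RibbonMap (Fin (2 * n))} (hM : InMaps g b n M) :
    (faceWeight M).IsWeightedHomogeneous (fun ℓ : ℕ => ℓ) n := by
  have h := MvPolynomial.IsWeightedHomogeneous.prod Finset.univ
    (fun f : M.Face => (MvPolynomial.X (M.fdeg f / 2) : MvPolynomial ℕ ℚ))
    (fun f => M.fdeg f / 2) (w := fun ℓ : ℕ => ℓ)
    (fun f _ => MvPolynomial.isWeightedHomogeneous_X ℚ _ _)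
  have h2 : ∑ f : M.Face, M.fdeg f / 2 = n := by
    have h3 : 2 * ∑ f : M.Face, M.fdeg f / 2 = 2 * n := by
      refine Eq.trans ?_ (sum_fdeg M)
      rw [Finset.mul_sum]
      exact Finset.sum_congr rfl fun f _ => Nat.two_mul_div_two_of_even (hM.2.2.1 f)
    omega
  rw [h2] at h
  exact h

theorem sumMaps_homogeneous {n : ℕ} {P : RibbonMap (Fin (2 * n)) → Prop}
    {w : RibbonMap (Fin (2 * n)) → MvPolynomial ℕ ℚ}
    (h : ∀ M, P M → (w M).IsWeightedHomogeneous (fun ℓ : ℕ => ℓ) n) :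
    (sumMaps n P w).IsWeightedHomogeneous (fun ℓ : ℕ => ℓ) n := by
  refine MvPolynomial.IsWeightedHomogeneous.sum _ _ _ fun c _ => ?_
  have := (MvPolynomial.isWeightedHomogeneous_C (fun ℓ : ℕ => ℓ)
    (1 / (c.rep.autCard : ℚ))).mul (h c.rep (Quotient.out c).2)
  rwa [zero_add] at this

theorem partitionPart_homogeneous (g b n : ℕ) :
    (partitionPart g b n).IsWeightedHomogeneous (fun ℓ : ℕ => ℓ) n := by
  unfold partitionPart
  split_ifs
  · refine sumMaps_homogeneous fun M hM => ?_
    have h1 : ((1 + MvPolynomial.X 0 : MvPolynomial ℕ ℚ)).IsWeightedHomogeneous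
        (fun ℓ : ℕ => ℓ) 0 :=
      (MvPolynomial.isWeightedHomogeneous_one ℚ _).add
        (MvPolynomial.isWeightedHomogeneous_X ℚ (fun ℓ : ℕ => ℓ) 0)
    have := (h1.pow (Nat.card M.Vertex)).mul (faceWeight_homogeneous hM)
    rwa [smul_zero, zero_add] at this
  · exact sumMaps_homogeneous fun M hM => faceWeight_homogeneous hM

theorem hatPartitionPart_homogeneous (g b n : ℕ) :
    (hatPartitionPart g b n).IsWeightedHomogeneous (fun ℓ : ℕ => ℓ) n := by
  unfold hatPartitionPart
  split_ifs
  · refine sumMaps_homogeneous fun M hM => ?_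
    have h1 : ∀ v : M.Vertex,
        ((MvPolynomial.X 0 + if 2 ≤ M.vdeg v then 1 else 0 :
          MvPolynomial ℕ ℚ)).IsWeightedHomogeneous (fun ℓ : ℕ => ℓ) 0 := fun v => by
      refine (MvPolynomial.isWeightedHomogeneous_X ℚ (fun ℓ : ℕ => ℓ) 0).add ?_
      split_ifs
      · exact MvPolynomial.isWeightedHomogeneous_one ℚ _
      · exact MvPolynomial.isWeightedHomogeneous_zero ℚ _ _
    have := (MvPolynomial.IsWeightedHomogeneous.prod Finset.univ _ (fun _ : M.Vertex => 0)
      (fun v _ => h1 v)).mul (faceWeight_homogeneous hM)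
    rwa [Finset.sum_const_zero, zero_add] at this
  · exact sumMaps_homogeneous fun M hM => faceWeight_homogeneous hM.1

theorem partitionPart_support_finite (g b : ℕ) (d : ℕ →₀ ℕ) :
    (Function.support fun n => (partitionPart g b n).coeff d).Finite :=
  (Set.finite_singleton (Finsupp.weight (fun ℓ : ℕ => ℓ) d)).subset fun n hn =>
    (partitionPart_homogeneous g b n hn).symm

theorem hatPartitionPart_support_finite (g b : ℕ) (d : ℕ →₀ ℕ) :
    (Function.support fun n => (hatPartitionPart g b n).coeff d).Finite :=
  (Set.finite_singleton (Finsupp.weight (fun ℓ : ℕ => ℓ) d)).subset fun n hn =>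
    (hatPartitionPart_homogeneous g b n hn).symm

/-- `A^{(b)}_{ℓ,p}`. -/
def substA (b ℓ p : ℕ) : ℚ :=
  (if ℓ = p ∧ p = b then 1 else 0) +
    if p ≤ ℓ ∧ b < p then (p : ℚ) / ℓ * (2 * ℓ).choose (ℓ - p) else 0

/-- `B^{(b)}_{p,ℓ}`. -/
def substB (b p ℓ : ℕ) : ℚ :=
  (if p = ℓ ∧ ℓ = b then 1 else 0) +
    if ℓ ≤ p ∧ b < ℓ then (-1) ^ (p - ℓ) * ((p + ℓ - 1).choose (p - ℓ) : ℚ) else 0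

/-- The (infinite) linear form `∑_ℓ c_ℓ x_ℓ`, as a formal power series. -/
noncomputable def linearForm (c : ℕ → ℚ) : MvPowerSeries ℕ ℚ :=
  fun d => ∑ ℓ ∈ d.support, c ℓ * MvPowerSeries.coeff d (MvPowerSeries.X ℓ : MvPowerSeries ℕ ℚ)

/-! The passage from F to F̂ is an inclusion–exclusion over leaves. In F̂ a vertex of degree 1 has
the vertex weight of F lowered by 1: from 1 to 0 if b ≥ 1, from 1 + x_0 to x_0 if b = 0. Expanding
the product over the vertices (`prod_vertex_sub`) gives a signed sum over maps with a set of marked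
leaves.

A map with marked leaves is built from a smaller map by inserting the leaves one at a time. A face
of degree 2m with a marked leaves offers 2m - a corners, since a corner at a marked leaf is
forbidden, and becomes a face of degree 2m + 2 with a + 1 marked leaves. Insertion is thus the
derivation Δ : X(m,a) ↦ (2m - a) X(m+1,a+1), except that Δ X(b,a) = 0, because faces of degree 2b
must stay intact (`sum_leafWeight_ins`). As k leaves can be removed in k! orders, maps with k marked
leaves are counted by Δ^k / k! (`factorial_mul_leafPart`), and F̂ is exp(-Δ) applied to F, with the
marks forgotten.

The exponential of a derivation is multiplicative (`leafExpFun_mul`), so it is a substitution,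
determined by the images of the X(m,0). For m > b, Δ^k X(m,0) = 2m(2m+1)⋯(2m+k-1) X(m+k,k), and
dividing by (-1)^k k! produces B_{m+k,m} = (-1)^k binom(2m+k-1,k). This is F̂ = F ∘ B
(`hatPartitionF_eq_subst`). Then F = F̂ ∘ A follows from AB = 1, as F involves only the x_ℓ with ℓ ≥
b. The identity AB = 1 comes from the three-term recurrences of the ballot numbers and of their
inverse (`sum_ballot_mul_ballotInv`).

The geometric input is `isAdmissible_ins_iff`: inserting a leaf preserves essential irreducibility
exactly if the receiving face does not have degree 2b. Simple cycles never enter a leaf, so an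
insertion can only spoil the property that a cycle of length 2b bounds a face. The contour of a face
of degree 2b is such a cycle in the cover, and its other side is not a face as well, since the map
would then be a single cycle on the sphere. The universal cover is treated downstairs, by closed
walks in the map together with a group-valued monodromy; flat monodromies replace any computation of
homotopy groups (`coverIrreducible_cls_iff`). -/

namespace Equiv.Perm

/-! ### Cycles of a permutation, and the insertion of a point into a cycle -/

variable {X : Type}

/-- The main tool for comparing cycles: taking for `r` the quotient map of another cycle relation
turns a one-step check into an inclusion of relations. -/
theorem SameCycle.apply_eq_of_invariant {β : Sort*} {s : Perm X} {r : X → β}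
    (hr : ∀ x, r (s x) = r x) {x y : X} (h : s.SameCycle x y) : r x = r y := by
  obtain ⟨i, rfl⟩ := h
  induction i using Int.induction_on with
  | zero => simp
  | succ i ih => rw [add_comm, zpow_add, zpow_one, mul_apply, hr, ih]
  | pred i ih =>
    rw [ih, ← hr ((s ^ (-(i : ℤ) - 1)) x), ← mul_apply, ← zpow_one_add]
    congr 3
    ring

open Classical in
/-- Insert a new point `none` just before `x` in the cycle of `x`. -/
noncomputable def insPerm (s : Perm X) (x : X) : Perm (Option X) :=
  swap none (some x) * s.optionCongr

@[simp] theorem insPerm_none (s : Perm X) (x : X) : insPerm s x none = some x := by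
  simp [insPerm]

theorem insPerm_some_of_eq {s : Perm X} {x y : X} (h : s y = x) :
    insPerm s x (some y) = none := by
  classical
  simp [insPerm, h]

theorem insPerm_some_of_ne {s : Perm X} {x y : X} (h : s y ≠ x) :
    insPerm s x (some y) = some (s y) := by
  classical
  simp only [insPerm, mul_apply, optionCongr_apply, Option.map_some]
  exact swap_apply_of_ne_of_ne (by simp) (by simpa using h)

theorem sameCycle_insPerm_none (s : Perm X) (x : X) : (insPerm s x).SameCycle none (some x) :=
  ⟨1, by simp⟩

theorem insPerm_invariant {β : Sort*} {s : Perm X} (x : X) {r : X → β}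
    (hr : ∀ y, r (s y) = r y) (z : Option X) :
    Option.elim (insPerm s x z) (r x) r = Option.elim z (r x) r := by
  rcases z with _ | y
  · simp
  · by_cases h : s y = x
    · rw [insPerm_some_of_eq h]
      simp [← h, hr]
    · rw [insPerm_some_of_ne h]
      simp [hr]

theorem sameCycle_insPerm_some {s : Perm X} {x y z : X} :
    (insPerm s x).SameCycle (some y) (some z) ↔ s.SameCycle y z := by
  constructor
  · intro h
    have := h.apply_eq_of_invariant
      (r := fun z => Option.elim z (Quotient.mk (SameCycle.setoid s) x)
        fun z => Quotient.mk (SameCycle.setoid s) z)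
      (insPerm_invariant x (s := s) (r := fun z => (Quotient.mk (SameCycle.setoid s) z))
        fun y => Quotient.sound (s := SameCycle.setoid s) ((sameCycle_apply_left).2 SameCycle.rfl))
    exact Quotient.exact this
  · intro h
    have := h.apply_eq_of_invariant
      (r := fun y => Quotient.mk (SameCycle.setoid (insPerm s x)) (some y)) ?_
    · exact Quotient.exact this
    · intro y
      refine Quotient.sound (s := SameCycle.setoid (insPerm s x)) ?_
      change (insPerm s x).SameCycle _ _
      by_cases h : s y = x
      · rw [h]
        exact (sameCycle_insPerm_none s x).symm.trans
          (by rw [← insPerm_some_of_eq h]; exact (sameCycle_apply_left).2 SameCycle.rfl)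
      · rw [← insPerm_some_of_ne h]
        exact (sameCycle_apply_left).2 SameCycle.rfl

theorem sameCycle_insPerm_none_some {s : Perm X} {x y : X} :
    (insPerm s x).SameCycle none (some y) ↔ s.SameCycle x y := by
  rw [← sameCycle_insPerm_some (x := x)]
  exact ⟨fun h => (sameCycle_insPerm_none s x).symm.trans h,
    fun h => (sameCycle_insPerm_none s x).trans h⟩

theorem sameCycle_optionCongr_some {s : Perm X} {y z : X} :
    SameCycle (α := Option X) s.optionCongr (some y) (some z) ↔ s.SameCycle y z := by
  constructor
  · intro h
    have := h.apply_eq_of_invariant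
      (r := Option.map fun z => (Quotient.mk (SameCycle.setoid s) z)) ?_
    · exact Quotient.exact (Option.some.inj this)
    · rintro (_ | y)
      · rfl
      · exact congrArg some
          (Quotient.sound (s := SameCycle.setoid s) ((sameCycle_apply_left).2 SameCycle.rfl))
  · intro h
    have := h.apply_eq_of_invariant
      (r := fun y => Quotient.mk (SameCycle.setoid (s.optionCongr : Perm (Option X))) (some y)) ?_
    · exact Quotient.exact this
    · intro y
      exact Quotient.sound (s := SameCycle.setoid (s.optionCongr : Perm (Option X)))
        ((sameCycle_apply_left (f := (s.optionCongr : Perm (Option X))) (x := some y)).2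
          SameCycle.rfl)

theorem sameCycle_optionCongr_none {s : Perm X} {z : Option X} :
    SameCycle (α := Option X) s.optionCongr none z ↔ z = none := by
  refine ⟨fun h => (h.eq_of_left (x := none) rfl).symm, ?_⟩
  rintro rfl
  exact SameCycle.rfl

/-- The number of points in the cycle of `x`. -/
noncomputable def cycDeg (s : Perm X) (x : X) : ℕ := Nat.card {y // s.SameCycle y x}

theorem _root_.Nat.card_subtype_option [Finite X] (P : Option X → Prop) [Decidable (P none)] :
    Nat.card {z // P z} = Nat.card {z : X // P (some z)} + if P none then 1 else 0 := by
  classical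
  have := Fintype.ofFinite X
  simp only [Nat.card_eq_fintype_card, Fintype.card_subtype, Finset.card_filter,
    Fintype.sum_option]
  rw [add_comm]
  congr

open Classical in
theorem cycDeg_insPerm_some [Finite X] (s : Perm X) (x y : X) :
    cycDeg (insPerm s x) (some y) = cycDeg s y + if s.SameCycle x y then 1 else 0 := by
  unfold cycDeg
  rw [Nat.card_subtype_option]
  simp only [sameCycle_insPerm_some, sameCycle_insPerm_none_some]

theorem cycDeg_eq_one_iff {s : Perm X} {x : X} : cycDeg s x = 1 ↔ s x = x := by
  unfold cycDeg
  rw [Nat.card_eq_one_iff_unique]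
  constructor
  · rintro ⟨h, -⟩
    exact congrArg Subtype.val (h.elim ⟨s x, sameCycle_apply_left.2 SameCycle.rfl⟩
      ⟨x, SameCycle.rfl⟩)
  · intro h
    refine ⟨⟨?_⟩, ⟨⟨x, SameCycle.rfl⟩⟩⟩
    rintro ⟨a, ha⟩ ⟨b, hb⟩
    exact Subtype.ext ((ha.eq_of_right h).trans (hb.eq_of_right h).symm)

theorem cycDeg_eq_minimalPeriod [Finite X] (s : Perm X) (x : X) :
    cycDeg s x = Function.minimalPeriod s x := by
  have := Fintype.ofFinite X
  classical
  have h := MulAction.minimalPeriod_eq_card (a := s) (b := x)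
  rw [show (fun y : X => s • y) = s from rfl] at h
  rw [h, ← Nat.card_eq_fintype_card]
  refine Nat.card_congr (Equiv.subtypeEquivRight fun y => ?_)
  constructor
  · intro k
    obtain ⟨i, rfl⟩ := k.symm
    exact ⟨⟨s ^ i, i, rfl⟩, rfl⟩
  · rintro ⟨⟨_, i, rfl⟩, rfl⟩
    exact SameCycle.symm ⟨i, rfl⟩

theorem cycDeg_pos [Finite X] (s : Perm X) (x : X) : 0 < cycDeg s x :=
  Nat.card_pos_iff.2 ⟨⟨⟨x, SameCycle.rfl⟩⟩, inferInstance⟩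

theorem sameCycle_conj_map {Y : Type} (e : X ≃ Y) {s : Perm X} {t : Perm Y}
    (h : ∀ x, t (e x) = e (s x)) {x y : X} : t.SameCycle (e x) (e y) ↔ s.SameCycle x y := by
  constructor
  · intro k
    have := k.apply_eq_of_invariant
      (r := fun y => Quotient.mk (SameCycle.setoid s) (e.symm y)) ?_
    · have := Quotient.exact this
      rw [e.symm_apply_apply, e.symm_apply_apply] at this
      exact this
    · intro y
      obtain ⟨x, rfl⟩ := e.surjective y
      rw [h]
      refine Quotient.sound (s := SameCycle.setoid s) ?_
      rw [e.symm_apply_apply, e.symm_apply_apply]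
      exact (sameCycle_apply_left (f := s) (x := x)).2 SameCycle.rfl
  · intro k
    have := k.apply_eq_of_invariant (r := fun x => Quotient.mk (SameCycle.setoid t) (e x)) ?_
    · exact Quotient.exact this
    · intro x
      rw [← h]
      exact Quotient.sound (s := SameCycle.setoid t) (sameCycle_apply_left.2 SameCycle.rfl)

theorem cycDeg_conj_map {Y : Type} (e : X ≃ Y) {s : Perm X} {t : Perm Y}
    (h : ∀ x, t (e x) = e (s x)) (x : X) : cycDeg t (e x) = cycDeg s x :=
  (Nat.card_congr (e.subtypeEquiv fun y => (sameCycle_conj_map e h (x := y) (y := x)).symm)).symm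

end Equiv.Perm

/-! ### Transport of maps along bijections, and insertion of a leaf -/

namespace RibbonMap

open Equiv.Perm

variable {D E : Type} (M : RibbonMap D)

theorem origin_eq_iff {x y : D} : M.origin x = M.origin y ↔ M.σ.SameCycle x y :=
  Quotient.eq (r := SameCycle.setoid M.σ)

theorem face_eq_iff {x y : D} : M.face x = M.face y ↔ M.φ.SameCycle x y :=
  Quotient.eq (r := SameCycle.setoid M.φ)

theorem origin_surjective : Function.Surjective M.origin := Quotient.exists_rep

theorem face_surjective : Function.Surjective M.face := Quotient.exists_rep

theorem φ_apply (x : D) : M.φ x = M.σ (M.α x) := rfl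

@[simp] theorem origin_σ (x : D) : M.origin (M.σ x) = M.origin x :=
  M.origin_eq_iff.2 (sameCycle_apply_left.2 SameCycle.rfl)

@[simp] theorem face_φ (x : D) : M.face (M.φ x) = M.face x :=
  M.face_eq_iff.2 (sameCycle_apply_left.2 SameCycle.rfl)

theorem origin_φ (x : D) : M.origin (M.φ x) = M.origin (M.α x) := M.origin_σ _

theorem fdeg_face (x : D) : M.fdeg (M.face x) = cycDeg M.φ x :=
  Nat.card_congr (Equiv.subtypeEquivRight fun _ => M.face_eq_iff)

theorem vdeg_origin (x : D) : M.vdeg (M.origin x) = cycDeg M.σ x :=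
  Nat.card_congr (Equiv.subtypeEquivRight fun _ => M.origin_eq_iff)

theorem origin_eq_of_σ_eq {l x : D} (hl : M.σ l = l) (h : M.origin x = M.origin l) : x = l :=
  (M.origin_eq_iff.1 h).eq_of_right hl

/-- Invariant predicates replace words in `σ` and `α`; they are easily extended or restricted when
the set of darts changes. -/
theorem connected_iff : M.Connected ↔ Nonempty D ∧ ∀ P : D → Prop, (∀ x, P (M.σ x) ↔ P x) →
    (∀ x, P (M.α x) ↔ P x) → ∀ x y, P x → P y := by
  refine and_congr_right fun _ => ⟨fun h P h₁ h₂ x y hx => ?_, fun h x y => ?_⟩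
  · obtain ⟨p, hp, rfl⟩ := h x y
    have : ∀ z, P (p z) ↔ P z := by
      induction hp using Subgroup.closure_induction with
      | mem q hq =>
        rcases hq with rfl | rfl
        · exact h₁
        · exact h₂
      | one => simp
      | mul q r _ _ hq hr => intro z; rw [mul_apply, hq, hr]
      | inv q _ hq => intro z; rw [← hq]; simp
    exact (this x).2 hx
  · exact h (M.Reachable x)
      (fun z => M.reachable_iff_of_mem (Subgroup.subset_closure (Set.mem_insert _ _)) x z)
      (fun z => M.reachable_iff_of_mem
        (Subgroup.subset_closure (Set.mem_insert_of_mem _ rfl)) x z) x y ⟨1, one_mem _, rfl⟩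

/-- Transport of a map along a bijection of the sets of darts. -/
def map (e : D ≃ E) : RibbonMap E where
  σ := e.permCongr M.σ
  α := e.permCongr M.α
  α_α := fun d => by simp [M.α_α]
  α_ne := fun d => by
    simp only [Equiv.permCongr_apply, ne_eq]
    rw [← Equiv.eq_symm_apply]
    exact M.α_ne _

@[simp] theorem map_σ (e : D ≃ E) (x : D) : (M.map e).σ (e x) = e (M.σ x) := by simp [map]

@[simp] theorem map_α (e : D ≃ E) (x : D) : (M.map e).α (e x) = e (M.α x) := by simp [map]

@[simp] theorem map_φ (e : D ≃ E) (x : D) : (M.map e).φ (e x) = e (M.φ x) := by simp [φ_apply]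

theorem map_map {F : Type} (e : D ≃ E) (f : E ≃ F) : (M.map e).map f = M.map (e.trans f) :=
  ext' (by ext; simp [map]) (by ext; simp [map])

@[simp] theorem map_refl : M.map (Equiv.refl D) = M := ext' (by ext; simp [map]) (by ext; simp [map])

/-- Transport of maps along a bijection, as a bijection. -/
def mapEquiv (e : D ≃ E) : RibbonMap D ≃ RibbonMap E where
  toFun M := M.map e
  invFun M := M.map e.symm
  left_inv M := by simp [map_map]
  right_inv M := by simp [map_map]

theorem isIso_iff {M N : RibbonMap D} {p : Equiv.Perm D} : IsIso M N p ↔ M.map p = N := by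
  constructor
  · rintro ⟨h₁, h₂⟩
    refine ext' (Equiv.ext fun x => ?_) (Equiv.ext fun x => ?_)
    · obtain ⟨x, rfl⟩ := p.surjective x
      rw [map_σ, h₁]
    · obtain ⟨x, rfl⟩ := p.surjective x
      rw [map_α, h₂]
  · rintro rfl
    exact ⟨fun d => (M.map_σ p d).symm, fun d => (M.map_α p d).symm⟩

theorem map_origin_eq_iff (e : D ≃ E) {x y : D} :
    (M.map e).origin (e x) = (M.map e).origin (e y) ↔ M.origin x = M.origin y := by
  rw [origin_eq_iff, origin_eq_iff]
  exact sameCycle_conj_map e (M.map_σ e)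

/-- The faces of a transported map. -/
noncomputable def mapFaceEquiv (e : D ≃ E) : M.Face ≃ (M.map e).Face :=
  Quotient.congr e fun _ _ => (sameCycle_conj_map e (M.map_φ e)).symm

@[simp] theorem mapFaceEquiv_face (e : D ≃ E) (x : D) :
    M.mapFaceEquiv e (M.face x) = (M.map e).face (e x) := rfl

/-- The vertices of a transported map. -/
noncomputable def mapVertexEquiv (e : D ≃ E) : M.Vertex ≃ (M.map e).Vertex :=
  Quotient.congr e fun _ _ => (sameCycle_conj_map e (M.map_σ e)).symm

@[simp] theorem mapVertexEquiv_origin (e : D ≃ E) (x : D) :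
    M.mapVertexEquiv e (M.origin x) = (M.map e).origin (e x) := rfl

theorem map_fdeg (e : D ≃ E) (f : M.Face) : (M.map e).fdeg (M.mapFaceEquiv e f) = M.fdeg f := by
  obtain ⟨x, rfl⟩ := M.face_surjective f
  rw [mapFaceEquiv_face, fdeg_face, fdeg_face]
  exact cycDeg_conj_map e (M.map_φ e) x

theorem map_vdeg (e : D ≃ E) (v : M.Vertex) :
    (M.map e).vdeg (M.mapVertexEquiv e v) = M.vdeg v := by
  obtain ⟨x, rfl⟩ := M.origin_surjective v
  rw [mapVertexEquiv_origin, vdeg_origin, vdeg_origin]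
  exact cycDeg_conj_map e (M.map_σ e) x

theorem Connected.map {M : RibbonMap D} (h : M.Connected) (e : D ≃ E) : (M.map e).Connected := by
  rw [connected_iff] at h ⊢
  refine ⟨h.1.map e, fun P h₁ h₂ x y hx => ?_⟩
  obtain ⟨x, rfl⟩ := e.surjective x
  obtain ⟨y, rfl⟩ := e.surjective y
  exact h.2 (fun z => P (e z)) (fun z => by rw [← map_σ, h₁]) (fun z => by rw [← map_α, h₂]) x y hx

/-- Insert a leaf in the corner just before the dart `e`. The dart that starts at the leaf is
`none`, its reverse is `some none`. -/
noncomputable def ins (e : D) : RibbonMap (Option (Option D)) where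
  σ := (insPerm M.σ e).optionCongr
  α :=
    { toFun := fun x => Option.elim x (some none) fun y => Option.elim y none
        fun z => some (some (M.α z))
      invFun := fun x => Option.elim x (some none) fun y => Option.elim y none
        fun z => some (some (M.α z))
      left_inv := by rintro (_ | _ | z) <;> simp [M.α_α]
      right_inv := by rintro (_ | _ | z) <;> simp [M.α_α] }
  α_α := by rintro (_ | _ | z) <;> simp [M.α_α]
  α_ne := by rintro (_ | _ | z) <;> simp [M.α_ne]

section ins

variable (e : D)

@[simp] theorem ins_α_none : (M.ins e).α none = some none := rfl

@[simp] theorem ins_α_some_none : (M.ins e).α (some none) = none := rfl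

@[simp] theorem ins_α_some_some (x : D) : (M.ins e).α (some (some x)) = some (some (M.α x)) := rfl

@[simp] theorem ins_σ_none : (M.ins e).σ none = none := rfl

theorem ins_σ_some (x : Option D) : (M.ins e).σ (some x) = some (insPerm M.σ e x) := rfl

@[simp] theorem ins_σ_some_none : (M.ins e).σ (some none) = some (some e) := by
  rw [ins_σ_some, insPerm_none]

variable {e}

theorem ins_σ_some_some_of_eq {x : D} (h : M.σ x = e) :
    (M.ins e).σ (some (some x)) = some none := by
  rw [ins_σ_some, insPerm_some_of_eq h]

theorem ins_σ_some_some_of_ne {x : D} (h : M.σ x ≠ e) :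
    (M.ins e).σ (some (some x)) = some (some (M.σ x)) := by
  rw [ins_σ_some, insPerm_some_of_ne h]

variable (e)

/-- Just before `e`, the contour now runs out along the new edge (`some none`) and back (`none`).
One face gains two darts, and all other faces are unchanged. -/
theorem ins_φ : (M.ins e).φ = insPerm (insPerm M.φ e) (some e) := by
  refine Equiv.ext ?_
  rintro (_ | _ | x)
  · simp [φ_apply]
  · rw [φ_apply, ins_α_some_none, ins_σ_none, insPerm_some_of_eq (insPerm_none _ _)]
  · rw [φ_apply, ins_α_some_some, ins_σ_some]
    by_cases h : M.φ x = e
    · have h' : insPerm M.φ e (some x) = none := insPerm_some_of_eq h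
      rw [insPerm_some_of_eq (s := M.σ) h, insPerm_some_of_ne (by simp [h']), h']
    · have h' : insPerm M.φ e (some x) = some (M.φ x) := insPerm_some_of_ne h
      rw [insPerm_some_of_ne (s := M.σ) h, insPerm_some_of_ne (by simpa [h'] using h), h']
      rfl

theorem ins_origin_eq_iff {x y : D} :
    (M.ins e).origin (some (some x)) = (M.ins e).origin (some (some y)) ↔
      M.origin x = M.origin y := by
  rw [origin_eq_iff, origin_eq_iff]
  exact sameCycle_optionCongr_some.trans sameCycle_insPerm_some

theorem ins_face_eq_iff {x y : D} :
    (M.ins e).face (some (some x)) = (M.ins e).face (some (some y)) ↔ M.face x = M.face y := by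
  rw [face_eq_iff, face_eq_iff, ins_φ, sameCycle_insPerm_some, sameCycle_insPerm_some]

theorem ins_face_none : (M.ins e).face none = (M.ins e).face (some (some e)) := by
  rw [face_eq_iff, ins_φ, sameCycle_insPerm_none_some]

theorem ins_face_some_none : (M.ins e).face (some none) = (M.ins e).face (some (some e)) := by
  rw [← ins_face_none, ← face_φ]
  rfl

/-- The faces of a map are preserved by the insertion of a leaf. -/
noncomputable def insFaceEquiv : M.Face ≃ (M.ins e).Face :=
  Equiv.ofBijective
    (Quotient.lift (fun x => (M.ins e).face (some (some x)))
      fun _ _ h => (M.ins_face_eq_iff e).2 (M.face_eq_iff.2 h)) (by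
    constructor
    · rintro ⟨x⟩ ⟨y⟩ h
      exact (M.ins_face_eq_iff e).1 h
    · intro f
      obtain ⟨x, rfl⟩ := (M.ins e).face_surjective f
      rcases x with _ | _ | x
      · exact ⟨M.face e, (M.ins_face_none e).symm⟩
      · exact ⟨M.face e, (M.ins_face_some_none e).symm⟩
      · exact ⟨M.face x, rfl⟩)

@[simp] theorem insFaceEquiv_face (x : D) :
    M.insFaceEquiv e (M.face x) = (M.ins e).face (some (some x)) := rfl

/-- The insertion of a leaf adds a vertex. -/
noncomputable def insVertexEquiv : Option M.Vertex ≃ (M.ins e).Vertex :=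
  Equiv.ofBijective
    (fun v => Option.elim v ((M.ins e).origin none)
      (Quotient.lift (fun x => (M.ins e).origin (some (some x)))
        fun _ _ h => (M.ins_origin_eq_iff e).2 (M.origin_eq_iff.2 h))) (by
    have key : ∀ x, (M.ins e).origin none ≠ (M.ins e).origin (some x) := fun x h =>
      Option.some_ne_none _ (sameCycle_optionCongr_none.1 ((M.ins e).origin_eq_iff.1 h))
    constructor
    · rintro (_ | v) (_ | w) h
      · rfl
      · obtain ⟨y, rfl⟩ := M.origin_surjective w
        exact absurd h (key (some y))
      · obtain ⟨x, rfl⟩ := M.origin_surjective v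
        exact absurd h.symm (key (some x))
      · obtain ⟨x, rfl⟩ := M.origin_surjective v
        obtain ⟨y, rfl⟩ := M.origin_surjective w
        exact congrArg some ((M.ins_origin_eq_iff e).1 h)
    · intro f
      obtain ⟨x, rfl⟩ := (M.ins e).origin_surjective f
      rcases x with _ | _ | x
      · exact ⟨none, rfl⟩
      · refine ⟨some (M.origin e), ?_⟩
        rw [← (M.ins e).origin_σ (some none), ins_σ_some_none]
        rfl
      · exact ⟨some (M.origin x), rfl⟩)

theorem card_vertex_ins [Finite D] : Nat.card (M.ins e).Vertex = Nat.card M.Vertex + 1 := by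
  rw [← Nat.card_congr (M.insVertexEquiv e), Finite.card_option]

theorem card_face_ins : Nat.card (M.ins e).Face = Nat.card M.Face :=
  (Nat.card_congr (M.insFaceEquiv e)).symm

open Classical in
theorem fdeg_ins [Finite D] (f : M.Face) :
    (M.ins e).fdeg (M.insFaceEquiv e f) = M.fdeg f + if M.face e = f then 2 else 0 := by
  obtain ⟨x, rfl⟩ := M.face_surjective f
  rw [insFaceEquiv_face, fdeg_face, fdeg_face, ins_φ, cycDeg_insPerm_some, cycDeg_insPerm_some,
    sameCycle_insPerm_some, face_eq_iff]
  split_ifs <;> rfl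

theorem connected_ins_iff : (M.ins e).Connected ↔ M.Connected := by
  rw [connected_iff, connected_iff]
  constructor
  · rintro ⟨-, h⟩
    refine ⟨⟨e⟩, fun P h₁ h₂ x y hx => ?_⟩
    refine h (fun z => Option.elim z (P e) fun z => Option.elim z (P e) P) ?_ ?_
      (some (some x)) (some (some y)) hx
    · rintro (_ | _ | z)
      · simp
      · simp
      · by_cases hz : M.σ z = e
        · rw [ins_σ_some_some_of_eq M hz]
          simp [← hz, h₁]
        · rw [ins_σ_some_some_of_ne M hz]
          simp [h₁]
    · rintro (_ | _ | z)
      · simp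
      · simp
      · simp [h₂]
  · rintro ⟨-, h⟩
    refine ⟨⟨none⟩, fun P h₁ h₂ => ?_⟩
    have h₃ : P (some none) ↔ P (some (some e)) := by rw [← h₁ (some none), ins_σ_some_none]
    have h₄ : P none ↔ P (some none) := by rw [← h₂ none, ins_α_none]
    have h₅ := h (fun z => P (some (some z))) (fun z => by
      by_cases hz : M.σ z = e
      · rw [hz, ← h₃, ← ins_σ_some_some_of_eq M hz, h₁]
      · rw [← ins_σ_some_some_of_ne M hz, h₁]) (fun z => by rw [← h₂]; simp [M.α_α])
    have h₆ : ∀ x, P x ↔ P (some (some e)) := by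
      rintro (_ | _ | x)
      · rw [h₄, h₃]
      · exact h₃
      · exact ⟨h₅ x e, h₅ e x⟩
    intro x y
    rw [h₆ x, h₆ y]
    exact id

end ins

/-- Any map in which the dart `none` starts at a leaf and `some none` is its reverse is obtained
by the insertion of a leaf, unless it has a component with a single edge. -/
theorem exists_ins {N : RibbonMap (Option (Option D))} (hσ : N.σ none = none)
    (hα : N.α none = some none) (h : N.σ (some none) ≠ some none) :
    ∃ (M : RibbonMap D) (e : D), M.ins e = N := by
  have hα' : N.α (some none) = none := by rw [← hα, N.α_α]
  have hσs : ∀ x, ∃ y, N.σ (some x) = some y := fun x => by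
    rw [← Option.ne_none_iff_exists']
    intro hx
    rw [← hσ] at hx
    exact Option.some_ne_none _ (N.σ.injective hx)
  have hαs : ∀ x, ∃ y, N.α (some (some x)) = some (some y) := fun x => by
    rcases hy : N.α (some (some x)) with _ | _ | y
    · rw [← hα'] at hy
      simpa using N.α.injective hy
    · rw [← hα] at hy
      simpa using N.α.injective hy
    · exact ⟨y, rfl⟩
  obtain ⟨τ, hτ⟩ : ∃ τ : Equiv.Perm (Option D), ∀ x, N.σ (some x) = some (τ x) :=
    ⟨Equiv.removeNone N.σ, fun x => (Equiv.removeNone_some _ (hσs x)).symm⟩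
  obtain ⟨e, he⟩ : ∃ e, τ none = some e := by
    rw [← Option.ne_none_iff_exists']
    intro hx
    exact h (by rw [hτ, hx])
  choose a ha using hαs
  have haa : ∀ x, a (a x) = x := fun x => by
    have := N.α_α (some (some x))
    rw [ha, ha] at this
    simpa using this
  refine ⟨⟨Equiv.removeNone τ, ⟨a, a, haa, haa⟩, haa, fun x hx => ?_⟩, e, ?_⟩
  · have := N.α_ne (some (some x))
    rw [ha] at this
    exact this (congrArg (some ∘ some) hx)
  · refine ext' (Equiv.ext ?_) (Equiv.ext ?_)
    · rintro (_ | _ | x)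
      · rw [hσ, ins_σ_none]
      · rw [hτ, he, ins_σ_some_none]
      · rw [hτ, ins_σ_some]
        congr 1
        by_cases hx : Equiv.removeNone τ x = e
        · rw [insPerm_some_of_eq hx]
          rcases hy : τ (some x) with _ | y
          · rfl
          · have := Equiv.removeNone_some τ ⟨y, hy⟩
            rw [hx, ← he] at this
            simpa using τ.injective this
        · rw [insPerm_some_of_ne hx]
          refine Equiv.removeNone_some τ ?_
          rw [← Option.ne_none_iff_exists']
          intro hy
          have := Equiv.removeNone_none τ hy
          rw [he] at this
          exact hx (Option.some.inj this)
    · rintro (_ | _ | x)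
      · rw [hα, ins_α_none]
      · rw [hα', ins_α_some_none]
      · rw [ha]
        rfl

theorem ins_injective {M N : RibbonMap D} {e f : D} (h : M.ins e = N.ins f) :
    M = N ∧ e = f := by
  classical
  have he : e = f := by
    have := congrArg (fun K => K.σ (some none)) h
    simpa using this
  subst he
  refine ⟨ext' ?_ (Equiv.ext fun x => ?_), rfl⟩
  · have h₁ : insPerm M.σ e = insPerm N.σ e := Equiv.optionCongr_injective (congrArg RibbonMap.σ h)
    exact Equiv.optionCongr_injective (mul_left_cancel h₁)
  · have := congrArg (fun K => K.α (some (some x))) h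
    simpa using this

end RibbonMap

/-! ### Irreducibility of covers, read in the base map through a monodromy -/

theorem ZMod.induction_add_one {k : ℕ} (hk : 0 < k) {P : ZMod k → Prop} (a : ZMod k) (h : P a)
    (hs : ∀ i, P i → P (i + 1)) (i : ZMod k) : P i := by
  have : NeZero k := ⟨hk.ne'⟩
  obtain ⟨n, hn⟩ := ZMod.natCast_zmod_surjective (i - a)
  obtain rfl : i = a + n := by rw [hn]; ring
  clear hn
  induction n with
  | zero => simpa using h
  | succ n ih =>
    have := hs _ ih
    rwa [Nat.cast_succ, ← add_assoc]

namespace RibbonMap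

open Equiv.Perm

variable {D E : Type} (M : RibbonMap D) {G H : Type*} [Group G] [Group H]

/-- A closed walk whose lifts to the cover of `M` with monodromy `h` are simple cycles. -/
def IsLiftedCycle (h : D → G) (k : ℕ) (c : ZMod k → D) : Prop :=
  0 < k ∧ (∀ i, M.origin (M.α (c i)) = M.origin (c (i + 1))) ∧
    (∃ w : ZMod k → G, (∀ i, w (i + 1) = w i * h (c i)) ∧
      Function.Injective fun i => (M.origin (c i), w i)) ∧ ∀ i, c (i + 1) ≠ M.α (c i)

/-- No edge of the map starts on the left of the closed walk `c`. -/
def LeftFree (k : ℕ) (c : ZMod k → D) : Prop := ∀ i, M.σ (M.α (c i)) = c (i + 1)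

/-- No edge of the map starts on the right of the closed walk `c`. -/
def RightFree (k : ℕ) (c : ZMod k → D) : Prop := ∀ i, M.σ (c (i + 1)) = M.α (c i)

/-- Irreducibility of the cover of `M` with monodromy `h`. -/
def CoverIrreducible (h : D → G) (b : ℕ) : Prop :=
  (∀ (k : ℕ) (c : ZMod k → D), M.IsLiftedCycle h k c → 2 * b ≤ k) ∧
    ∀ c : ZMod (2 * b) → D, M.IsLiftedCycle h (2 * b) c →
      M.LeftFree (2 * b) c ∨ M.RightFree (2 * b) c

variable {M}

theorem LeftFree.pow_φ {k : ℕ} {c : ZMod k → D} (h : M.LeftFree k c) (j : ℕ) (i : ZMod k) :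
    (M.φ)^[j] (c i) = c (i + j) := by
  induction j with
  | zero => simp
  | succ j ih => rw [Function.iterate_succ_apply', ih, φ_apply, h]; push_cast; congr 1; ring

theorem RightFree.pow_φ {k : ℕ} {c : ZMod k → D} (h : M.RightFree k c) (j : ℕ) (i : ZMod k) :
    (M.φ)^[j] (M.α (c i)) = M.α (c (i - j)) := by
  induction j with
  | zero => simp
  | succ j ih =>
    rw [Function.iterate_succ_apply', ih, φ_apply, M.α_α]
    have := h (i - j - 1)
    rw [sub_add_cancel] at this
    rw [this]; push_cast; congr 2; ring

/-- A simple cycle has a single dart starting at each of its vertices, so a contour with the same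
darts has to follow it in order. The resulting condition is local at each vertex, and so makes sense
below a cover. -/
theorem isFaceBoundary_iff {k : ℕ} {c : ZMod k → D} (hc : M.IsSimpleCycle k c) :
    M.IsFaceBoundary k c ↔ M.LeftFree k c ∨ M.RightFree k c := by
  obtain ⟨hk, hadj, hinj, -⟩ := hc
  have : NeZero k := ⟨hk.ne'⟩
  constructor
  · rintro ⟨f, hf | hf⟩
    · left
      intro i
      have h₁ : M.face (c i) = f := hf.ge ⟨i, rfl⟩
      obtain ⟨j, hj⟩ : M.φ (c i) ∈ Set.range c := hf.le ((M.face_φ _).trans h₁)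
      have h₂ : M.origin (c j) = M.origin (c (i + 1)) := by rw [hj, origin_φ, hadj]
      rw [← φ_apply, ← hj, hinj h₂]
    · right
      intro i
      have h₁ : M.face (M.α (c (i + 1))) = f := hf.ge ⟨i + 1, rfl⟩
      obtain ⟨j, hj⟩ : M.φ (M.α (c (i + 1))) ∈ Set.range fun i => M.α (c i) :=
        hf.le ((M.face_φ _).trans h₁)
      simp only [φ_apply, M.α_α] at hj
      have h₂ : M.origin (c (j + 1)) = M.origin (c (i + 1)) := by
        rw [← hadj, hj, origin_σ]
      rw [← hj, add_right_cancel (hinj h₂)]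
  · have key : ∀ a : ZMod k → D, ∀ ε : ZMod k, (∀ i, M.φ (a i) = a (i + ε)) →
        (∀ P : ZMod k → Prop, P 0 → (∀ i, P i → P (i + ε)) → ∀ i, P i) →
        {d | M.face d = M.face (a 0)} = Set.range a := by
      intro a ε h₁ h₂
      ext d
      constructor
      · intro hd
        have hinv : ∀ x, (M.φ x ∈ Set.range a) = (x ∈ Set.range a) := by
          refine fun x => propext ⟨?_, ?_⟩
          · rintro ⟨i, hi⟩
            refine ⟨i - ε, M.φ.injective ?_⟩
            rw [h₁, sub_add_cancel, hi]
          · rintro ⟨i, rfl⟩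
            exact ⟨i + ε, (h₁ i).symm⟩
        exact (SameCycle.apply_eq_of_invariant hinv (M.face_eq_iff.1 hd)).mpr ⟨0, rfl⟩
      · rintro ⟨i, rfl⟩
        refine h₂ (fun i => M.face (a i) = M.face (a 0)) rfl (fun i hi => ?_) i
        rw [← h₁, face_φ, hi]
    rintro (h | h)
    · exact ⟨M.face (c 0), Or.inl (key c 1 h fun P h₀ => ZMod.induction_add_one hk 0 h₀)⟩
    · refine ⟨M.face (M.α (c 0)), Or.inr (key (fun i => M.α (c i)) (-1) (fun i => ?_) ?_)⟩
      · have := h (i - 1)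
        rw [sub_add_cancel] at this
        rw [φ_apply, M.α_α, this, sub_eq_add_neg]
      · intro P h₀ hs i
        have := ZMod.induction_add_one hk (P := fun i => P (-i)) 0 (by simpa using h₀)
          (fun i hi => by
            have := hs _ hi
            rwa [neg_add]) (-i)
        simpa using this

/-- The planar case is the cover with trivial monodromy, so that g = 0 and g ≥ 1 share the lemmas
below. -/
theorem isSimpleCycle_iff {k : ℕ} {c : ZMod k → D} :
    M.IsSimpleCycle k c ↔ M.IsLiftedCycle (fun _ => (1 : Unit)) k c := by
  refine and_congr_right fun _ => and_congr_right fun _ => and_congr_left fun _ => ?_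
  constructor
  · exact fun h => ⟨fun _ => 1, fun _ => rfl, fun i j hij => h (congrArg Prod.fst hij)⟩
  · rintro ⟨w, -, h⟩ i j hij
    exact h (Prod.ext hij rfl)

variable (M) in
theorem irreducible_iff (b : ℕ) :
    M.Irreducible b ↔ M.CoverIrreducible (fun _ => (1 : Unit)) b := by
  refine and_congr (forall_congr' fun k => forall_congr' fun c => ?_)
    (forall_congr' fun c => ?_)
  · rw [isSimpleCycle_iff]
  · rw [← isSimpleCycle_iff]
    exact forall_congr' isFaceBoundary_iff

variable (M) in
theorem universalCover_origin_eq_iff (d₀ : D)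
    {x y : {y : D × M.HomotopyGroup // M.lifts.Reachable (d₀, 1) y}} :
    (M.universalCover d₀).origin x = (M.universalCover d₀).origin y ↔
      M.origin x.1.1 = M.origin y.1.1 ∧ x.1.2 = y.1.2 := by
  rw [origin_eq_iff, origin_eq_iff]
  have h : (M.universalCover d₀).σ.SameCycle x y ↔ M.lifts.σ.SameCycle x.1 y.1 :=
    sameCycle_subtypePerm (h := fun y => M.lifts.reachable_iff_of_mem
      (Subgroup.subset_closure (Set.mem_insert _ _)) (d₀, 1) y)
  rw [h]
  obtain ⟨⟨x, v⟩, _⟩ := x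
  obtain ⟨⟨y, w⟩, _⟩ := y
  constructor
  · intro h
    refine ⟨M.origin_eq_iff.1 ?_, ?_⟩
    · exact h.apply_eq_of_invariant (r := fun z => M.origin z.1) fun z => M.origin_σ z.1
    · exact h.apply_eq_of_invariant (r := fun z => z.2) fun z => rfl
  · rintro ⟨h, rfl : v = w⟩
    have := h.apply_eq_of_invariant (r := fun z => M.lifts.origin (z, v))
      fun z => M.lifts.origin_σ (z, v)
    exact M.lifts.origin_eq_iff.1 this

variable (M) in
-- Simple cycles upstairs project to lifted cycles, and a lifted cycle lifts back once its classes
-- are normalised to start at 1. The turning conditions at the vertices do not see the classes.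
theorem universalCover_irreducible_iff (b : ℕ) :
    (∀ d₀, (M.universalCover d₀).Irreducible b) ↔ M.CoverIrreducible M.cls b := by
  have hα : ∀ d₀ x, ((M.universalCover d₀).α x).1 = (M.α x.1.1, x.1.2 * M.cls x.1.1) :=
    fun _ _ => rfl
  have hσ : ∀ d₀ x, ((M.universalCover d₀).σ x).1 = (M.σ x.1.1, x.1.2) := fun _ _ => rfl
  have down : ∀ d₀ k c, (M.universalCover d₀).IsSimpleCycle k c ↔
      M.IsLiftedCycle M.cls k (fun i => (c i).1.1) ∧
        ∀ i, (c (i + 1)).1.2 = (c i).1.2 * M.cls (c i).1.1 := by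
    intro d₀ k c
    constructor
    · rintro ⟨hk, hadj, hinj, hnb⟩
      have hadj' := fun i => (M.universalCover_origin_eq_iff d₀).1 (hadj i)
      have hw : ∀ i, (c (i + 1)).1.2 = (c i).1.2 * M.cls (c i).1.1 := fun i => (hadj' i).2.symm
      refine ⟨⟨hk, fun i => (hadj' i).1, ⟨fun i => (c i).1.2, hw, fun i j hij => ?_⟩,
        fun i hi => hnb i (Subtype.ext (Prod.ext hi (hw i)))⟩, hw⟩
      exact hinj ((M.universalCover_origin_eq_iff d₀).2
        ⟨(Prod.mk.inj hij).1, (Prod.mk.inj hij).2⟩)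
    · rintro ⟨⟨hk, hadj, ⟨w, hw, hinj⟩, hnb⟩, hc⟩
      refine ⟨hk, fun i => (M.universalCover_origin_eq_iff d₀).2 ⟨hadj i, (hc i).symm⟩,
        fun i j hij => ?_, fun i hi => hnb i (congrArg (fun x => x.1.1) hi)⟩
      obtain ⟨h₁, h₂⟩ := (M.universalCover_origin_eq_iff d₀).1 hij
      -- Two families of classes along the same walk differ by a fixed left factor.
      have hconst : ∀ i, w i * (c i).1.2⁻¹ = w 0 * (c 0).1.2⁻¹ :=
        ZMod.induction_add_one hk 0 rfl fun i hi => by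
          rw [← hi, hw, hc]
          group
      refine hinj (Prod.ext h₁ ?_)
      have := (hconst i).trans (hconst j).symm
      rw [h₂] at this
      exact mul_right_cancel this
  have free : ∀ d₀ k c, (M.universalCover d₀).IsSimpleCycle k c →
      ((M.universalCover d₀).IsFaceBoundary k c ↔
        M.LeftFree k (fun i => (c i).1.1) ∨ M.RightFree k (fun i => (c i).1.1)) := by
    intro d₀ k c hc
    rw [isFaceBoundary_iff hc]
    have hw := ((down d₀ k c).1 hc).2
    refine or_congr (forall_congr' fun i => ?_) (forall_congr' fun i => ?_)
    · rw [Subtype.ext_iff, hσ, hα, Prod.ext_iff]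
      exact and_iff_left (hw i).symm
    · rw [Subtype.ext_iff, hσ, hα, Prod.ext_iff]
      exact and_iff_left (hw i)
  have up : ∀ k c, M.IsLiftedCycle M.cls k c →
      ∃ d₀ c', (M.universalCover d₀).IsSimpleCycle k c' ∧ c = fun i => (c' i).1.1 := by
    intro k c hc
    obtain ⟨hk, hadj, ⟨w, hw, -⟩, -⟩ := id hc
    have hreach : ∀ i, M.lifts.Reachable (c 0, 1) (c i, (w 0)⁻¹ * w i) := by
      refine ZMod.induction_add_one hk 0 ?_ fun i hi => ?_
      · rw [inv_mul_cancel]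
        exact ⟨1, one_mem _, rfl⟩
      · have h₁ : M.lifts.Reachable (c 0, 1) (M.lifts.α (c i, (w 0)⁻¹ * w i)) :=
          (M.lifts.reachable_iff_of_mem
            (Subgroup.subset_closure (Set.mem_insert_of_mem _ rfl)) _ _).2 hi
        have hinv : ∀ y, M.lifts.Reachable (c 0, 1) (M.σ y, (w 0)⁻¹ * w (i + 1)) =
            M.lifts.Reachable (c 0, 1) (y, (w 0)⁻¹ * w (i + 1)) := fun y =>
          propext (M.lifts.reachable_iff_of_mem
            (Subgroup.subset_closure (Set.mem_insert _ _)) _ (y, (w 0)⁻¹ * w (i + 1)))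
        refine ((M.origin_eq_iff.1 (hadj i)).apply_eq_of_invariant
          (r := fun y => M.lifts.Reachable (c 0, 1) (y, (w 0)⁻¹ * w (i + 1))) hinv).mp ?_
        simp only [hw]
        rw [ ← mul_assoc]
        exact h₁
    refine ⟨c 0, fun i => ⟨(c i, (w 0)⁻¹ * w i), hreach i⟩, (down _ _ _).2 ⟨hc, fun i => ?_⟩, rfl⟩
    exact (congrArg ((w 0)⁻¹ * ·) (hw i)).trans (mul_assoc _ _ _).symm
  constructor
  · intro h
    refine ⟨fun k c hc => ?_, fun c hc => ?_⟩
    · obtain ⟨d₀, c', hc', rfl⟩ := up k c hc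
      exact (h d₀).1 k c' hc'
    · obtain ⟨d₀, c', hc', rfl⟩ := up _ c hc
      exact (free d₀ _ c' hc').1 ((h d₀).2 c' hc')
  · intro h d₀
    refine ⟨fun k c hc => h.1 k _ ((down d₀ k c).1 hc).1, fun c hc => ?_⟩
    exact (free d₀ _ c hc).2 (h.2 _ ((down d₀ _ c).1 hc).1)

/-- Along a closed walk the positions stay in a single left coset of the image of `ι`, so enlarging
the group only adds disjoint copies of the cover. -/
theorem IsLiftedCycle.comp_injective_iff {h : D → G} {ι : G →* H} (hι : Function.Injective ι)
    {k : ℕ} {c : ZMod k → D} :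
    M.IsLiftedCycle (fun d => ι (h d)) k c ↔ M.IsLiftedCycle h k c := by
  refine and_congr_right fun hk => and_congr_right fun _ => and_congr_left fun _ => ?_
  constructor
  · rintro ⟨w, hw, hinj⟩
    have hv : ∀ i, ∃ v, w i = w 0 * ι v := by
      refine ZMod.induction_add_one hk 0 ⟨1, by simp⟩ ?_
      rintro i ⟨v, hv⟩
      exact ⟨v * h (c i), by rw [hw, hv, map_mul, mul_assoc]⟩
    choose v hv using hv
    refine ⟨v, fun i => hι (mul_left_cancel (a := w 0) ?_), fun i j hij => hinj ?_⟩
    · rw [← hv, hw, hv, map_mul, mul_assoc]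
    · simp only [Prod.mk.injEq] at hij ⊢
      rw [hv i, hv j, hij.2]
      exact ⟨hij.1, rfl⟩
  · rintro ⟨w, hw, hinj⟩
    refine ⟨fun i => ι (w i), fun i => by simp only [hw, map_mul], fun i j hij => hinj ?_⟩
    simp only [Prod.mk.injEq] at hij ⊢
    exact ⟨hij.1, hι hij.2⟩

theorem CoverIrreducible.comp_injective_iff {h : D → G} {ι : G →* H} (hι : Function.Injective ι)
    {b : ℕ} : M.CoverIrreducible (fun d => ι (h d)) b ↔ M.CoverIrreducible h b := by
  simp only [CoverIrreducible, IsLiftedCycle.comp_injective_iff hι]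

variable (M) in
/-- The monodromy `h` is trivial around all edges and all faces: there is a potential `u` along
the contours of the faces. -/
def IsFlat (h : D → G) : Prop :=
  (∀ d, h d * h (M.α d) = 1) ∧ ∃ u : D → G, ∀ d, u (M.φ d) = u d * h d

/-- The product of the monodromies of the first `k` darts of the contour that starts at `d`. -/
def contourProd (φ : Equiv.Perm D) (h : D → G) (d : D) (k : ℕ) : G :=
  (List.ofFn fun i : Fin k => h (φ^[(i : ℕ)] d)).prod

theorem contourProd_succ (φ : Equiv.Perm D) (h : D → G) (d : D) (k : ℕ) :
    contourProd φ h d (k + 1) = contourProd φ h d k * h (φ^[k] d) := by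
  rw [contourProd, List.ofFn_succ', List.prod_concat]
  rfl

@[simp] theorem contourProd_zero (φ : Equiv.Perm D) (h : D → G) (d : D) :
    contourProd φ h d 0 = 1 := by
  simp [contourProd]

theorem contourProd_add (φ : Equiv.Perm D) (h : D → G) (d : D) (k l : ℕ) :
    contourProd φ h d (k + l) = contourProd φ h d k * contourProd φ h (φ^[k] d) l := by
  induction l with
  | zero => simp
  | succ l ih =>
    rw [← add_assoc, contourProd_succ, ih, contourProd_succ, mul_assoc,
      ← Function.iterate_add_apply, add_comm l k]

theorem eq_mul_contourProd {φ : Equiv.Perm D} {h u : D → G} (hu : ∀ d, u (φ d) = u d * h d)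
    (d : D) (k : ℕ) : u (φ^[k] d) = u d * contourProd φ h d k := by
  induction k with
  | zero => simp
  | succ k ih => rw [Function.iterate_succ_apply', hu, ih, contourProd_succ, mul_assoc]

/-- Choose a representative in each cycle of `φ`; the potential at `d` is the product of `h` from
the representative to `d`, which does not depend on the number of turns. -/
theorem exists_potential [Finite D] {φ : Equiv.Perm D} {h : D → G}
    (hφ : ∀ d, contourProd φ h d (Function.minimalPeriod φ d) = 1) :
    ∃ u : D → G, ∀ d, u (φ d) = u d * h d := by
  have h₁ : ∀ d m, contourProd φ h d (Function.minimalPeriod φ d * m) = 1 := by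
    intro d m
    induction m with
    | zero => simp
    | succ m ih =>
      rw [mul_add, mul_one, contourProd_add, ih, one_mul,
        ((Function.isPeriodicPt_minimalPeriod φ d).mul_const m).eq, hφ]
  have h₂ : ∀ d k, φ^[k] d = d → contourProd φ h d k = 1 := by
    intro d k hk
    obtain ⟨m, rfl⟩ := Function.IsPeriodicPt.minimalPeriod_dvd (f := φ) (x := d) hk
    exact h₁ d m
  have h₃ : ∀ d k l, k ≤ l → φ^[k] d = φ^[l] d → contourProd φ h d k = contourProd φ h d l := by
    intro d k l hkl he
    obtain ⟨m, rfl⟩ := Nat.exists_eq_add_of_le hkl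
    rw [contourProd_add, h₂ (φ^[k] d) m, mul_one]
    rw [← Function.iterate_add_apply, add_comm, ← he]
  have h₄ : ∀ d k l, φ^[k] d = φ^[l] d → contourProd φ h d k = contourProd φ h d l := by
    intro d k l he
    rcases le_total k l with hkl | hkl
    · exact h₃ d k l hkl he
    · exact (h₃ d l k hkl he.symm).symm
  let rep : D → D := fun d => (Quotient.mk (SameCycle.setoid φ) d).out
  have hrep : ∀ d, rep (φ d) = rep d := fun d => congrArg Quotient.out
    (Quotient.sound (s := SameCycle.setoid φ) (sameCycle_apply_left.2 SameCycle.rfl))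
  have hk : ∀ d, ∃ k : ℕ, φ^[k] (rep d) = d := fun d => by
    obtain ⟨k, hk⟩ := SameCycle.exists_nat_pow_eq
      (Quotient.exact (Quotient.out_eq (Quotient.mk (SameCycle.setoid φ) d)) : φ.SameCycle (rep d) d)
    exact ⟨k, by rw [Equiv.Perm.iterate_eq_pow]; exact hk⟩
  choose k hk using hk
  refine ⟨fun d => contourProd φ h (rep d) (k d), fun d => ?_⟩
  have := contourProd_succ φ h (rep d) (k d)
  rw [hk d] at this
  simp only [hrep]
  rw [← this]
  refine h₄ _ _ _ ?_
  rw [Function.iterate_succ_apply', hk d, ← hrep d, hk (φ d)]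

variable (M) in
theorem isFlat_cls [Finite D] : M.IsFlat M.cls := by
  refine ⟨M.cls_mul_cls_α, exists_potential fun d => ?_⟩
  have h : PresentedGroup.mk M.homotopyRels (M.contourWord d) = 1 :=
    PresentedGroup.one_of_mem (Or.inr ⟨d, rfl⟩)
  rw [contourWord, map_list_prod, List.map_ofFn] at h
  exact h

/-- The potential returns to its value after a full contour, so the product around each face is
trivial and all homotopy relations hold in `G`. -/
theorem IsFlat.exists_hom {h : D → G} (hh : M.IsFlat h) :
    ∃ r : M.HomotopyGroup →* G, ∀ d, r (M.cls d) = h d := by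
  have hr : ∀ x ∈ M.homotopyRels, FreeGroup.lift h x = 1 := by
    rintro x (⟨d, rfl⟩ | ⟨d, rfl⟩)
    · simpa using hh.1 d
    · obtain ⟨u, hu⟩ := hh.2
      have h₁ := eq_mul_contourProd hu d (Function.minimalPeriod M.φ d)
      rw [Function.iterate_minimalPeriod, left_eq_mul] at h₁
      rw [contourWord, map_list_prod, List.map_ofFn]
      refine Eq.trans ?_ h₁
      rw [contourProd]
      congr 2
      funext i
      simp
  exact ⟨PresentedGroup.toGroup hr, fun d => PresentedGroup.toGroup.of hr⟩

/-- Flatness makes `h` factor through the homotopy group by some `ι`, and `r` is a left inverse of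
`ι`; hence `ι` is injective. This lets the homotopy group of a modified map stand in for that of the
original one. -/
theorem coverIrreducible_cls_iff {h : D → G} (hh : M.IsFlat h) {r : G →* M.HomotopyGroup}
    (hr : ∀ d, r (h d) = M.cls d) {b : ℕ} :
    M.CoverIrreducible M.cls b ↔ M.CoverIrreducible h b := by
  obtain ⟨ι, hι⟩ := hh.exists_hom
  have hid : r.comp ι = MonoidHom.id _ := PresentedGroup.ext fun d => by
    exact (congrArg r (hι d)).trans (hr d)
  have hinj : Function.Injective ι := Function.LeftInverse.injective
    (g := r) fun x => DFunLike.congr_fun hid x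
  rw [← CoverIrreducible.comp_injective_iff hinj]
  simp only [hι]

theorem coverIrreducible_map_iff (e : D ≃ E) {h : E → G} {b : ℕ} :
    (M.map e).CoverIrreducible h b ↔ M.CoverIrreducible (fun d => h (e d)) b := by
  have key : ∀ k (c : ZMod k → D), (M.map e).IsLiftedCycle h k (fun i => e (c i)) ↔
      M.IsLiftedCycle (fun d => h (e d)) k c := by
    intro k c
    simp only [IsLiftedCycle, map_α, map_origin_eq_iff, Function.Injective, Prod.mk.injEq, ne_eq,
      e.injective.eq_iff]
  have free : ∀ k (c : ZMod k → D), (M.map e).LeftFree k (fun i => e (c i)) ∨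
      (M.map e).RightFree k (fun i => e (c i)) ↔ M.LeftFree k c ∨ M.RightFree k c := by
    intro k c
    simp only [LeftFree, RightFree, map_α, map_σ, e.injective.eq_iff]
  have lift : ∀ {k} (c : ZMod k → E), ∃ c' : ZMod k → D, c = fun i => e (c' i) :=
    fun c => ⟨fun i => e.symm (c i), by simp⟩
  constructor
  · rintro ⟨h₁, h₂⟩
    exact ⟨fun k c hc => h₁ k _ ((key k c).2 hc),
      fun c hc => (free _ c).1 (h₂ _ ((key _ c).2 hc))⟩
  · rintro ⟨h₁, h₂⟩
    refine ⟨fun k c hc => ?_, fun c hc => ?_⟩ <;> obtain ⟨c, rfl⟩ := lift c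
    · exact h₁ k c ((key k c).1 hc)
    · exact (free _ c).2 (h₂ c ((key _ c).1 hc))

theorem IsFlat.of_map {e : D ≃ E} {h : E → G} (hh : (M.map e).IsFlat h) :
    M.IsFlat fun d => h (e d) := by
  obtain ⟨h₁, u, hu⟩ := hh
  exact ⟨fun d => by rw [← h₁ (e d), map_α], fun d => u (e d), fun d => by rw [← hu, map_φ]⟩

theorem IsFlat.map {h : D → G} (hh : M.IsFlat h) (e : D ≃ E) :
    (M.map e).IsFlat fun x => h (e.symm x) := by
  apply IsFlat.of_map (e := e.symm)
  rw [map_map, Equiv.self_trans_symm, map_refl]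
  exact hh

theorem essIrreducible_iff {g b : ℕ} : M.EssIrreducible g b ↔
    (g = 0 → M.CoverIrreducible (fun _ => (1 : Unit)) b) ∧
      (g ≠ 0 → M.CoverIrreducible M.cls b) := by
  rw [EssIrreducible, irreducible_iff, universalCover_irreducible_iff]

theorem essIrreducible_map_iff [Finite D] (e : D ≃ E) {g b : ℕ} :
    (M.map e).EssIrreducible g b ↔ M.EssIrreducible g b := by
  have : Finite E := Finite.of_equiv D e
  rw [essIrreducible_iff, essIrreducible_iff, coverIrreducible_map_iff, coverIrreducible_map_iff]
  refine and_congr_right fun _ => imp_congr_right fun _ => ?_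
  obtain ⟨r, hr⟩ := (M.isFlat_cls.map e).exists_hom
  exact (coverIrreducible_cls_iff (M.map e).isFlat_cls.of_map fun d => by simpa using hr (e d)).symm

end RibbonMap

/-! ### Effect of a leaf on irreducibility -/

namespace RibbonMap

open Equiv.Perm

variable {D E : Type} {M : RibbonMap D} {G H : Type*} [Group G] [Group H]

section ins

variable {e : D}

theorem isLiftedCycle_ins_iff {h : Option (Option D) → G} {k : ℕ} {c : ZMod k → D} :
    (M.ins e).IsLiftedCycle h k (fun i => some (some (c i))) ↔
      M.IsLiftedCycle (fun x => h (some (some x))) k c := by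
  simp only [IsLiftedCycle, ins_α_some_some, ins_origin_eq_iff, Function.Injective, Prod.mk.injEq,
    ne_eq, Option.some_inj]

/-- A walk that reaches a leaf can only leave it along the edge just traversed, which is excluded.
-/
theorem IsLiftedCycle.exists_eq_of_ins {h : Option (Option D) → G} {k : ℕ}
    {c : ZMod k → Option (Option D)} (hc : (M.ins e).IsLiftedCycle h k c) :
    ∃ c' : ZMod k → D, c = fun i => some (some (c' i)) := by
  obtain ⟨-, hadj, -, hnb⟩ := hc
  have key : ∀ i, ∃ x, c i = some (some x) := by
    intro i
    rcases hi : c i with _ | _ | x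
    · have h₁ := hadj (i - 1)
      have h₂ := hnb (i - 1)
      rw [sub_add_cancel, hi] at h₁ h₂
      exact absurd (origin_eq_of_σ_eq _ (M.ins_σ_none e) h₁).symm h₂
    · have h₁ := hadj i
      have h₂ := hnb i
      rw [hi, ins_α_some_none] at h₁ h₂
      exact absurd (origin_eq_of_σ_eq _ (M.ins_σ_none e) h₁.symm) h₂
    · exact ⟨x, rfl⟩
  choose c' hc' using key
  exact ⟨c', funext hc'⟩

/-- The new edge fills the corner just before `e`; it lies on the left of the cycle precisely when
the cycle turns through that corner and leaves along `e`. -/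
theorem leftFree_ins_iff {k : ℕ} {c : ZMod k → D} :
    (M.ins e).LeftFree k (fun i => some (some (c i))) ↔ M.LeftFree k c ∧ ∀ i, c i ≠ e := by
  have h₁ : ∀ i, (M.ins e).σ (some (some (M.α (c i)))) = some (some (c (i + 1))) ↔
      M.σ (M.α (c i)) = c (i + 1) ∧ c (i + 1) ≠ e := by
    intro i
    by_cases h : M.σ (M.α (c i)) = e
    · rw [ins_σ_some_some_of_eq M h]
      simp only [Option.some_inj, reduceCtorEq, ne_eq, false_iff, not_and, not_not]
      exact fun h' => h' ▸ h
    · rw [ins_σ_some_some_of_ne M h]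
      simp only [Option.some_inj, ne_eq, iff_self_and]
      exact fun h' => h' ▸ h
  refine (forall_congr' h₁).trans (forall_and.trans (and_congr_right fun _ => ?_))
  exact ⟨fun h i => by simpa using h (i - 1), fun h i => h _⟩

theorem rightFree_ins_iff {k : ℕ} {c : ZMod k → D} :
    (M.ins e).RightFree k (fun i => some (some (c i))) ↔
      M.RightFree k c ∧ ∀ i, M.α (c i) ≠ e := by
  refine (forall_congr' fun i => ?_).trans forall_and
  rw [ins_α_some_some]
  by_cases h : M.σ (c (i + 1)) = e
  · rw [ins_σ_some_some_of_eq M h]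
    simp only [Option.some_inj, reduceCtorEq, ne_eq, false_iff, not_and, not_not]
    exact fun h' => h' ▸ h
  · rw [ins_σ_some_some_of_ne M h]
    simp only [Option.some_inj, ne_eq, iff_self_and]
    exact fun h' => h' ▸ h

theorem ins_φ_none : (M.ins e).φ none = some (some e) := M.ins_σ_some_none e

theorem ins_φ_some_none : (M.ins e).φ (some none) = none := rfl

/-- The contour makes a detour along the new edge and back, whose total monodromy is trivial, so the
old potential still works. -/
theorem IsFlat.of_ins {h : Option (Option D) → G} (hh : (M.ins e).IsFlat h) :
    M.IsFlat fun x => h (some (some x)) := by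
  obtain ⟨h₁, u, hu⟩ := hh
  refine ⟨fun d => h₁ (some (some d)), fun x => u (some (some x)), fun x => ?_⟩
  by_cases hx : M.φ x = e
  · have h₂ := hu (some (some x))
    have h₃ := hu (some none)
    have h₄ := hu none
    rw [φ_apply, ins_α_some_some, ins_σ_some_some_of_eq M hx] at h₂
    rw [ins_φ_some_none] at h₃
    have h₅ : h (some none) * h none = 1 := h₁ (some none)
    rw [ins_φ_none, h₃, mul_assoc, h₅, mul_one, h₂] at h₄
    rw [hx]
    exact h₄
  · rw [← hu, φ_apply, φ_apply, ins_α_some_some, ins_σ_some_some_of_ne M hx]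

theorem IsFlat.ins {h : D → G} (hh : M.IsFlat h) (e : D) :
    (M.ins e).IsFlat fun x => Option.elim x 1 fun y => Option.elim y 1 h := by
  obtain ⟨h₁, u, hu⟩ := hh
  refine ⟨?_, fun x => Option.elim x (u e) fun y => Option.elim y (u e) u, ?_⟩
  · rintro (_ | _ | x)
    · simp
    · simp
    · exact h₁ x
  · rintro (_ | _ | x)
    · simp [ins_φ_none]
    · simp [ins_φ_some_none]
    · by_cases hx : M.φ x = e
      · rw [φ_apply, ins_α_some_some, ins_σ_some_some_of_eq M hx]
        simpa [hx] using hu x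
      · rw [φ_apply, ins_α_some_some, ins_σ_some_some_of_ne M hx]
        exact hu x

end ins

/-- The cycle follows a contour, so its position in the cover and the potential advance together. A
repeated dart would repeat a lifted vertex; hence the contour is run through exactly once. -/
theorem LeftFree.fdeg_eq [Finite D] {h : D → G} (hh : M.IsFlat h) {k : ℕ} {c : ZMod k → D}
    (hc : M.IsLiftedCycle h k c) (hl : M.LeftFree k c) (i : ZMod k) :
    M.fdeg (M.face (c i)) = k := by
  obtain ⟨hk, -, ⟨w, hw, hinj⟩, -⟩ := hc
  obtain ⟨-, u, hu⟩ := hh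
  have hconst : ∀ j, w j * (u (c j))⁻¹ = w 0 * (u (c 0))⁻¹ :=
    ZMod.induction_add_one hk 0 rfl fun j hj => by
      rw [← hj, hw, ← hl j, ← φ_apply, hu]
      group
  have hc : Function.Injective c := fun i j hij => by
    refine hinj (Prod.ext (congrArg M.origin hij) ?_)
    have := (hconst i).trans (hconst j).symm
    rw [hij] at this
    exact mul_right_cancel this
  rw [fdeg_face, cycDeg_eq_minimalPeriod]
  refine Nat.dvd_antisymm (Function.IsPeriodicPt.minimalPeriod_dvd ?_) ?_
  · rw [Function.IsPeriodicPt, Function.IsFixedPt, hl.pow_φ]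
    simp
  · have := hl.pow_φ (Function.minimalPeriod M.φ (c i)) i
    rw [Function.iterate_minimalPeriod] at this
    rw [← ZMod.natCast_eq_zero_iff]
    simpa using (hc this).symm

theorem RightFree.fdeg_eq [Finite D] {h : D → G} (hh : M.IsFlat h) {k : ℕ} {c : ZMod k → D}
    (hc : M.IsLiftedCycle h k c) (hl : M.RightFree k c) (i : ZMod k) :
    M.fdeg (M.face (M.α (c i))) = k := by
  obtain ⟨hk, -, ⟨w, hw, hinj⟩, -⟩ := hc
  obtain ⟨hα, u, hu⟩ := hh
  have hconst : ∀ j, w (j + 1) * (u (M.α (c j)))⁻¹ = w (0 + 1) * (u (M.α (c 0)))⁻¹ :=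
    ZMod.induction_add_one hk 0 rfl fun j hj => by
      have h₁ := hu (M.α (c (j + 1)))
      rw [φ_apply, M.α_α, hl j] at h₁
      rw [← hj, hw (j + 1), h₁, eq_inv_of_mul_eq_one_left (hα (c (j + 1)))]
      group
  have hc : Function.Injective c := fun i j hij => by
    refine hinj (Prod.ext (congrArg M.origin hij) ?_)
    have := (hconst i).trans (hconst j).symm
    rw [hij] at this
    have := mul_right_cancel this
    rw [hw, hw, hij] at this
    exact mul_right_cancel this
  rw [fdeg_face, cycDeg_eq_minimalPeriod]
  refine Nat.dvd_antisymm (Function.IsPeriodicPt.minimalPeriod_dvd ?_) ?_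
  · rw [Function.IsPeriodicPt, Function.IsFixedPt, hl.pow_φ]
    simp
  · have := hl.pow_φ (Function.minimalPeriod M.φ (M.α (c i))) i
    rw [Function.iterate_minimalPeriod] at this
    rw [← ZMod.natCast_eq_zero_iff]
    exact sub_eq_self.1 (hc (M.α.injective this)).symm

/-- Along the contour of a face without leaves, a closest pair of darts with the same lifted origin
gives a lifted cycle. -/
theorem isLiftedCycle_of_minimal {h u : D → G} (hα : ∀ d, h d * h (M.α d) = 1)
    (hu : ∀ d, u (M.φ d) = u d * h d) {F : Set D} (hF : ∀ d ∈ F, M.φ d ∈ F)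
    (hleaf : ∀ d ∈ F, M.φ d ≠ M.α d) {k : ℕ} (hk : 0 < k)
    (hmin : ∀ j, 0 < j → j < k → ∀ d ∈ F,
      ¬ (M.origin d = M.origin ((M.φ)^[j] d) ∧ u d = u ((M.φ)^[j] d)))
    {d : D} (hd : d ∈ F) (ho : M.origin d = M.origin ((M.φ)^[k] d)) (hud : u d = u ((M.φ)^[k] d)) :
    M.IsLiftedCycle h k fun i : ZMod k => (M.φ)^[i.val] d := by
  have : NeZero k := ⟨hk.ne'⟩
  have hFi : ∀ j : ℕ, (M.φ)^[j] d ∈ F := fun j => by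
    induction j with
    | zero => exact hd
    | succ j ih => rw [Function.iterate_succ_apply']; exact hF _ ih
  have hval : ∀ i : ZMod k, ((i + 1).val = i.val + 1 ∧ i.val + 1 < k) ∨
      ((i + 1).val = 0 ∧ i.val + 1 = k) := by
    intro i
    have hlt := ZMod.val_lt i
    have h₁ : i + 1 = ((i.val + 1 : ℕ) : ZMod k) := by simp
    rcases Nat.lt_or_ge (i.val + 1) k with h | h
    · exact Or.inl ⟨by rw [h₁, ZMod.val_natCast_of_lt h], h⟩
    · refine Or.inr ⟨?_, by omega⟩
      rw [h₁, show i.val + 1 = k by omega]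
      simp
  refine ⟨hk, fun i => ?_, ⟨fun i => u ((M.φ)^[i.val] d), fun i => ?_, ?_⟩, fun i => ?_⟩
  · rw [← origin_φ, ← Function.iterate_succ_apply' (f := M.φ)]
    beta_reduce
    rcases hval i with ⟨h₁, -⟩ | ⟨h₁, h₂⟩
    · rw [h₁]
    · rw [h₁, Nat.succ_eq_add_one, h₂, ← ho]
      rfl
  · rw [← hu, ← Function.iterate_succ_apply' (f := M.φ)]
    beta_reduce
    rcases hval i with ⟨h₁, -⟩ | ⟨h₁, h₂⟩
    · rw [h₁]
    · rw [h₁, Nat.succ_eq_add_one, h₂, ← hud]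
      rfl
  · have key : ∀ a b : ℕ, a < b → b < k → ¬ (M.origin ((M.φ)^[a] d) = M.origin ((M.φ)^[b] d) ∧
        u ((M.φ)^[a] d) = u ((M.φ)^[b] d)) := by
      intro a b hab hb
      have := hmin (b - a) (by omega) (by omega) _ (hFi a)
      rwa [← Function.iterate_add_apply, Nat.sub_add_cancel hab.le] at this
    intro i j hij
    obtain ⟨h₁, h₂⟩ := Prod.mk.inj hij
    rcases lt_trichotomy i.val j.val with hlt | heq | hlt
    · exact absurd ⟨h₁, h₂⟩ (key _ _ hlt (ZMod.val_lt j))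
    · exact ZMod.val_injective k heq
    · exact absurd ⟨h₁.symm, h₂.symm⟩ (key _ _ hlt (ZMod.val_lt i))
  · rcases hval i with ⟨h₁, -⟩ | ⟨h₁, h₂⟩
    · simp only [h₁]
      rw [Function.iterate_succ_apply' (f := M.φ)]
      exact hleaf _ (hFi _)
    · simp only [h₁, Function.iterate_zero, id_eq]
      -- If the cycle closes by running back along its first edge, then both ends can be trimmed:
      -- the origins of `φ d` and `φ^m d` agree in the cover, at distance `m - 1 = k - 2`. This
      -- contradicts minimality, or exhibits a leaf if `m = 1`.
      intro hback
      set m := i.val with hm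
      have hm0 : m ≠ 0 := by
        intro h0
        rw [h0] at hback
        exact M.α_ne d hback.symm
      have hback' : M.α d = (M.φ)^[m] d := by conv_lhs => rw [hback, M.α_α]
      have ho' : M.origin (M.φ d) = M.origin ((M.φ)^[m] d) := by rw [origin_φ, hback']
      have hu' : u (M.φ d) = u ((M.φ)^[m] d) := by
        have h₃ := hu ((M.φ)^[m] d)
        rw [← Function.iterate_succ_apply' (f := M.φ), Nat.succ_eq_add_one, h₂, ← hud,
          ← hback'] at h₃
        rw [hu, h₃, ← hback', mul_assoc]
        have h₄ := hα (M.α d)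
        rw [M.α_α] at h₄
        rw [h₄, mul_one]
      rcases Nat.lt_or_ge 1 m with h1 | h1
      · refine hmin (m - 1) (by omega) (by omega) (M.φ d) (hF _ hd) ?_
        rw [← Function.iterate_succ_apply, Nat.succ_eq_add_one, Nat.sub_add_cancel h1.le]
        exact ⟨ho', hu'⟩
      · have h3 : m = 1 := by omega
        rw [h3] at hback'
        exact hleaf d hd hback'.symm

/-- The contour closes up in the cover, so the smallest distance between two of its darts with the
same lifted origin is at most the degree. This distance is the length of a lifted cycle, hence at
least 2b. If the degree is 2b, the whole contour attains the minimum. -/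
theorem CoverIrreducible.two_mul_le_of_no_leaf [Finite D] {h : D → G} (hh : M.IsFlat h) {b : ℕ}
    (hM : M.CoverIrreducible h b) {d : D} (hleaf : ∀ x, M.face x = M.face d → M.φ x ≠ M.α x) :
    2 * b ≤ M.fdeg (M.face d) ∧ (M.fdeg (M.face d) = 2 * b →
      M.IsLiftedCycle h (2 * b) fun i : ZMod (2 * b) => (M.φ)^[i.val] d) := by
  classical
  obtain ⟨hα, u, hu⟩ := hh
  set F : Set D := {x | M.face x = M.face d} with hFdef
  have hF : ∀ x ∈ F, M.φ x ∈ F := fun x hx => (M.face_φ x).trans hx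
  let p := M.fdeg (M.face d)
  have hp : p = Function.minimalPeriod M.φ d :=
    (M.fdeg_face d).trans (cycDeg_eq_minimalPeriod _ _)
  have hpd : (M.φ)^[p] d = d := by rw [hp]; exact Function.iterate_minimalPeriod
  have hp0 : 0 < p := by
    have := cycDeg_pos M.φ d
    rwa [← fdeg_face] at this
  have hex : ∃ k, 0 < k ∧ ∃ x ∈ F, M.origin x = M.origin ((M.φ)^[k] x) ∧ u x = u ((M.φ)^[k] x) :=
    ⟨p, hp0, d, rfl, by rw [hpd], by rw [hpd]⟩
  have hmin := fun j (hj : 0 < j) (hjk : j < Nat.find hex) x (hx : x ∈ F) hxj =>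
    Nat.find_min hex hjk ⟨hj, x, hx, hxj⟩
  obtain ⟨hk, x, hx, hox, hux⟩ := Nat.find_spec hex
  have h₁ := hM.1 _ _ (isLiftedCycle_of_minimal hα hu hF hleaf hk hmin hx hox hux)
  have h₂ : Nat.find hex ≤ p := Nat.find_min' hex ⟨hp0, d, rfl, by rw [hpd], by rw [hpd]⟩
  refine ⟨h₁.trans h₂, fun h => ?_⟩
  have h₃ : Nat.find hex = 2 * b := le_antisymm (h₂.trans h.le) h₁
  rw [h₃] at hk hmin
  have h₄ : (M.φ)^[2 * b] d = d := by rw [← h]; exact hpd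
  exact isLiftedCycle_of_minimal hα hu hF hleaf hk hmin rfl (by rw [h₄]) (by rw [h₄])

variable (M) in
/-- The map is connected, of genus `g`, and has at least three faces if it is planar. -/
def IsGenus (g : ℕ) : Prop :=
  M.Connected ∧ 2 * (Nat.card M.Vertex + Nat.card M.Face + 2 * g) = Nat.card D + 4 ∧
    (g = 0 → 3 ≤ Nat.card M.Face)

theorem isGenus_ins_iff [Finite D] {e : D} {g : ℕ} : (M.ins e).IsGenus g ↔ M.IsGenus g := by
  rw [IsGenus, IsGenus, connected_ins_iff, card_vertex_ins, card_face_ins, Finite.card_option,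
    Finite.card_option]
  refine and_congr_right fun _ => and_congr_left fun _ => ?_
  omega

theorem isGenus_map_iff (e : D ≃ E) {g : ℕ} : (M.map e).IsGenus g ↔ M.IsGenus g := by
  rw [IsGenus, IsGenus, ← Nat.card_congr (M.mapVertexEquiv e), ← Nat.card_congr (M.mapFaceEquiv e),
    ← Nat.card_congr e]
  refine and_congr_left fun _ => ⟨fun h => ?_, fun h => h.map e⟩
  simpa [map_map] using h.map e.symm

/-- If both ends of an edge are leaves, connectedness leaves only this edge, and Euler's formula
rules it out. -/
theorem IsGenus.σ_α_ne [Finite D] {g : ℕ} (h : M.IsGenus g) {x : D} (hx : M.σ x = x) :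
    M.σ (M.α x) ≠ M.α x := by
  intro hαx
  obtain ⟨hc, hE, hg⟩ := h
  have hall : ∀ z, z = x ∨ z = M.α x := by
    intro z
    refine (M.connected_iff.1 hc).2 (fun z => z = x ∨ z = M.α x) (fun y => ?_) (fun y => ?_) x z
      (Or.inl rfl)
    · rw [← hx, M.σ.injective.eq_iff, hx, ← hαx, M.σ.injective.eq_iff, hαx]
    · rw [M.α.injective.eq_iff, or_comm]
      refine or_congr_right ⟨fun h => by rw [← h, M.α_α], fun h => by rw [h, M.α_α]⟩
  have hD : Nat.card D ≤ 2 := by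
    have := Nat.card_le_card_of_surjective (fun b : Bool => cond b x (M.α x)) fun z => by
      rcases hall z with rfl | rfl
      · exact ⟨true, rfl⟩
      · exact ⟨false, rfl⟩
    simpa using this
  have : Finite M.Vertex := inferInstanceAs (Finite (Quotient _))
  have : Finite M.Face := inferInstanceAs (Finite (Quotient _))
  have : Nontrivial M.Vertex := ⟨M.origin x, M.origin (M.α x), fun h =>
    M.α_ne x (M.origin_eq_of_σ_eq hx h.symm)⟩
  have : Nonempty M.Face := ⟨M.face x⟩
  have h₁ := Finite.one_lt_card (α := M.Vertex)
  have h₂ := Finite.card_pos (α := M.Face)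
  rcases Nat.eq_zero_or_pos g with rfl | hg'
  · have := hg rfl
    omega
  · omega

/-- A closed walk with no edge on either side is the whole map and all vertices have degree 2. Then
there are at least as many vertices as edges, which contradicts Euler's formula for g ≥ 1, and for g
= 0 because of the third face. -/
theorem IsGenus.not_leftFree_and_rightFree [Finite D] {g : ℕ} (h : M.IsGenus g) {k : ℕ}
    {c : ZMod k → D} (hnb : ∀ i, c (i + 1) ≠ M.α (c i)) (hl : M.LeftFree k c)
    (hr : M.RightFree k c) : False := by
  classical
  obtain ⟨hc, hE, hg⟩ := h
  have hall : ∀ z, M.σ z ≠ z ∧ M.σ (M.σ z) = z := by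
    have key : ∀ z, (∃ i, z = c i) ∨ ∃ i, z = M.α (c i) := by
      intro z
      refine (M.connected_iff.1 hc).2 (fun z => (∃ i, z = c i) ∨ ∃ i, z = M.α (c i))
        (fun y => ⟨?_, ?_⟩) (fun y => ⟨?_, ?_⟩) (c 0) z (Or.inl ⟨0, rfl⟩)
      · rintro (⟨i, hi⟩ | ⟨i, hi⟩)
        · have := hl (i - 1)
          rw [sub_add_cancel, ← hi] at this
          exact Or.inr ⟨_, (M.σ.injective this).symm⟩
        · rw [← hr i] at hi
          exact Or.inl ⟨_, M.σ.injective hi⟩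
      · rintro (⟨i, rfl⟩ | ⟨i, rfl⟩)
        · have := hr (i - 1)
          rw [sub_add_cancel] at this
          exact Or.inr ⟨_, this⟩
        · exact Or.inl ⟨_, hl i⟩
      · rintro (⟨i, hi⟩ | ⟨i, hi⟩)
        · exact Or.inr ⟨i, by rw [← hi, M.α_α]⟩
        · exact Or.inl ⟨i, M.α.injective hi⟩
      · rintro (⟨i, rfl⟩ | ⟨i, rfl⟩)
        · exact Or.inr ⟨i, rfl⟩
        · exact Or.inl ⟨i, M.α_α _⟩
    intro z
    rcases key z with ⟨i, rfl⟩ | ⟨i, rfl⟩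
    · have h₁ := hr (i - 1)
      have h₂ := hl (i - 1)
      have h₃ := hnb (i - 1)
      rw [sub_add_cancel] at h₁ h₂ h₃
      rw [h₁, h₂]
      exact ⟨h₃.symm, rfl⟩
    · rw [hl, hr]
      exact ⟨hnb i, rfl⟩
  have hcycle : ∀ y x, M.σ.SameCycle y x → y = x ∨ y = M.σ x := by
    intro y x hyx
    have := hyx.apply_eq_of_invariant (r := fun z => z = x ∨ z = M.σ x) fun z => propext (by
      constructor
      · rintro (hz | hz)
        · exact Or.inr (by rw [← hz, (hall z).2])
        · exact Or.inl (M.σ.injective hz)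
      · rintro (rfl | rfl)
        · exact Or.inr rfl
        · exact Or.inl (hall x).2)
    exact this.mpr (Or.inl rfl)
  have := Fintype.ofFinite D
  have hV : Nat.card D ≤ 2 * Nat.card M.Vertex := by
    have hle := Finset.card_le_mul_card_image (f := M.origin) (Finset.univ : Finset D) 2 ?_
    · rw [Finset.card_univ] at hle
      refine (Nat.card_eq_fintype_card (α := D)).le.trans (hle.trans ?_)
      rw [Nat.card_eq_fintype_card]
      exact Nat.mul_le_mul_left 2 (Finset.card_le_univ _)
    · intro v hv
      obtain ⟨x, rfl⟩ := M.origin_surjective v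
      refine (Finset.card_le_card (t := {x, M.σ x}) fun y hy => ?_).trans Finset.card_le_two
      have := hcycle y x (M.origin_eq_iff.1 (Finset.mem_filter.1 hy).2)
      simpa using this
  have : Finite M.Face := inferInstanceAs (Finite (Quotient _))
  have : Nonempty M.Face := ⟨M.face (c 0)⟩
  have h₂ := Finite.card_pos (α := M.Face)
  rcases Nat.eq_zero_or_pos g with rfl | hg'
  · have := hg rfl
    omega
  · omega

/-- A map with a leaf is obtained by the insertion of this leaf into a smaller map. -/
theorem IsGenus.exists_map_eq_ins [Finite D] {g : ℕ} (h : M.IsGenus g) {l : D} (hl : M.σ l = l) :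
    ∃ (D' : Type) (f : D ≃ Option (Option D')) (N : RibbonMap D') (e : D'),
      f l = none ∧ M.map f = N.ins e := by
  classical
  let l' : {y : D // y ≠ l} := ⟨M.α l, M.α_ne l⟩
  -- The outer `none` stands for the leaf dart `l`, the inner one for its reverse.
  let f : D ≃ Option (Option {z : {y : D // y ≠ l} // z ≠ l'}) :=
    (Equiv.optionSubtypeNe l).symm.trans (Equiv.optionSubtypeNe l').symm.optionCongr
  have hfl : f l = none := by simp [f]
  have hfl' : f (M.α l) = some none := by
    have : (Equiv.optionSubtypeNe l).symm (M.α l) = some l' :=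
      Equiv.optionSubtypeNe_symm_of_ne (M.α_ne l)
    change Equiv.optionCongr _ ((Equiv.optionSubtypeNe l).symm (M.α l)) = _
    rw [this]
    exact congrArg some (Equiv.optionSubtypeNe_symm_self l')
  obtain ⟨N, e, hN⟩ := exists_ins (N := M.map f) (by rw [← hfl, map_σ, hl])
    (by rw [← hfl', ← hfl, map_α]) (by
      rw [← hfl', map_σ, ne_eq, f.injective.eq_iff]
      exact h.σ_α_ne hl)
  exact ⟨_, f, N, e, hfl, hN.symm⟩

theorem CoverIrreducible.of_ins {h : Option (Option D) → G} {e : D} {b : ℕ}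
    (hM : (M.ins e).CoverIrreducible h b) :
    M.CoverIrreducible (fun x => h (some (some x))) b :=
  ⟨fun k _ hc => hM.1 k _ (isLiftedCycle_ins_iff.2 hc), fun _ hc =>
    (hM.2 _ (isLiftedCycle_ins_iff.2 hc)).imp (fun h => (leftFree_ins_iff.1 h).1)
      fun h => (rightFree_ins_iff.1 h).1⟩

/-- In an irreducible map, the faces have degree at least `2b`, and the contours of the faces of
degree `2b` are simple in the cover. -/
theorem IsGenus.two_mul_le_fdeg {g b : ℕ} [Finite D] (hM : M.IsGenus g) {h : D → G}
    (hh : M.IsFlat h) (hirr : M.CoverIrreducible h b) (d : D) :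
    2 * b ≤ M.fdeg (M.face d) ∧ (M.fdeg (M.face d) = 2 * b →
      M.IsLiftedCycle h (2 * b) fun i : ZMod (2 * b) => (M.φ)^[i.val] d) := by
  classical
  induction hn : Nat.card D using Nat.strong_induction_on generalizing D with
  | _ n ih =>
    by_cases hleaf : ∀ x, M.face x = M.face d → M.φ x ≠ M.α x
    · exact hirr.two_mul_le_of_no_leaf hh hleaf
    push Not at hleaf
    obtain ⟨x, hx, hφx⟩ := hleaf
    obtain ⟨D', f, N, e, hfl, hN⟩ := hM.exists_map_eq_ins (l := M.α x) hφx
    have hfin : Finite (Option (Option D')) := Finite.of_equiv D f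
    have : Finite D' := Finite.of_injective (fun y : D' => some (some y)) fun y z h => by simpa using h
    have hdeg : M.fdeg (M.face d) = N.fdeg (N.face e) + 2 := by
      have h₁ : M.face (M.α x) = M.face x := by rw [← hφx, face_φ]
      rw [← hx, ← h₁, ← map_fdeg M f, mapFaceEquiv_face, hfl, hN, ins_face_none,
        ← insFaceEquiv_face, fdeg_ins, if_pos rfl]
    have hM' := (isGenus_map_iff f).2 hM
    have hh' := hh.map f
    have hirr' : (M.map f).CoverIrreducible (fun y => h (f.symm y)) b := by
      rw [coverIrreducible_map_iff]
      simpa using hirr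
    rw [hN] at hM' hh' hirr'
    have hcard : Nat.card D' < n := by
      rw [← hn, Nat.card_congr f, Finite.card_option, Finite.card_option]
      omega
    have := (ih _ hcard (isGenus_ins_iff.1 hM') hh'.of_ins hirr'.of_ins e rfl).1
    -- Removing the leaf lowered the degree by two, so the face has degree at least 2b + 2 and the
    -- second claim is vacuous.
    exact ⟨by omega, fun h => by omega⟩

/-- The contour of a face of degree 2b is a lifted cycle. With a leaf inside that face it could only
bound a face on its other side, which `IsGenus.not_leftFree_and_rightFree` forbids. Conversely, a
leaf in another face obstructs no bounding cycle of length 2b. -/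
theorem coverIrreducible_ins_iff [Finite D] {g b : ℕ} (hM : M.IsGenus g) {e : D}
    {h : Option (Option D) → G} (hh : (M.ins e).IsFlat h) :
    (M.ins e).CoverIrreducible h b ↔
      M.CoverIrreducible (fun x => h (some (some x))) b ∧ M.fdeg (M.face e) ≠ 2 * b := by
  constructor
  · intro hirr
    refine ⟨hirr.of_ins, fun hdeg => ?_⟩
    have hc := (hM.two_mul_le_fdeg hh.of_ins hirr.of_ins e).2 hdeg
    have hk := hc.1
    have : NeZero (2 * b) := ⟨hk.ne'⟩
    have hl : M.LeftFree (2 * b) fun i : ZMod (2 * b) => (M.φ)^[i.val] e := by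
      intro i
      rw [← φ_apply, ← Function.iterate_succ_apply' (f := M.φ)]
      rw [fdeg_face, cycDeg_eq_minimalPeriod] at hdeg
      have h₁ : i + 1 = ((i.val + 1 : ℕ) : ZMod (2 * b)) := by simp
      beta_reduce
      rw [h₁, ZMod.val_natCast]
      have h₂ := Function.iterate_mod_minimalPeriod_eq (f := M.φ) (x := e) (n := i.val + 1)
      rw [hdeg] at h₂
      exact h₂.symm
    rcases hirr.2 _ (isLiftedCycle_ins_iff.2 hc) with h' | h'
    · exact (leftFree_ins_iff.1 h').2 0 (by simp)
    · exact hM.not_leftFree_and_rightFree hc.2.2.2 hl (rightFree_ins_iff.1 h').1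
  · rintro ⟨hirr, hdeg⟩
    refine ⟨fun k c hc => ?_, fun c hc => ?_⟩ <;>
      obtain ⟨c, rfl⟩ := hc.exists_eq_of_ins <;> rw [isLiftedCycle_ins_iff] at hc
    · exact hirr.1 k c hc
    · rcases hirr.2 c hc with h' | h'
      · refine Or.inl (leftFree_ins_iff.2 ⟨h', fun i hi => hdeg ?_⟩)
        rw [← hi]
        exact h'.fdeg_eq hh.of_ins hc i
      · refine Or.inr (rightFree_ins_iff.2 ⟨h', fun i hi => hdeg ?_⟩)
        rw [← hi]
        exact h'.fdeg_eq hh.of_ins hc i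

theorem isFlat_one : M.IsFlat fun _ => (1 : Unit) := ⟨fun _ => rfl, fun _ => 1, fun _ => rfl⟩

theorem essIrreducible_ins_iff [Finite D] {g b : ℕ} (hM : M.IsGenus g) {e : D} :
    (M.ins e).EssIrreducible g b ↔ M.EssIrreducible g b ∧ M.fdeg (M.face e) ≠ 2 * b := by
  rw [essIrreducible_iff, essIrreducible_iff, coverIrreducible_ins_iff hM isFlat_one,
    coverIrreducible_ins_iff hM (M.ins e).isFlat_cls]
  -- Classes extended by 1 on the new edge are flat for `M.ins e`; this yields the retraction needed
  -- to compare the two homotopy groups.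
  obtain ⟨r, hr⟩ := (M.isFlat_cls.ins e).exists_hom
  rw [← coverIrreducible_cls_iff (M.ins e).isFlat_cls.of_ins
    fun d => hr (some (some d))]
  tauto

variable (M) in
/-- Membership in the set of essentially `2b`-irreducible maps of genus `g` with faces of even
degree, on an arbitrary set of darts. -/
def IsAdmissible (g b : ℕ) : Prop :=
  M.IsGenus g ∧ (∀ f : M.Face, Even (M.fdeg f)) ∧ M.EssIrreducible g b

theorem isAdmissible_ins_iff [Finite D] {g b : ℕ} {e : D} :
    (M.ins e).IsAdmissible g b ↔ M.IsAdmissible g b ∧ M.fdeg (M.face e) ≠ 2 * b := by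
  classical
  have heven : (∀ f, Even ((M.ins e).fdeg f)) ↔ ∀ f, Even (M.fdeg f) := by
    rw [← (M.insFaceEquiv e).forall_congr_right]
    refine forall_congr' fun f => ?_
    rw [fdeg_ins]
    split_ifs
    · simp [Nat.even_add]
    · simp
  rw [IsAdmissible, IsAdmissible, isGenus_ins_iff, heven, and_assoc, and_assoc]
  refine and_congr_right fun h => ?_
  rw [essIrreducible_ins_iff h]

theorem isAdmissible_map_iff [Finite D] {g b : ℕ} (f : D ≃ E) :
    (M.map f).IsAdmissible g b ↔ M.IsAdmissible g b := by
  rw [IsAdmissible, IsAdmissible, isGenus_map_iff, essIrreducible_map_iff,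
    ← (M.mapFaceEquiv f).forall_congr_right]
  simp only [map_fdeg]

theorem IsAdmissible.two_mul_le_fdeg [Finite D] {g b : ℕ} (h : M.IsAdmissible g b) (f : M.Face) :
    2 * b ≤ M.fdeg f := by
  obtain ⟨d, rfl⟩ := M.face_surjective f
  have hirr := essIrreducible_iff.1 h.2.2
  rcases eq_or_ne g 0 with hg | hg
  · exact (h.1.two_mul_le_fdeg isFlat_one (hirr.1 hg) d).1
  · exact (h.1.two_mul_le_fdeg M.isFlat_cls (hirr.2 hg) d).1

theorem inMaps_iff {g b n : ℕ} {M : RibbonMap (Fin (2 * n))} :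
    InMaps g b n M ↔ M.IsAdmissible g b := by
  have : Nat.card M.Vertex + Nat.card M.Face + 2 * g = n + 2 ↔
      2 * (Nat.card M.Vertex + Nat.card M.Face + 2 * g) = Nat.card (Fin (2 * n)) + 4 := by
    rw [Nat.card_fin]
    omega
  rw [InMaps, IsAdmissible, IsGenus, this]
  tauto

end RibbonMap

/-! ### Enumeration of maps with marked leaves -/

section Enumeration

open Finset

theorem Derivation.map_finset_prod {R A ι : Type*} [CommRing R] [CommRing A] [Algebra R A]
    [DecidableEq ι] (d : Derivation R A A) (s : Finset ι) (x : ι → A) :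
    d (∏ i ∈ s, x i) = ∑ i ∈ s, (∏ j ∈ s.erase i, x j) * d (x i) := by
  induction s using Finset.induction_on with
  | empty => simp
  | insert a s ha ih =>
    rw [Finset.prod_insert ha, d.leibniz, ih, Finset.sum_insert ha, Finset.erase_insert ha,
      smul_eq_mul, smul_eq_mul, Finset.mul_sum, add_comm]
    congr 1
    refine Finset.sum_congr rfl fun i hi => ?_
    rw [Finset.erase_insert_of_ne (by rintro rfl; exact ha hi),
      Finset.prod_insert (fun h => ha (Finset.mem_of_mem_erase h)), mul_assoc]

namespace RibbonMap

variable {D E : Type} {K : Type*} [CommRing K]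

noncomputable instance [Finite D] : Fintype (RibbonMap D) := Fintype.ofFinite _

/-- `M` is an admissible map and `A` is a set of leaves of `M`. -/
def HasLeaves (g b : ℕ) (M : RibbonMap D) (A : Finset D) : Prop :=
  M.IsAdmissible g b ∧ ∀ a ∈ A, M.σ a = a

theorem hasLeaves_map_iff {g b : ℕ} [Finite D] {M : RibbonMap D} {A : Finset D} (e : D ≃ E) :
    HasLeaves g b (M.map e) (A.map e.toEmbedding) ↔ HasLeaves g b M A := by
  rw [HasLeaves, HasLeaves, isAdmissible_map_iff, forall_mem_map]
  simp

open Classical in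
/-- The weight of a map `M` with a set `A` of marked leaves. A face of degree `2m` with `a` marked
leaves has weight `X (m, a)`, and the vertices that are not marked leaves have weight `y`. -/
noncomputable def leafWeight (g b : ℕ) (y : K) [Finite D] (M : RibbonMap D) (A : Finset D) :
    MvPolynomial (ℕ × ℕ) K :=
  if HasLeaves g b M A then
    MvPolynomial.C (y ^ (Nat.card M.Vertex - #A)) *
      ∏ f : M.Face, MvPolynomial.X (M.fdeg f / 2, #{a ∈ A | M.face a = f})
  else 0

theorem leafWeight_map (g b : ℕ) (y : K) [Finite D] [Finite E] (M : RibbonMap D) (A : Finset D)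
    (e : D ≃ E) : leafWeight g b y (M.map e) (A.map e.toEmbedding) = leafWeight g b y M A := by
  classical
  unfold leafWeight
  rw [hasLeaves_map_iff, ← Nat.card_congr (M.mapVertexEquiv e), card_map,
    ← Equiv.prod_comp (M.mapFaceEquiv e)]
  congr 2
  refine prod_congr rfl fun f _ => ?_
  rw [map_fdeg]
  congr 2
  rw [filter_map, card_map]
  congr 1
  refine filter_congr fun a _ => ?_
  change (M.map e).face (e a) = _ ↔ _
  rw [← mapFaceEquiv_face, (M.mapFaceEquiv e).injective.eq_iff]

/-- The derivation that describes the insertion of one more leaf. -/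
noncomputable def leafDerivation (K : Type*) [CommRing K] (b : ℕ) :
    Derivation K (MvPolynomial (ℕ × ℕ) K) (MvPolynomial (ℕ × ℕ) K) :=
  MvPolynomial.mkDerivation K fun i =>
    (if i.1 = b then 0 else 2 * (i.1 : K) - i.2) • MvPolynomial.X (i.1 + 1, i.2 + 1)

theorem leafDerivation_X (b m a : ℕ) :
    leafDerivation K b (MvPolynomial.X (m, a)) =
      (if m = b then 0 else 2 * (m : K) - a) • MvPolynomial.X (m + 1, a + 1) :=
  MvPolynomial.mkDerivation_X _ _ _

/-- The marked leaves after the insertion of a new leaf. -/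
def insLeaf (A : Finset D) : Finset (Option (Option D)) := insertNone (A.map Function.Embedding.some)

theorem card_insLeaf (A : Finset D) : #(insLeaf A) = #A + 1 := by
  rw [insLeaf, card_insertNone, card_map]

/-- Inserting at a marked leaf would raise its degree to 2, hence the assumption `e ∉ A`. -/
theorem hasLeaves_ins_iff {g b : ℕ} [Finite D] {M : RibbonMap D} {A : Finset D} {e : D}
    (he : e ∉ A) : HasLeaves g b (M.ins e) (insLeaf A) ↔
      HasLeaves g b M A ∧ M.fdeg (M.face e) ≠ 2 * b := by
  have h : (∀ a ∈ insLeaf A, (M.ins e).σ a = a) ↔ ∀ a ∈ A, M.σ a = a := by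
    constructor
    · intro h a ha
      have h₁ := h (some (some a)) (by simp [insLeaf, ha])
      by_cases hx : M.σ a = e
      · rw [ins_σ_some_some_of_eq M hx] at h₁
        simp at h₁
      · rw [ins_σ_some_some_of_ne M hx] at h₁
        simpa using h₁
    · rintro h (_ | _ | a) ha
      · rfl
      · simp [insLeaf] at ha
      · have ha' : a ∈ A := by simpa [insLeaf] using ha
        rw [ins_σ_some_some_of_ne M (by rw [h a ha']; rintro rfl; exact he ha'), h a ha']
  rw [HasLeaves, HasLeaves, isAdmissible_ins_iff, h]
  tauto

open Classical in
theorem leafWeight_ins (g b : ℕ) (y : K) [Finite D] (M : RibbonMap D) (A : Finset D) (e : D)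
    (he : e ∉ A) :
    leafWeight g b y (M.ins e) (insLeaf A) =
      if HasLeaves g b M A ∧ M.fdeg (M.face e) ≠ 2 * b then
        MvPolynomial.C (y ^ (Nat.card M.Vertex - #A)) *
          ((∏ f ∈ univ.erase (M.face e), MvPolynomial.X (M.fdeg f / 2, #{a ∈ A | M.face a = f})) *
            MvPolynomial.X (M.fdeg (M.face e) / 2 + 1, #{a ∈ A | M.face a = M.face e} + 1))
      else 0 := by
  have hcount : ∀ f, #{a ∈ insLeaf A | (M.ins e).face a = M.insFaceEquiv e f} =
      #{a ∈ A | M.face a = f} + if M.face e = f then 1 else 0 := by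
    intro f
    rw [card_filter, card_filter, insLeaf, sum_insertNone, sum_map, add_comm]
    congr 1
    · refine sum_congr rfl fun a _ => ?_
      change (if (M.ins e).face (some (some a)) = _ then 1 else 0) = _
      rw [← insFaceEquiv_face, (M.insFaceEquiv e).injective.eq_iff]
    · rw [ins_face_none, ← insFaceEquiv_face, (M.insFaceEquiv e).injective.eq_iff]
  unfold leafWeight
  rw [hasLeaves_ins_iff he, card_vertex_ins, card_insLeaf, Nat.add_sub_add_right,
    ← Equiv.prod_comp (M.insFaceEquiv e), ← prod_erase_mul _ _ (mem_univ (M.face e))]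
  congr 3
  · refine prod_congr rfl fun f hf => ?_
    rw [hcount, fdeg_ins, if_neg (ne_of_mem_erase hf).symm, if_neg (ne_of_mem_erase hf).symm]
    rfl
  · rw [hcount, fdeg_ins, if_pos rfl, if_pos rfl, Nat.add_div_right _ two_pos]

/-- The Leibniz rule chooses the face that receives the leaf, and the coefficient of the derivation
counts its available corners. The power of `y` is unaffected, as the new vertex is marked. -/
theorem sum_leafWeight_ins (g b : ℕ) (y : K) [Fintype D] [DecidableEq D] (M : RibbonMap D)
    (A : Finset D) :
    ∑ e : D, (if e ∈ A then 0 else leafWeight g b y (M.ins e) (insLeaf A)) =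
      leafDerivation K b (leafWeight g b y M A) := by
  classical
  by_cases hM : HasLeaves g b M A
  · have hE : leafDerivation K b (leafWeight g b y M A) =
        ∑ f : M.Face, MvPolynomial.C (y ^ (Nat.card M.Vertex - #A)) *
          ((∏ f' ∈ univ.erase f, MvPolynomial.X (M.fdeg f' / 2, #{a ∈ A | M.face a = f'})) *
          (if M.fdeg f = 2 * b then 0 else (2 * ((M.fdeg f / 2 : ℕ) : K) - #{a ∈ A | M.face a = f}) •
            MvPolynomial.X (M.fdeg f / 2 + 1, #{a ∈ A | M.face a = f} + 1))) := by
      rw [leafWeight, if_pos hM, ← MvPolynomial.smul_eq_C_mul, Derivation.map_smul,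
        Derivation.map_finset_prod, smul_sum]
      refine sum_congr rfl fun f _ => ?_
      have : M.fdeg f / 2 = b ↔ M.fdeg f = 2 * b := by
        obtain ⟨m, hm⟩ := hM.1.2.1 f
        omega
      rw [leafDerivation_X, MvPolynomial.smul_eq_C_mul, ite_smul, zero_smul]
      simp only [this]
    set T : M.Face → MvPolynomial (ℕ × ℕ) K := fun f => MvPolynomial.C (y ^ (Nat.card M.Vertex - #A)) *
      ((∏ f' ∈ univ.erase f, MvPolynomial.X (M.fdeg f' / 2, #{a ∈ A | M.face a = f'})) *
        MvPolynomial.X (M.fdeg f / 2 + 1, #{a ∈ A | M.face a = f} + 1)) with hT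
    have hterm : ∀ e : D, (if e ∈ A then 0 else leafWeight g b y (M.ins e) (insLeaf A)) =
        ∑ f : M.Face, if M.face e = f then
          (if e ∈ A then 0 else if M.fdeg f = 2 * b then 0 else T f) else 0 := fun e => by
      rw [sum_ite_eq, if_pos (mem_univ _)]
      by_cases he : e ∈ A
      · rw [if_pos he, if_pos he]
      · rw [if_neg he, if_neg he, leafWeight_ins g b y M A e he]
        simp only [hM, true_and, ne_eq, ite_not, hT]
    rw [hE, sum_congr rfl fun e _ => hterm e, sum_comm]
    refine sum_congr rfl fun f _ => ?_
    -- The corners of a face correspond to its darts; those at marked leaves are unavailable.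
    have hcard : (#{e : D | M.face e = f ∧ e ∉ A} : K) =
        2 * ((M.fdeg f / 2 : ℕ) : K) - #{a ∈ A | M.face a = f} := by
      have h₁ : #{e : D | M.face e = f ∧ e ∉ A} + #{a ∈ A | M.face a = f} = M.fdeg f := by
        rw [fdeg, Nat.card_eq_fintype_card, Fintype.card_subtype,
          ← card_filter_add_card_filter_not (s := {e : D | M.face e = f}) (fun e => e ∉ A),
          filter_filter, filter_filter]
        congr 2
        ext a
        simp [and_comm]
      have h₂ : 2 * (M.fdeg f / 2) = M.fdeg f := Nat.two_mul_div_two_of_even (hM.1.2.1 f)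
      rw [eq_sub_iff_add_eq]
      have h₃ := congrArg (Nat.cast : ℕ → K) (h₁.trans h₂.symm)
      rwa [Nat.cast_add, Nat.cast_mul, Nat.cast_ofNat] at h₃
    by_cases hf : M.fdeg f = 2 * b
    · simp [hf]
    · rw [if_neg hf, if_neg hf, ← hcard, mul_smul_comm, mul_smul_comm, Nat.cast_smul_eq_nsmul,
        card_filter, sum_smul]
      refine sum_congr rfl fun e _ => ?_
      by_cases h₁ : M.face e = f <;> by_cases h₂ : e ∈ A <;> simp [h₁, h₂, hT]
  · rw [show leafWeight g b y M A = 0 from if_neg hM, map_zero]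
    refine sum_eq_zero fun e _ => ?_
    split_ifs with he
    · rfl
    · rw [leafWeight_ins g b y M A e he, if_neg (fun h => hM h.1)]

/-- The sum of the weights of the maps on the set of darts `D` with `k` marked leaves. -/
noncomputable def leafSum (g b : ℕ) (y : K) (k : ℕ) (D : Type) [Fintype D] :
    MvPolynomial (ℕ × ℕ) K :=
  ∑ M : RibbonMap D, ∑ A : Finset D, if #A = k then leafWeight g b y M A else 0

open Classical in
/-- The sum of the weights of the maps with `k` marked leaves, such that `l` is a marked leaf and
`t` is its reverse. -/
noncomputable def leafSumAt (g b : ℕ) (y : K) (k : ℕ) {D : Type} [Fintype D] (l t : D) :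
    MvPolynomial (ℕ × ℕ) K :=
  ∑ M : RibbonMap D, ∑ A : Finset D,
    if M.α l = t ∧ l ∈ A ∧ #A = k then leafWeight g b y M A else 0

theorem leafSumAt_map (g b : ℕ) (y : K) (k : ℕ) [Fintype D] [Fintype E] (e : D ≃ E) (l t : D) :
    leafSumAt g b y k (e l) (e t) = leafSumAt g b y k l t := by
  classical
  unfold leafSumAt
  rw [← Equiv.sum_comp (mapEquiv e)]
  refine sum_congr rfl fun M _ => ?_
  rw [← Equiv.sum_comp e.finsetCongr]
  refine sum_congr rfl fun A _ => ?_
  change (if (M.map e).α (e l) = e t ∧ e l ∈ A.map e.toEmbedding ∧ #(A.map e.toEmbedding) = k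
    then leafWeight g b y (M.map e) (A.map e.toEmbedding) else 0) = _
  rw [leafWeight_map, card_map, map_α, e.injective.eq_iff]
  simp

/-- Double counting: distinguish one of the k + 1 marked leaves; its reverse `t` is then determined.
-/
theorem succ_mul_leafSum (g b : ℕ) (y : K) (k : ℕ) [Fintype D] :
    ((k + 1 : ℕ) : MvPolynomial (ℕ × ℕ) K) * leafSum g b y (k + 1) D =
      ∑ l : D, ∑ t : D, leafSumAt g b y (k + 1) l t := by
  classical
  have h₁ : ∀ l : D, ∑ t : D, leafSumAt g b y (k + 1) l t = ∑ M : RibbonMap D, ∑ A : Finset D,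
      if l ∈ A ∧ #A = k + 1 then leafWeight g b y M A else 0 := by
    intro l
    unfold leafSumAt
    rw [sum_comm]
    refine sum_congr rfl fun M _ => ?_
    rw [sum_comm]
    refine sum_congr rfl fun A _ => ?_
    simp only [ite_and]
    rw [sum_ite_eq, if_pos (mem_univ _)]
  rw [sum_congr rfl fun l _ => h₁ l, sum_comm, leafSum, mul_sum]
  refine sum_congr rfl fun M _ => ?_
  rw [sum_comm, mul_sum]
  refine sum_congr rfl fun A _ => ?_
  simp only [ite_and, ← sum_filter]
  by_cases hA : #A = k + 1
  · simp [hA]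
  · simp [hA]

theorem insLeaf_injective : Function.Injective (insLeaf : Finset D → _) := fun A B h => by
  ext a
  have := congrArg (fun s => some (some a) ∈ s) h
  simpa [insLeaf] using this

theorem leafSumAt_none (g b : ℕ) (y : K) (k : ℕ) [Fintype D] :
    leafSumAt g b y (k + 1) (none : Option (Option D)) (some none) =
      leafDerivation K b (leafSum g b y k D) := by
  classical
  have key : leafDerivation K b (leafSum g b y k D) = ∑ p : RibbonMap D × D, ∑ A : Finset D,
      if #A = k then if p.2 ∈ A then 0 else leafWeight g b y (p.1.ins p.2) (insLeaf A) else 0 := by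
    rw [leafSum, map_sum, Fintype.sum_prod_type]
    refine sum_congr rfl fun M _ => ?_
    rw [map_sum, sum_comm]
    refine sum_congr rfl fun A _ => ?_
    split_ifs
    · exact (sum_leafWeight_ins g b y M A).symm
    · simp
  rw [key, leafSumAt]
  symm
  refine sum_of_injOn (fun p : RibbonMap D × D => p.1.ins p.2) ?_ (by simp) ?_ ?_
  · rintro ⟨M, e⟩ _ ⟨N, f⟩ _ h
    obtain ⟨h₁, h₂⟩ := ins_injective h
    exact Prod.ext h₁ h₂
  · intro N _ hN
    refine sum_eq_zero fun A _ => ?_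
    -- A map outside the image of `ins` contributes nothing: if its dart `none` were a marked leaf,
    -- the leaf could be removed.
    split_ifs with hA
    · unfold leafWeight
      refine if_neg fun hL => hN ?_
      have hσ := hL.2 none hA.2.1
      obtain ⟨M, e, rfl⟩ := exists_ins hσ hA.1 (by
        have := hL.1.1.σ_α_ne hσ
        rwa [hA.1] at this)
      exact ⟨(M, e), by simp, rfl⟩
    · rfl
  · rintro ⟨M, e⟩ _
    refine sum_of_injOn insLeaf insLeaf_injective.injOn (by simp) ?_ ?_
    · intro B _ hB
      split_ifs with h
      · unfold leafWeight
        refine if_neg fun hL => hB ⟨(univ.filter fun a => some (some a) ∈ B), by simp, ?_⟩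
        ext a
        rcases a with _ | _ | a
        · simpa [insLeaf] using h.2.1
        · simp only [insLeaf, mem_insertNone, Option.mem_def, Option.some_inj, forall_eq']
          refine iff_of_false (by simp) fun h' => ?_
          have := hL.2 _ h'
          simp at this
        · simp [insLeaf]
      · rfl
    · intro A _
      rw [card_insLeaf]
      by_cases hA : #A = k
      · have hcond : (M.ins e).α none = some none ∧ none ∈ insLeaf A ∧ #A + 1 = k + 1 :=
          ⟨rfl, by simp [insLeaf], by rw [hA]⟩
        rw [if_pos hA, if_pos hcond]
        split_ifs with he
        -- Inserting at the marked leaf `e` destroys that leaf, so the weight vanishes, in agreement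
        -- with the zero on the left.
        · unfold leafWeight
          refine (if_neg fun hL => ?_).symm
          have := hL.2 (some (some e)) (by simpa [insLeaf] using he)
          by_cases hx : M.σ e = e
          · rw [ins_σ_some_some_of_eq M hx] at this
            simp at this
          · rw [ins_σ_some_some_of_ne M hx] at this
            simp [hx] at this
        · rfl
      · rw [if_neg hA, if_neg (by simp [hA])]

/-- By relabelling, every ordered pair of distinct darts contributes the same amount as `none` and
`some none`; the numerical factor is the number of such pairs. -/
theorem leafSum_succ (g b : ℕ) (y : K) (k : ℕ) [Fintype D] [Fintype E]
    (h : Fintype.card E = Fintype.card D + 2) :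
    ((k + 1 : ℕ) : MvPolynomial (ℕ × ℕ) K) * leafSum g b y (k + 1) E =
      (((Fintype.card D + 2) * (Fintype.card D + 1) : ℕ) : MvPolynomial (ℕ × ℕ) K) *
        leafDerivation K b (leafSum g b y k D) := by
  classical
  rw [succ_mul_leafSum]
  have h₁ : ∀ l t : E, leafSumAt g b y (k + 1) l t =
      if l = t then 0 else leafDerivation K b (leafSum g b y k D) := by
    intro l t
    split_ifs with hlt
    · subst hlt
      refine sum_eq_zero fun M _ => sum_eq_zero fun A _ => if_neg fun h => M.α_ne _ h.1
    · rw [← leafSumAt_none]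
      obtain ⟨f, hf₁, hf₂⟩ : ∃ f : E ≃ Option (Option D), f l = none ∧ f t = some none := by
        have hcard : Fintype.card E = Fintype.card (Option (Option D)) := by simp [h]
        let f₀ := Fintype.equivOfCardEq hcard
        let f₁ := f₀.trans (Equiv.swap (f₀ l) none)
        refine ⟨f₁.trans (Equiv.swap (f₁ t) (some none)), ?_, ?_⟩
        · have h₁ : f₁ l = none := by simp [f₁]
          have h₂ : f₁ t ≠ none := fun h => hlt (f₁.injective (h₁.trans h.symm))
          rw [Equiv.trans_apply, h₁, Equiv.swap_apply_of_ne_of_ne h₂.symm (by simp)]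
        · simp
      rw [← leafSumAt_map g b y (k + 1) f, hf₁, hf₂]
  simp only [h₁, sum_ite, sum_const_zero, zero_add, sum_const, nsmul_eq_mul]
  have hc : ∀ l : E, #{t | ¬ l = t} = Fintype.card D + 1 := by
    intro l
    rw [filter_not, filter_eq, if_pos (mem_univ _), card_sdiff]
    simp [h]
  simp only [hc, sum_const, card_univ, h, nsmul_eq_mul]
  push_cast
  ring

end RibbonMap

/-! ### From isomorphism classes to labelled maps, and inclusion–exclusion over leaves -/

namespace RibbonMap

variable {D E : Type}

theorem autCard_eq (M : RibbonMap D) : M.autCard = Nat.card {p : Equiv.Perm D // M.map p = M} :=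
  Nat.card_congr (Equiv.subtypeEquivRight fun _ => isIso_iff)

/-- Orbit–stabiliser for the relabellings of the darts. -/
theorem card_orbit_mul_autCard [Fintype D] [DecidableEq D] (M : RibbonMap D) :
    Nat.card {N : RibbonMap D // ∃ p : Equiv.Perm D, M.map p = N} * M.autCard =
      (Fintype.card D).factorial := by
  rw [autCard_eq, ← Fintype.card_perm, ← Nat.card_eq_fintype_card, ← Nat.card_prod]
  refine Nat.card_congr (Equiv.ofBijective (fun x => x.2.1.trans x.1.2.choose) ⟨?_, ?_⟩)
  · rintro ⟨⟨N, hN⟩, ⟨p, hp⟩⟩ ⟨⟨N', hN'⟩, ⟨p', hp'⟩⟩ h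
    have h₁ : N = N' := by
      have := congrArg M.map h
      rwa [← map_map, ← map_map, hp, hp', hN.choose_spec, hN'.choose_spec] at this
    subst h₁
    have h₂ : p = p' := by
      ext x
      exact hN.choose.injective (DFunLike.congr_fun h x)
    subst h₂
    rfl
  · intro q
    have hN : ∃ p : Equiv.Perm D, M.map p = M.map q := ⟨q, rfl⟩
    refine ⟨⟨⟨M.map q, hN⟩, ⟨q.trans hN.choose.symm, ?_⟩⟩, ?_⟩
    · have := congrArg (fun N => N.map hN.choose.symm) hN.choose_spec
      rw [map_map, Equiv.self_trans_symm, map_refl] at this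
      rw [← map_map]
      exact this.symm
    · ext x
      simp

theorem autCard_pos [Finite D] (M : RibbonMap D) : 0 < M.autCard := by
  rw [autCard_eq]
  exact Nat.card_pos_iff.2 ⟨⟨⟨1, M.map_refl⟩⟩, inferInstance⟩

end RibbonMap

open RibbonMap

/-- The isomorphism class of a map. -/
def MapClass.mk {n : ℕ} {P : RibbonMap (Fin (2 * n)) → Prop} (M : {M // P M}) : MapClass P :=
  Quotient.mk (isoSetoid P) M

theorem MapClass.mk_eq_iff {n : ℕ} {P : RibbonMap (Fin (2 * n)) → Prop} {M : {M // P M}}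
    {c : MapClass P} : MapClass.mk M = c ↔ ∃ p : Equiv.Perm (Fin (2 * n)), c.rep.map p = M.1 := by
  have h : MapClass.mk (Quotient.out c) = c := Quotient.out_eq (s := isoSetoid P) c
  conv_lhs => rw [← h, eq_comm]
  exact (Quotient.eq (r := isoSetoid P)).trans (exists_congr fun p => isIso_iff)

open Classical in
-- A class has (2n)!/|Aut| labellings, so the symmetry factors disappear in favour of a global
-- 1/(2n)!.
theorem sumMaps_eq {n : ℕ} {P : RibbonMap (Fin (2 * n)) → Prop}
    {w : RibbonMap (Fin (2 * n)) → MvPolynomial ℕ ℚ} (hP : ∀ M p, P M → P (M.map p))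
    (hw : ∀ M p, P M → w (RibbonMap.map M p) = w M) :
    sumMaps n P w =
      MvPolynomial.C (1 / ((2 * n).factorial : ℚ)) * ∑ M, if P M then w M else 0 := by
  have h₁ : ∑ M, (if P M then w M else 0) = ∑ M : {M // P M}, w M := by
    rw [← sum_filter]
    exact sum_subtype _ (by simp) _
  rw [h₁, ← sum_fiberwise (g := MapClass.mk), sumMaps, mul_sum]
  refine sum_congr rfl fun c _ => ?_
  have hPrep : P c.rep := (Quotient.out c).2
  rw [sum_congr rfl (g := fun _ => w c.rep) (fun M hM => by
    obtain ⟨p, hp⟩ := MapClass.mk_eq_iff.1 (mem_filter.1 hM).2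
    rw [← hp, hw _ p hPrep]), sum_const, nsmul_eq_mul, ← mul_assoc]
  congr 1
  have hcard : #{M : {M // P M} | MapClass.mk M = c} =
      Nat.card {N : RibbonMap (Fin (2 * n)) // ∃ p : Equiv.Perm _, c.rep.map p = N} := by
    rw [← Fintype.card_subtype, ← Nat.card_eq_fintype_card]
    refine Nat.card_congr ⟨fun x => ⟨x.1.1, MapClass.mk_eq_iff.1 x.2⟩, fun x => ⟨⟨x.1, ?_⟩, MapClass.mk_eq_iff.2 x.2⟩,
      fun _ => rfl, fun _ => rfl⟩
    obtain ⟨p, hp⟩ := x.2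
    rw [← hp]
    exact hP _ _ hPrep
  have hmul := card_orbit_mul_autCard c.rep
  rw [← hcard, Fintype.card_fin] at hmul
  have hne : (c.rep.autCard : ℚ) ≠ 0 := by exact_mod_cast c.rep.autCard_pos.ne'
  have hne' : ((2 * n).factorial : ℚ) ≠ 0 := by exact_mod_cast (Nat.factorial_pos _).ne'
  rw [← map_natCast (MvPolynomial.C (σ := ℕ) (R := ℚ)), ← map_mul]
  congr 1
  rw [div_mul_eq_mul_div, one_mul, div_eq_div_iff hne hne', one_mul]
  exact_mod_cast hmul.symm

/-- The weight of the vertices. -/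
noncomputable def vertexWeight (b : ℕ) : MvPolynomial ℕ ℚ :=
  if b = 0 then 1 + MvPolynomial.X 0 else 1

theorem faceWeight_map {n : ℕ} (M : RibbonMap (Fin (2 * n))) (p : Equiv.Perm (Fin (2 * n))) :
    faceWeight (M.map p) = faceWeight M := by
  rw [faceWeight, ← Equiv.prod_comp (M.mapFaceEquiv p)]
  simp only [map_fdeg]
  rfl

theorem inMaps_map {g b n : ℕ} (M : RibbonMap (Fin (2 * n))) (p : Equiv.Perm (Fin (2 * n)))
    (h : InMaps g b n M) : InMaps g b n (M.map p) :=
  inMaps_iff.2 ((isAdmissible_map_iff p).2 (inMaps_iff.1 h))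

open Classical in
theorem partitionPart_eq (g b n : ℕ) : partitionPart g b n =
    MvPolynomial.C (1 / ((2 * n).factorial : ℚ)) * ∑ M : RibbonMap (Fin (2 * n)),
      if M.IsAdmissible g b then vertexWeight b ^ Nat.card M.Vertex * faceWeight M else 0 := by
  simp only [← inMaps_iff]
  unfold partitionPart vertexWeight
  split_ifs with hb
  · subst hb
    refine sumMaps_eq (fun M p h => inMaps_map M p h) fun M p _ => ?_
    rw [faceWeight_map, Nat.card_congr (M.mapVertexEquiv p)]
  · simp only [one_pow, one_mul]
    exact sumMaps_eq (fun M p h => inMaps_map M p h) fun M p _ => faceWeight_map M p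

theorem prod_vdeg_map {n : ℕ} (M : RibbonMap (Fin (2 * n))) (p : Equiv.Perm (Fin (2 * n)))
    (f : ℕ → MvPolynomial ℕ ℚ) :
    ∏ v : (M.map p).Vertex, f ((M.map p).vdeg v) = ∏ v : M.Vertex, f (M.vdeg v) := by
  rw [← Equiv.prod_comp (M.mapVertexEquiv p)]
  simp only [map_vdeg]

open Classical in
-- Unifies both definitions: for b = 0 the vertex weight is 1 + x_0 lowered by 1 at leaves, and for
-- b ≥ 1 the product is the indicator of having no leaf.
theorem hatPartitionPart_eq (g b n : ℕ) : hatPartitionPart g b n =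
    MvPolynomial.C (1 / ((2 * n).factorial : ℚ)) * ∑ M : RibbonMap (Fin (2 * n)),
      if M.IsAdmissible g b then
        (∏ v : M.Vertex, (vertexWeight b - if M.vdeg v = 1 then 1 else 0)) * faceWeight M
      else 0 := by
  simp only [← inMaps_iff]
  unfold hatPartitionPart vertexWeight
  split_ifs with hb
  · subst hb
    rw [sumMaps_eq (fun M p h => inMaps_map M p h) fun M p _ => by
      rw [faceWeight_map, prod_vdeg_map M p fun d => MvPolynomial.X 0 + if 2 ≤ d then 1 else 0]]
    congr 1
    refine sum_congr rfl fun M _ => ?_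
    congr 2
    refine prod_congr rfl fun v _ => ?_
    obtain ⟨x, rfl⟩ := M.origin_surjective v
    have := Equiv.Perm.cycDeg_pos M.σ x
    rw [vdeg_origin]
    rcases Nat.lt_or_ge (Equiv.Perm.cycDeg M.σ x) 2 with h | h
    · rw [if_neg (by omega), if_pos (by omega)]
      ring
    · rw [if_pos h, if_neg (by omega)]
      ring
  · rw [sumMaps_eq (P := InHatMaps g b n) (fun M p h => ⟨inMaps_map M p h.1, fun v => by
      obtain ⟨v, rfl⟩ := (M.mapVertexEquiv p).surjective v
      rw [map_vdeg]
      exact h.2 v⟩) fun M p _ => faceWeight_map M p]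
    congr 1
    refine sum_congr rfl fun M _ => ?_
    unfold InHatMaps
    by_cases h₁ : InMaps g b n M
    · by_cases h₂ : ∀ v : M.Vertex, M.vdeg v ≠ 1
      · rw [if_pos ⟨h₁, h₂⟩, if_pos h₁, prod_eq_one fun v _ => by rw [if_neg (h₂ v), sub_zero],
          one_mul]
      · rw [if_neg (fun h => h₂ h.2), if_pos h₁]
        push Not at h₂
        obtain ⟨v, hv⟩ := h₂
        rw [prod_eq_zero (mem_univ v) (by rw [if_pos hv, sub_self]), zero_mul]
    · rw [if_neg (fun h => h₁ h.1), if_neg h₁]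

open Classical in
theorem prod_vertex_sub {K : Type*} [CommRing K] {D : Type} [Fintype D] (M : RibbonMap D) (y : K) :
    ∏ v : M.Vertex, (y - if M.vdeg v = 1 then 1 else 0) =
      ∑ A : Finset D, if ∀ a ∈ A, M.σ a = a then (-1) ^ #A * y ^ (Nat.card M.Vertex - #A) else 0 := by
  set L : Finset D := {a | M.σ a = a} with hL
  have hcard : #{v : M.Vertex | M.vdeg v = 1} = #L := by
    symm
    refine card_bij (fun a _ => M.origin a) ?_ ?_ ?_
    · intro a ha
      rw [mem_filter, vdeg_origin, Equiv.Perm.cycDeg_eq_one_iff]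
      simpa [hL] using ha
    · intro a _ a' ha' h
      exact M.origin_eq_of_σ_eq (by simpa [hL] using ha') h
    · intro v hv
      obtain ⟨x, rfl⟩ := M.origin_surjective v
      rw [mem_filter, vdeg_origin, Equiv.Perm.cycDeg_eq_one_iff] at hv
      exact ⟨x, by simpa [hL] using hv, rfl⟩
  have hle : #L ≤ Nat.card M.Vertex := by
    rw [← hcard, Nat.card_eq_fintype_card]
    exact card_le_univ _
  have h₁ : ∏ v : M.Vertex, (y - if M.vdeg v = 1 then 1 else 0) =
      (-1 + y) ^ #L * y ^ (Nat.card M.Vertex - #L) := by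
    rw [prod_congr rfl fun v _ => show (y - if M.vdeg v = 1 then 1 else 0) =
      if M.vdeg v = 1 then -1 + y else y by split_ifs <;> ring, prod_ite, prod_const, prod_const,
      hcard, filter_not, card_sdiff_of_subset (filter_subset _ _), hcard, card_univ,
      Nat.card_eq_fintype_card]
  rw [h₁, ← sum_pow_mul_eq_add_pow, sum_mul, ← sum_filter]
  refine sum_congr ?_ fun A hA => ?_
  · ext A
    simp [hL, subset_iff]
  · have hA : #A ≤ #L := card_le_card fun a ha => by simpa [hL] using (mem_filter.1 hA).2 a ha
    rw [mul_assoc, ← pow_add]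
    congr 2
    omega

/-- Forget which leaves are marked. -/
noncomputable def forgetLeaves : MvPolynomial (ℕ × ℕ) (MvPolynomial ℕ ℚ) →ₐ[MvPolynomial ℕ ℚ]
    MvPolynomial ℕ ℚ := MvPolynomial.aeval fun i => MvPolynomial.X i.1

open Classical in
theorem forgetLeaves_leafWeight {g b n : ℕ} (y : MvPolynomial ℕ ℚ) (M : RibbonMap (Fin (2 * n)))
    (A : Finset (Fin (2 * n))) : forgetLeaves (leafWeight g b y M A) =
      if HasLeaves g b M A then y ^ (Nat.card M.Vertex - #A) * faceWeight M else 0 := by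
  unfold leafWeight forgetLeaves
  split_ifs
  · rw [map_mul, map_prod, ← MvPolynomial.algebraMap_eq, AlgHom.commutes]
    simp only [MvPolynomial.aeval_X]
    rfl
  · simp

/-- The generating polynomial of the maps with `n` edges and `k` marked leaves. -/
noncomputable def leafPart (g b k n : ℕ) : MvPolynomial (ℕ × ℕ) (MvPolynomial ℕ ℚ) :=
  MvPolynomial.C (MvPolynomial.C (1 / ((2 * n).factorial : ℚ))) *
    leafSum g b (vertexWeight b) k (Fin (2 * n))

theorem forgetLeaves_C (a : MvPolynomial ℕ ℚ) : forgetLeaves (MvPolynomial.C a) = a := by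
  rw [← MvPolynomial.algebraMap_eq, AlgHom.commutes]
  rfl

theorem hatPartitionPart_eq_sum (g b n : ℕ) : hatPartitionPart g b n =
    ∑ k ∈ range (2 * n + 1), (-1) ^ k * forgetLeaves (leafPart g b k n) := by
  classical
  have h : ∀ k, (-1) ^ k * forgetLeaves (leafPart g b k n) =
      MvPolynomial.C (1 / ((2 * n).factorial : ℚ)) * ∑ M : RibbonMap (Fin (2 * n)),
        ∑ A : Finset (Fin (2 * n)), if #A = k then
          if HasLeaves g b M A then
            (-1) ^ #A * vertexWeight b ^ (Nat.card M.Vertex - #A) * faceWeight M else 0 else 0 := by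
    intro k
    rw [leafPart, map_mul, forgetLeaves_C, leafSum, map_sum, mul_left_comm, mul_sum]
    congr 1
    refine sum_congr rfl fun M _ => ?_
    rw [map_sum, mul_sum]
    refine sum_congr rfl fun A _ => ?_
    split_ifs with h₁ h₂
    · rw [forgetLeaves_leafWeight, if_pos h₂, h₁, mul_assoc]
    · rw [forgetLeaves_leafWeight, if_neg h₂, mul_zero]
    · simp
  rw [sum_congr rfl fun k _ => h k, ← mul_sum, hatPartitionPart_eq]
  congr 1
  rw [sum_comm]
  refine sum_congr rfl fun M _ => ?_
  rw [sum_comm, prod_vertex_sub]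
  have h₂ : ∀ A : Finset (Fin (2 * n)), #A ∈ range (2 * n + 1) := fun A => by
    have := card_le_univ A
    rw [Fintype.card_fin] at this
    exact mem_range.2 (by omega)
  split_ifs with hM
  · rw [sum_mul]
    refine sum_congr rfl fun A _ => ?_
    rw [sum_ite_eq, if_pos (h₂ A), HasLeaves]
    simp only [hM, true_and]
    split_ifs <;> simp
  · refine (sum_eq_zero fun A _ => ?_).symm
    rw [sum_ite_eq, if_pos (h₂ A), if_neg (fun h => hM h.1)]

/-- The factor (2n+2)(2n+1) of `leafSum_succ` is absorbed by the ratio of the factorials. -/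
theorem leafPart_succ (g b k n : ℕ) :
    ((k + 1 : ℕ) : MvPolynomial (ℕ × ℕ) (MvPolynomial ℕ ℚ)) * leafPart g b (k + 1) (n + 1) =
      leafDerivation _ b (leafPart g b k n) := by
  have h := leafSum_succ g b (vertexWeight b) k (D := Fin (2 * n)) (E := Fin (2 * (n + 1)))
    (by simp only [Fintype.card_fin]; ring)
  rw [leafPart, leafPart, mul_left_comm, h, ← MvPolynomial.smul_eq_C_mul,
    ← MvPolynomial.smul_eq_C_mul, Derivation.map_smul, Fintype.card_fin,
    ← map_natCast (MvPolynomial.C (σ := ℕ × ℕ) (R := MvPolynomial ℕ ℚ)),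
    ← MvPolynomial.smul_eq_C_mul, smul_smul, ← map_natCast (MvPolynomial.C (σ := ℕ) (R := ℚ)),
    ← map_mul]
  congr 2
  rw [show 2 * (n + 1) = 2 * n + 1 + 1 by ring, Nat.factorial_succ, Nat.factorial_succ]
  have : ((2 * n).factorial : ℚ) ≠ 0 := by exact_mod_cast (Nat.factorial_pos _).ne'
  push_cast
  field_simp
  ring

theorem leafPart_succ_zero (g b k : ℕ) : leafPart g b (k + 1) 0 = 0 := by
  rw [leafPart, leafSum, sum_eq_zero fun M _ => sum_eq_zero fun A _ => if_neg fun h => ?_, mul_zero]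
  have := card_le_univ A
  rw [Fintype.card_fin] at this
  omega

theorem factorial_mul_leafPart (g b k n : ℕ) :
    ((k.factorial : ℕ) : MvPolynomial (ℕ × ℕ) (MvPolynomial ℕ ℚ)) * leafPart g b k n =
      if k ≤ n then (leafDerivation _ b)^[k] (leafPart g b 0 (n - k)) else 0 := by
  induction k generalizing n with
  | zero => simp
  | succ k ih =>
    rcases n with _ | n
    · simp [leafPart_succ_zero]
    · rw [Nat.factorial_succ, mul_comm (k + 1), Nat.cast_mul, mul_assoc, leafPart_succ,
        ← nsmul_eq_mul, ← map_nsmul, nsmul_eq_mul, ih]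
      split_ifs with h₁ h₂ h₂
      · rw [Function.iterate_succ_apply', Nat.add_sub_add_right]
      · omega
      · omega
      · simp

theorem hatPartitionPart_eq_sum_derivation (g b n : ℕ) : hatPartitionPart g b n =
    ∑ k ∈ range (n + 1), MvPolynomial.C ((-1) ^ k / (k.factorial : ℚ)) *
      forgetLeaves ((leafDerivation _ b)^[k] (leafPart g b 0 (n - k))) := by
  rw [hatPartitionPart_eq_sum]
  have h : ∀ k, (-1) ^ k * forgetLeaves (leafPart g b k n) = if k < n + 1 then
      MvPolynomial.C ((-1) ^ k / (k.factorial : ℚ)) *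
        forgetLeaves ((leafDerivation _ b)^[k] (leafPart g b 0 (n - k))) else 0 := by
    intro k
    have h₁ := congrArg forgetLeaves (factorial_mul_leafPart g b k n)
    have hk : (k.factorial : ℚ) ≠ 0 := by exact_mod_cast (Nat.factorial_pos k).ne'
    rw [map_mul, map_natCast] at h₁
    have h₂ : (-1) ^ k * forgetLeaves (leafPart g b k n) =
        MvPolynomial.C ((-1) ^ k / (k.factorial : ℚ)) *
          ((k.factorial : MvPolynomial ℕ ℚ) * forgetLeaves (leafPart g b k n)) := by
      rw [← mul_assoc, ← map_natCast (MvPolynomial.C (σ := ℕ) (R := ℚ)), ← map_mul,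
        div_mul_cancel₀ _ hk, map_pow, map_neg, map_one]
    rw [h₂, h₁]
    simp only [Nat.lt_succ_iff]
    split_ifs
    · rfl
    · simp
  rw [sum_congr rfl fun k _ => h k, ← sum_filter]
  congr 1
  ext k
  simp only [mem_filter, mem_range]
  omega

/-! ### Ballot numbers and the inversion of the matrices -/

/-- The ballot numbers, as differences of binomial coefficients. -/
def ballot (r p : ℕ) : ℚ := (2 * r + 1).choose (r + p) - (2 * r + 1).choose (r + p + 1)

/-- The inverse of the matrix of ballot numbers. -/
def ballotInv (p s : ℕ) : ℚ := (-1) ^ (p + s + 1) * (p + s).choose (2 * s + 1)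

theorem ballot_zero_right (r : ℕ) : ballot r 0 = 0 := by
  rw [ballot, add_zero, sub_eq_zero, ← Nat.choose_symm_half]

theorem ballot_eq_zero {r p : ℕ} (h : r + 2 ≤ p) : ballot r p = 0 := by
  rw [ballot, Nat.choose_eq_zero_of_lt (by omega), Nat.choose_eq_zero_of_lt (by omega), sub_self]

theorem ballot_succ (r p : ℕ) :
    ballot (r + 1) (p + 1) = ballot r p + 2 * ballot r (p + 1) + ballot r (p + 2) := by
  simp only [ballot, show 2 * (r + 1) + 1 = 2 * r + 1 + 1 + 1 by ring,
    show r + 1 + (p + 1) = r + p + 1 + 1 by ring, show r + (p + 1) = r + p + 1 by ring,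
    show r + (p + 2) = r + p + 1 + 1 by ring, Nat.choose_succ_succ' (2 * r + 1 + 1),
    Nat.choose_succ_succ' (2 * r + 1)]
  push_cast
  ring

theorem ballotInv_zero_left (s : ℕ) : ballotInv 0 s = 0 := by
  rw [ballotInv, Nat.choose_eq_zero_of_lt (by omega), Nat.cast_zero, mul_zero]

theorem ballotInv_rec_zero (q : ℕ) :
    ballotInv (q + 2) 0 + 2 * ballotInv (q + 1) 0 + ballotInv q 0 = 0 := by
  simp only [ballotInv, mul_zero, zero_add, add_zero, Nat.choose_one_right]
  push_cast
  ring

theorem ballotInv_rec_succ (q s : ℕ) :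
    ballotInv (q + 2) (s + 1) + 2 * ballotInv (q + 1) (s + 1) + ballotInv q (s + 1) =
      ballotInv (q + 1) s := by
  simp only [ballotInv, show q + 2 + (s + 1) = q + s + 1 + 1 + 1 by ring,
    show q + 1 + (s + 1) = q + s + 1 + 1 by ring, show q + (s + 1) = q + s + 1 by ring,
    show q + 1 + s = q + s + 1 by ring,
    show 2 * (s + 1) + 1 = 2 * s + 1 + 1 + 1 by ring, Nat.choose_succ_succ' (q + s + 1 + 1),
    Nat.choose_succ_succ' (q + s + 1)]
  push_cast
  ring

/-- Induction on `r`. The recurrence of the ballot numbers has weights 1, 2, 1; moved to the other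
factor by summation by parts, it becomes the recurrence of `ballotInv`, which lowers `s`. -/
theorem sum_ballot_mul_ballotInv (r s N : ℕ) (h : r + 1 ≤ N) :
    ∑ q ∈ range N, ballot r (q + 1) * ballotInv (q + 1) s = if r = s then 1 else 0 := by
  induction r generalizing s with
  | zero =>
    obtain ⟨N, rfl⟩ := Nat.exists_eq_add_of_le' h
    rw [sum_range_succ', sum_eq_zero fun q _ => by rw [ballot_eq_zero (by omega), zero_mul], zero_add]
    rcases s with _ | s
    · norm_num [ballot, ballotInv]
    · rw [ballotInv, Nat.choose_eq_zero_of_lt (by omega)]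
      simp
  | succ r ih =>
    -- The two telescoping sums perform the summation by parts; their boundary terms vanish.
    have h₁ := sum_range_sub (fun q => ballot r q * ballotInv (q + 1) s) N
    have h₂ := sum_range_sub (fun q => ballot r (q + 1) * ballotInv q s) N
    rw [ballot_zero_right, zero_mul, ballot_eq_zero (by omega), zero_mul, sub_zero] at h₁
    rw [ballotInv_zero_left, mul_zero, ballot_eq_zero (by omega), zero_mul, sub_zero] at h₂
    have h₃ : ∑ q ∈ range N, ballot (r + 1) (q + 1) * ballotInv (q + 1) s =
        ∑ q ∈ range N, ballot r (q + 1) *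
          (ballotInv (q + 2) s + 2 * ballotInv (q + 1) s + ballotInv q s) := by
      rw [← sub_eq_zero, ← sum_sub_distrib, ← sub_zero (0 : ℚ)]
      nth_rw 1 [← h₂]
      rw [← h₁, ← sum_sub_distrib]
      refine sum_congr rfl fun q _ => ?_
      rw [ballot_succ]
      ring
    rw [h₃]
    rcases s with _ | s
    · simp [ballotInv_rec_zero]
    · simp only [ballotInv_rec_succ]
      rw [ih s (by omega)]
      simp

/-- Outside column b the matrix does not depend on b, so one ballot identity serves all b. -/
theorem substA_of_lt {b ℓ p : ℕ} (h : b < p) : substA b (ℓ + 1) p = ballot ℓ p := by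
  obtain ⟨q, rfl⟩ := Nat.exists_eq_add_of_le' (show 1 ≤ p by omega)
  rw [substA, if_neg (by omega), zero_add]
  split_ifs with h₁
  · have h₂ : q ≤ ℓ := by omega
    have h₃ : (2 * (ℓ + 1)).choose (ℓ + 1 - (q + 1)) = (2 * ℓ + 1 + 1).choose (ℓ + q + 1 + 1) :=
      Nat.choose_symm_of_eq_add (by omega)
    have h₄ := Nat.choose_succ_right_eq (2 * ℓ + 1) (ℓ + q + 1)
    rw [show 2 * ℓ + 1 - (ℓ + q + 1) = ℓ - q by omega] at h₄
    have h₅ := congrArg (Nat.cast : ℕ → ℚ) h₄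
    rw [Nat.cast_mul, Nat.cast_mul, Nat.cast_sub h₂] at h₅
    rw [h₃, Nat.choose_succ_succ', ballot, ← add_assoc ℓ q 1]
    have h₆ : ((ℓ + 1 : ℕ) : ℚ) ≠ 0 := by positivity
    rw [div_mul_eq_mul_div, div_eq_iff h₆]
    push_cast at h₅ ⊢
    linear_combination h₅
  · rw [ballot_eq_zero (by omega)]

theorem substB_of_lt {b p ℓ : ℕ} (h : b < ℓ + 1) : substB b p (ℓ + 1) = ballotInv p ℓ := by
  rw [substB, if_neg (by omega), zero_add]
  split_ifs with h₁
  · obtain ⟨k, rfl⟩ := Nat.exists_eq_add_of_le h₁.1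
    rw [ballotInv, Nat.add_sub_cancel_left, show ℓ + 1 + k + ℓ + 1 = k + 2 * (ℓ + 1) by ring, pow_add,
      pow_mul, show ((-1 : ℚ)) ^ 2 = 1 by norm_num, one_pow, mul_one,
      show ℓ + 1 + k + (ℓ + 1) - 1 = ℓ + 1 + k + ℓ by omega]
    congr 2
    exact Nat.choose_symm_of_eq_add (by omega)
  · rw [ballotInv, Nat.choose_eq_zero_of_lt (by omega), Nat.cast_zero, mul_zero]

theorem substA_eq_zero {b ℓ p : ℕ} (h : ℓ < p) : substA b ℓ p = 0 := by
  rw [substA, if_neg (by omega), if_neg (by omega), add_zero]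

theorem substB_eq_zero {b p ℓ : ℕ} (h : p < ℓ) : substB b p ℓ = 0 := by
  rw [substB, if_neg (by omega), if_neg (by omega), add_zero]

theorem substA_self_right (b ℓ : ℕ) : substA b ℓ b = if ℓ = b then 1 else 0 := by
  simp [substA]

theorem substB_self_right (b p : ℕ) : substB b p b = if p = b then 1 else 0 := by
  simp [substB]

theorem substB_eq_zero_of_lt {b p ℓ : ℕ} (h : ℓ < b) : substB b p ℓ = 0 := by
  rw [substB, if_neg (by omega), if_neg (by omega), add_zero]

theorem substA_eq_zero_of_lt {b p ℓ : ℕ} (h : p < b) : substA b ℓ p = 0 := by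
  rw [substA, if_neg (by omega), if_neg (by omega), add_zero]

theorem sum_substA_mul_substB (b ℓ ℓ' : ℕ) {N : ℕ} (hN : ℓ < N) :
    ∑ p ∈ range N, substA b ℓ p * substB b p ℓ' = if ℓ = ℓ' ∧ b ≤ ℓ then 1 else 0 := by
  rcases lt_trichotomy ℓ' b with h | rfl | h
  · rw [if_neg (by omega)]
    exact sum_eq_zero fun p _ => by rw [substB_eq_zero_of_lt h, mul_zero]
  · simp only [substB_self_right, mul_ite, mul_one, mul_zero, sum_ite_eq', mem_range,
      substA_self_right]
    split_ifs <;> first | rfl | omega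
  · obtain ⟨s, rfl⟩ := Nat.exists_eq_add_of_le' (show 1 ≤ ℓ' by omega)
    rcases ℓ with _ | r
    · rw [if_neg (by omega)]
      refine sum_eq_zero fun p _ => ?_
      rcases Nat.lt_or_ge 0 p with hp | hp
      · rw [substA_eq_zero hp, zero_mul]
      · rw [substB_eq_zero (by omega), mul_zero]
    · have h₁ : ∀ p, substA b (r + 1) p * substB b p (s + 1) = ballot r p * ballotInv p s := by
        intro p
        rw [← substB_of_lt h]
        rcases Nat.lt_or_ge b p with hp | hp
        · rw [substA_of_lt hp]
        · rw [substB_eq_zero (by omega), mul_zero, mul_zero]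
      obtain ⟨N, rfl⟩ := Nat.exists_eq_add_of_le' (show 1 ≤ N by omega)
      rw [sum_congr rfl fun p _ => h₁ p, sum_range_succ', ballot_zero_right, zero_mul, add_zero,
        sum_ballot_mul_ballotInv r s N (by omega)]
      simp only [Nat.add_right_cancel_iff]
      split_ifs <;> first | rfl | omega

theorem matrix_substA_mul_substB (b m : ℕ) :
    (Matrix.of fun ℓ p : Finset.Icc b m => substA b ℓ p) *
      (Matrix.of fun p ℓ : Finset.Icc b m => substB b p ℓ) = 1 := by
  ext ⟨ℓ, hℓ⟩ ⟨ℓ', hℓ'⟩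
  rw [Matrix.mul_apply, Matrix.one_apply]
  simp only [Matrix.of_apply, Subtype.mk.injEq]
  have h := sum_substA_mul_substB b ℓ ℓ' (N := m + 1) (by rw [mem_Icc] at hℓ; omega)
  rw [sum_coe_sort (Finset.Icc b m) (fun p => substA b ℓ p * substB b p ℓ')]
  rw [sum_subset (s₂ := range (m + 1)) (fun p hp => by rw [mem_Icc] at hp; rw [mem_range]; omega)
    fun p hp hp' => ?_, h]
  · rw [mem_Icc] at hℓ
    simp [hℓ.1]
  · rw [substA_eq_zero_of_lt (by rw [mem_range] at hp; rw [mem_Icc] at hp'; omega), zero_mul]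

theorem matrix_substB_mul_substA (b m : ℕ) :
    (Matrix.of fun p ℓ : Finset.Icc b m => substB b p ℓ) *
      (Matrix.of fun ℓ p : Finset.Icc b m => substA b ℓ p) = 1 :=
  mul_eq_one_comm.1 (matrix_substA_mul_substB b m)

/-! ### Substitution of infinite linear forms -/

open MvPowerSeries in
theorem coeff_linearForm (c : ℕ → ℚ) (d : ℕ →₀ ℕ) :
    coeff d (linearForm c) = ∑ ℓ ∈ d.support, if d = Finsupp.single ℓ 1 then c ℓ else 0 := by
  change ∑ ℓ ∈ d.support, c ℓ * _ = _
  simp only [coeff_X, mul_ite, mul_one, mul_zero]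

open MvPowerSeries in
theorem coeff_linearForm_single (c : ℕ → ℚ) (ℓ : ℕ) :
    coeff (Finsupp.single ℓ 1) (linearForm c) = c ℓ := by
  rw [coeff_linearForm, Finsupp.support_single _ one_ne_zero, sum_singleton, if_pos rfl]

open MvPowerSeries in
theorem coeff_linearForm_of_ne {c : ℕ → ℚ} {d : ℕ →₀ ℕ} (h : ∀ ℓ, d ≠ Finsupp.single ℓ 1) :
    coeff d (linearForm c) = 0 := by
  rw [coeff_linearForm]
  exact sum_eq_zero fun ℓ _ => if_neg (h ℓ)

theorem hasSubst_linearForm {c : ℕ → ℕ → ℚ} (hc : ∀ ℓ p, ℓ < p → c ℓ p = 0) :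
    MvPowerSeries.HasSubst (fun p : ℕ => linearForm fun ℓ => c ℓ p) where
  const_coeff p := by
    have : MvPowerSeries.constantCoeff (linearForm fun ℓ => c ℓ p) = 0 := by
      rw [← MvPowerSeries.coeff_zero_eq_constantCoeff_apply, coeff_linearForm]
      simp
    rw [this]
    exact IsNilpotent.zero
  coeff_zero d := by
    by_cases h : ∃ ℓ, d = Finsupp.single ℓ 1
    · obtain ⟨ℓ, rfl⟩ := h
      refine (Set.finite_Iic ℓ).subset fun p hp => ?_
      by_contra h
      exact hp ((coeff_linearForm_single _ _).trans (hc _ _ (by simpa using h)))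
    · push Not at h
      refine Set.finite_empty.subset fun p hp => hp (coeff_linearForm_of_ne h)

theorem hasSubst_substA (b : ℕ) :
    MvPowerSeries.HasSubst (fun p : ℕ => linearForm fun ℓ => substA b ℓ p) :=
  hasSubst_linearForm fun _ _ h => substA_eq_zero h

theorem hasSubst_substB (b : ℕ) :
    MvPowerSeries.HasSubst (fun ℓ : ℕ => linearForm fun p => substB b p ℓ) :=
  hasSubst_linearForm fun _ _ h => substB_eq_zero h

open MvPowerSeries in
-- Composing linear substitutions multiplies their matrices, and AB = 1. For ℓ < b the relevant
-- column of B is zero.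
theorem subst_substA_linearForm (b ℓ : ℕ) :
    subst (fun p : ℕ => linearForm fun ℓ => substA b ℓ p) (linearForm fun p => substB b p ℓ) =
      if b ≤ ℓ then (X ℓ : MvPowerSeries ℕ ℚ) else 0 := by
  ext e
  rw [coeff_subst (hasSubst_substA b)]
  have hterm : ∀ p, coeff (Finsupp.single p 1) (linearForm fun p => substB b p ℓ) •
      coeff e ((Finsupp.single p 1).prod fun s n => (linearForm fun ℓ => substA b ℓ s) ^ n) =
      substB b p ℓ * coeff e (linearForm fun ℓ => substA b ℓ p) := by
    intro p
    rw [coeff_linearForm_single, Finsupp.prod_single_index (by simp), pow_one, smul_eq_mul]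
  by_cases he : ∃ ℓ', e = Finsupp.single ℓ' 1
  · obtain ⟨ℓ', rfl⟩ := he
    rw [finsum_eq_sum_of_support_subset
      (s := (range (ℓ' + 1)).map ⟨fun p => Finsupp.single p 1,
        Finsupp.single_left_injective one_ne_zero⟩), sum_map]
    · have h := sum_substA_mul_substB b ℓ' ℓ (Nat.lt_succ_self ℓ')
      simp only [Function.Embedding.coeFn_mk, hterm]
      simp only [coeff_linearForm_single]
      rw [sum_congr rfl fun p _ => mul_comm _ _, h]
      split_ifs with h₁ h₂ h₂
      · rw [h₁.1, coeff_X, if_pos rfl]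
      · omega
      · rw [coeff_X, if_neg fun h => h₁ ?_]
        have := Finsupp.single_left_injective one_ne_zero h
        omega
      · simp
    · intro d hd
      by_cases h : ∃ p, d = Finsupp.single p 1
      · obtain ⟨p, rfl⟩ := h
        simp only [coe_map, Function.Embedding.coeFn_mk, Set.mem_image, coe_range, Set.mem_Iio]
        refine ⟨p, ?_, rfl⟩
        by_contra hp
        refine hd ?_
        beta_reduce
        rw [hterm, coeff_linearForm_single, substA_eq_zero (by omega), mul_zero]
      · push Not at h
        refine absurd ?_ hd
        beta_reduce
        rw [coeff_linearForm_of_ne h, zero_smul]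
  · push Not at he
    have h₁ : coeff e (if b ≤ ℓ then (X ℓ : MvPowerSeries ℕ ℚ) else 0) = 0 := by
      split_ifs
      · rw [coeff_X, if_neg (he ℓ)]
      · simp
    rw [h₁]
    refine finsum_eq_zero_of_forall_eq_zero fun d => ?_
    by_cases h : ∃ p, d = Finsupp.single p 1
    · obtain ⟨p, rfl⟩ := h
      rw [hterm, coeff_linearForm_of_ne he, mul_zero]
    · push Not at h
      rw [coeff_linearForm_of_ne h, zero_smul]

/-- Irreducibility forces all faces to have degree at least 2b. -/
theorem le_of_mem_vars_partitionPart {g b n ℓ : ℕ} (h : ℓ ∈ (partitionPart g b n).vars) :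
    b ≤ ℓ := by
  classical
  rcases Nat.eq_zero_or_pos b with rfl | hb
  · exact Nat.zero_le _
  rw [partitionPart_eq, vertexWeight, if_neg hb.ne'] at h
  simp only [one_pow, one_mul] at h
  have h₁ := MvPolynomial.vars_mul _ _ h
  rw [MvPolynomial.vars_C, empty_union] at h₁
  obtain ⟨M, -, hM⟩ := mem_biUnion.1 (MvPolynomial.vars_sum_subset _ _ h₁)
  split_ifs at hM with hadm
  · obtain ⟨f, -, hf⟩ := mem_biUnion.1 (MvPolynomial.vars_prod _ hM)
    rw [MvPolynomial.vars_X, mem_singleton] at hf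
    have := hadm.two_mul_le_fdeg f
    omega
  · simp at hM

theorem coeff_partitionF (g b : ℕ) (d : ℕ →₀ ℕ) :
    MvPowerSeries.coeff d (partitionF g b) =
      (partitionPart g b (Finsupp.weight (fun ℓ : ℕ => ℓ) d)).coeff d :=
  finsum_eq_single _ _ fun _ hn => by
    by_contra h
    exact hn (partitionPart_homogeneous g b _ h).symm

theorem coeff_hatPartitionF (g b : ℕ) (d : ℕ →₀ ℕ) :
    MvPowerSeries.coeff d (hatPartitionF g b) =
      (hatPartitionPart g b (Finsupp.weight (fun ℓ : ℕ => ℓ) d)).coeff d :=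
  finsum_eq_single _ _ fun _ hn => by
    by_contra h
    exact hn (hatPartitionPart_homogeneous g b _ h).symm

open MvPowerSeries in
theorem subst_substA_subst_substB (g b : ℕ) :
    subst (fun p : ℕ => linearForm fun ℓ => substA b ℓ p)
      (subst (fun ℓ : ℕ => linearForm fun p => substB b p ℓ) (partitionF g b)) =
      partitionF g b := by
  rw [subst_comp_subst_apply (hasSubst_substB b) (hasSubst_substA b)]
  have hcomp : HasSubst fun ℓ : ℕ => subst (fun p : ℕ => linearForm fun ℓ => substA b ℓ p)
      (linearForm fun p => substB b p ℓ) := by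
    have := (hasSubst_substB b).comp (hasSubst_substA b)
    simpa only [coe_substAlgHom] using this
  simp only [subst_substA_linearForm] at hcomp ⊢
  conv_rhs => rw [← id_eq (partitionF g b), ← subst_self]
  ext e
  rw [coeff_subst hcomp, coeff_subst HasSubst.X]
  refine finsum_congr fun d => ?_
  -- The composite substitution fixes x_ℓ for ℓ ≥ b and kills the others, which do not occur in F.
  by_cases hd : coeff d (partitionF g b) = 0
  · rw [hd, zero_smul, zero_smul]
  · congr 2
    refine Finsupp.prod_congr fun ℓ hℓ => ?_
    rw [coeff_partitionF] at hd
    rw [if_pos (le_of_mem_vars_partitionPart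
      ((MvPolynomial.mem_vars_iff_mem_support _).2 ⟨d, MvPolynomial.mem_support_iff.2 hd, hℓ⟩))]

/-! ### Exponential of the leaf derivation -/

theorem Derivation.iterate_mul {R A : Type*} [CommRing R] [CommRing A] [Algebra R A]
    (d : Derivation R A A) (k : ℕ) (f g : A) :
    d^[k] (f * g) = ∑ ij ∈ antidiagonal k, (k.choose ij.1 : A) * (d^[ij.1] f * d^[ij.2] g) := by
  induction k with
  | zero => simp
  | succ k ih =>
    rw [Function.iterate_succ_apply', ih, map_sum,
      sum_antidiagonal_choose_succ_mul (fun i j => d^[i] f * d^[j] g), ← sum_add_distrib]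
    refine sum_congr rfl fun ij hij => ?_
    rw [← nsmul_eq_mul, map_nsmul, d.leibniz, nsmul_eq_mul, smul_eq_mul, smul_eq_mul,
      Function.iterate_succ_apply', Function.iterate_succ_apply',
      Nat.choose_symm_of_eq_add (HasAntidiagonal.mem_antidiagonal.1 hij).symm]
    ring

theorem Derivation.iterate_add {R A : Type*} [CommRing R] [CommRing A] [Algebra R A]
    (d : Derivation R A A) (k : ℕ) (f g : A) : d^[k] (f + g) = d^[k] f + d^[k] g := by
  induction k generalizing f g with
  | zero => rfl
  | succ k ih => rw [Function.iterate_succ_apply, map_add, ih]; rfl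

theorem Derivation.iterate_zero_right {R A : Type*} [CommRing R] [CommRing A] [Algebra R A]
    (d : Derivation R A A) (k : ℕ) : d^[k] (0 : A) = 0 := by
  induction k with
  | zero => rfl
  | succ k ih => rw [Function.iterate_succ_apply, map_zero, ih]

section LeafExp

theorem iterate_leafDerivation_C {K : Type*} [CommRing K] (b k : ℕ) (a : K) :
    (leafDerivation K b)^[k] (MvPolynomial.C a) = if k = 0 then MvPolynomial.C a else 0 := by
  rcases k with _ | k
  · rfl
  · rw [Function.iterate_succ_apply, ← MvPolynomial.algebraMap_eq, Derivation.map_algebraMap,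
      Derivation.iterate_zero_right, if_neg k.succ_ne_zero]

theorem iterate_leafDerivation_X_self {K : Type*} [CommRing K] (b k : ℕ) :
    (leafDerivation K b)^[k + 1] (MvPolynomial.X (b, 0)) = 0 := by
  rw [Function.iterate_succ_apply, leafDerivation_X, if_pos rfl, zero_smul,
    Derivation.iterate_zero_right]

/-- After k insertions the face has 2(m + k) corners, k of them at marked leaves, so the next factor
is 2m + k. -/
theorem iterate_leafDerivation_X_of_lt {K : Type*} [CommRing K] {b m : ℕ} (h : b < m) (k : ℕ) :
    (leafDerivation K b)^[k] (MvPolynomial.X (m, 0)) =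
      ((2 * m).ascFactorial k : K) • MvPolynomial.X (m + k, k) := by
  induction k with
  | zero => simp
  | succ k ih =>
    rw [Function.iterate_succ_apply', ih, Derivation.map_smul, leafDerivation_X,
      if_neg (by omega), smul_smul, Nat.ascFactorial_succ, add_assoc]
    congr 1
    push_cast
    ring

/-- The exponential of the derivation `-t * leafDerivation`, followed by the removal of the
marks. -/
noncomputable def leafExpFun (b : ℕ) (f : MvPolynomial (ℕ × ℕ) (MvPolynomial ℕ ℚ)) :
    PowerSeries (MvPolynomial ℕ ℚ) :=
  PowerSeries.mk fun k => MvPolynomial.C ((-1) ^ k / (k.factorial : ℚ)) *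
    forgetLeaves ((leafDerivation _ b)^[k] f)

theorem leafExpFun_C (b : ℕ) (a : MvPolynomial ℕ ℚ) :
    leafExpFun b (MvPolynomial.C a) = PowerSeries.C a := by
  ext1 k
  rw [leafExpFun, PowerSeries.coeff_mk, PowerSeries.coeff_C, iterate_leafDerivation_C]
  split_ifs with h
  · subst h
    simp
  · simp

/-- The higher Leibniz rule, with its binomial coefficients absorbed by the factorials. -/
theorem leafExpFun_mul (b : ℕ) (f g : MvPolynomial (ℕ × ℕ) (MvPolynomial ℕ ℚ)) :
    leafExpFun b (f * g) = leafExpFun b f * leafExpFun b g := by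
  ext1 k
  rw [PowerSeries.coeff_mul]
  simp only [leafExpFun, PowerSeries.coeff_mk]
  rw [Derivation.iterate_mul, map_sum, mul_sum]
  refine sum_congr rfl fun ij hij => ?_
  rw [HasAntidiagonal.mem_antidiagonal] at hij
  have h : (-1 : ℚ) ^ k / k.factorial * k.choose ij.1 =
      (-1) ^ ij.1 / ij.1.factorial * ((-1) ^ ij.2 / ij.2.factorial) := by
    subst hij
    have h₁ : ((ij.1.factorial : ℕ) : ℚ) ≠ 0 := by exact_mod_cast (Nat.factorial_pos _).ne'
    have h₂ : ((ij.2.factorial : ℕ) : ℚ) ≠ 0 := by exact_mod_cast (Nat.factorial_pos _).ne'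
    have h₃ : (((ij.1 + ij.2).factorial : ℕ) : ℚ) ≠ 0 := by
      exact_mod_cast (Nat.factorial_pos _).ne'
    rw [Nat.cast_add_choose, pow_add]
    field_simp
  rw [map_mul, map_mul, map_natCast, ← mul_assoc,
    ← map_natCast (MvPolynomial.C (σ := ℕ) (R := ℚ)), ← map_mul, h, map_mul]
  ring

/-- The homomorphism that removes the leaves from a generating function of maps. -/
noncomputable def leafExp (b : ℕ) : MvPolynomial (ℕ × ℕ) (MvPolynomial ℕ ℚ) →+*
    PowerSeries (MvPowerSeries ℕ ℚ) :=
  (PowerSeries.map MvPolynomial.coeToMvPowerSeries.ringHom).comp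
    { toFun := leafExpFun b
      map_one' := by rw [← MvPolynomial.C_1, leafExpFun_C, map_one]
      map_mul' := leafExpFun_mul b
      map_zero' := by rw [← MvPolynomial.C_0, leafExpFun_C, map_zero]
      map_add' := fun f g => by
        ext1 k
        simp only [leafExpFun, PowerSeries.coeff_mk, map_add, Derivation.iterate_add, mul_add] }

theorem coeff_leafExp (b k : ℕ) (f : MvPolynomial (ℕ × ℕ) (MvPolynomial ℕ ℚ)) :
    PowerSeries.coeff k (leafExp b f) =
      ((MvPolynomial.C ((-1) ^ k / (k.factorial : ℚ)) *
        forgetLeaves ((leafDerivation _ b)^[k] f) : MvPolynomial ℕ ℚ) : MvPowerSeries ℕ ℚ) := by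
  change PowerSeries.coeff k (PowerSeries.map MvPolynomial.coeToMvPowerSeries.ringHom
    (leafExpFun b f)) = _
  rw [PowerSeries.coeff_map, leafExpFun, PowerSeries.coeff_mk]
  rfl

theorem leafExp_C (b : ℕ) (a : MvPolynomial ℕ ℚ) :
    leafExp b (MvPolynomial.C a) = PowerSeries.C (a : MvPowerSeries ℕ ℚ) := by
  change PowerSeries.map MvPolynomial.coeToMvPowerSeries.ringHom
    (leafExpFun b (MvPolynomial.C a)) = _
  rw [leafExpFun_C, PowerSeries.map_C]
  rfl

theorem coeff_leafExp_X {b m : ℕ} (h : b ≤ m) (k : ℕ) :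
    PowerSeries.coeff k (leafExp b (MvPolynomial.X (m, 0))) =
      MvPowerSeries.C (substB b (m + k) m) * MvPowerSeries.X (m + k) := by
  rw [coeff_leafExp]
  rcases h.eq_or_lt with rfl | h
  · rw [substB_self_right]
    rcases k with _ | k
    · simp [forgetLeaves]
    · rw [iterate_leafDerivation_X_self]
      simp
  · rw [iterate_leafDerivation_X_of_lt h, map_smul, forgetLeaves, MvPolynomial.aeval_X,
      smul_eq_mul, ← mul_assoc, ← map_natCast (MvPolynomial.C (σ := ℕ) (R := ℚ)), ← map_mul,
      MvPolynomial.coe_mul, MvPolynomial.coe_C, MvPolynomial.coe_X]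
    congr 2
    rw [Nat.ascFactorial_eq_factorial_mul_choose', substB, if_neg (by omega), if_pos (by omega),
      zero_add, Nat.add_sub_cancel_left, show m + k + m - 1 = 2 * m + k - 1 by omega]
    have : ((k.factorial : ℕ) : ℚ) ≠ 0 := by exact_mod_cast (Nat.factorial_pos _).ne'
    push_cast
    field_simp

end LeafExp

/-! ### Weighted grading, and the substitution by B -/

section Grade

open MvPowerSeries

/-- The decomposition of a power series into weighted homogeneous components. -/
noncomputable def gradeHom : MvPowerSeries ℕ ℚ →+* PowerSeries (MvPowerSeries ℕ ℚ) where
  toFun f := PowerSeries.mk fun n => weightedHomogeneousComponent (fun ℓ : ℕ => ℓ) n f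
  map_one' := by
    ext n e
    rw [PowerSeries.coeff_mk, coeff_weightedHomogeneousComponent, coeff_one, PowerSeries.coeff_one]
    by_cases he : e = 0
    · subst he
      simp only [map_zero, if_true]
      rcases n with _ | n <;> simp
    · rw [if_neg he, ite_self]
      split_ifs
      · rw [coeff_one, if_neg he]
      · simp
  map_mul' f g := by
    classical
    ext n e
    rw [PowerSeries.coeff_mul, map_sum, PowerSeries.coeff_mk, coeff_weightedHomogeneousComponent]
    simp only [PowerSeries.coeff_mk, coeff_mul, coeff_weightedHomogeneousComponent]
    rw [sum_comm]
    have h : ∀ p ∈ antidiagonal e, ∑ x ∈ antidiagonal n,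
        ((if Finsupp.weight (fun ℓ : ℕ => ℓ) p.1 = x.1 then coeff p.1 f else 0) *
          if Finsupp.weight (fun ℓ : ℕ => ℓ) p.2 = x.2 then coeff p.2 g else 0) =
        if Finsupp.weight (fun ℓ : ℕ => ℓ) e = n then coeff p.1 f * coeff p.2 g else 0 := by
      intro p hp
      rw [HasAntidiagonal.mem_antidiagonal] at hp
      rw [← hp, map_add]
      by_cases hn : Finsupp.weight (fun ℓ : ℕ => ℓ) p.1 + Finsupp.weight (fun ℓ : ℕ => ℓ) p.2 = n
      · rw [if_pos hn, sum_eq_single_of_mem (Finsupp.weight (fun ℓ : ℕ => ℓ) p.1,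
          Finsupp.weight (fun ℓ : ℕ => ℓ) p.2) (HasAntidiagonal.mem_antidiagonal.2 hn), if_pos rfl, if_pos rfl]
        intro x _ hx
        by_cases h₁ : Finsupp.weight (fun ℓ : ℕ => ℓ) p.1 = x.1
        · rw [if_neg (c := Finsupp.weight (fun ℓ : ℕ => ℓ) p.2 = x.2)
            (fun h₂ => hx (Prod.ext h₁.symm h₂.symm)), mul_zero]
        · rw [if_neg h₁, zero_mul]
      · rw [if_neg hn]
        refine sum_eq_zero fun x hx => ?_
        rw [HasAntidiagonal.mem_antidiagonal] at hx
        by_cases h₁ : Finsupp.weight (fun ℓ : ℕ => ℓ) p.1 = x.1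
        · rw [if_neg (c := Finsupp.weight (fun ℓ : ℕ => ℓ) p.2 = x.2)
            (fun h₂ => hn (by rw [h₁, h₂, hx])), mul_zero]
        · rw [if_neg h₁, zero_mul]
    rw [sum_congr rfl h]
    split_ifs <;> simp
  map_zero' := by
    ext n e
    simp
  map_add' f g := by
    ext n e
    simp

theorem coeff_coeff_grade (f : MvPowerSeries ℕ ℚ) (n : ℕ) (e : ℕ →₀ ℕ) :
    coeff e (PowerSeries.coeff n (gradeHom f)) =
      if Finsupp.weight (fun ℓ : ℕ => ℓ) e = n then coeff e f else 0 := by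
  rw [← coeff_weightedHomogeneousComponent]
  exact congrArg (coeff e) (PowerSeries.coeff_mk n
    fun n => weightedHomogeneousComponent (fun ℓ : ℕ => ℓ) n f)

theorem grade_of_forall {f : MvPowerSeries ℕ ℚ}
    (h : ∀ e, coeff e f ≠ 0 → Finsupp.weight (fun ℓ : ℕ => ℓ) e = 0) :
    gradeHom f = PowerSeries.C f := by
  ext n e
  rw [coeff_coeff_grade, PowerSeries.coeff_C]
  by_cases he : coeff e f = 0
  · split_ifs <;> simp [he]
  · rw [h e he]
    simp only [eq_comm (a := 0)]
    split_ifs <;> simp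

/-- The homogeneous components of the substitution by `B`. -/
noncomputable def gradeSubstB (b : ℕ) : MvPolynomial ℕ ℚ →+* PowerSeries (MvPowerSeries ℕ ℚ) :=
  gradeHom.comp (MvPolynomial.aeval fun ℓ : ℕ => linearForm fun p => substB b p ℓ).toRingHom

theorem gradeSubstB_C (b : ℕ) (c : ℚ) : gradeSubstB b (MvPolynomial.C c) =
    PowerSeries.C ((MvPolynomial.C c : MvPolynomial ℕ ℚ) : MvPowerSeries ℕ ℚ) := by
  change gradeHom (MvPolynomial.aeval _ (MvPolynomial.C c)) = _
  rw [MvPolynomial.aeval_C, MvPolynomial.coe_C]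
  refine grade_of_forall fun e he => ?_
  change coeff e (C c) ≠ 0 at he
  rw [coeff_C] at he
  rw [of_not_not fun h => he (if_neg h), map_zero]

theorem linearForm_substB_self (b : ℕ) :
    linearForm (fun p => substB b p b) = (X b : MvPowerSeries ℕ ℚ) := by
  ext e
  by_cases he : ∃ ℓ, e = Finsupp.single ℓ 1
  · obtain ⟨ℓ, rfl⟩ := he
    rw [coeff_linearForm_single, substB_self_right, coeff_X]
    exact if_congr (Finsupp.single_left_injective one_ne_zero).eq_iff.symm rfl rfl
  · push Not at he
    rw [coeff_linearForm_of_ne he, coeff_X, if_neg (he b)]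

/-- For b = 0 the substitution fixes x_0, which has weight 0, so vertex weights behave as scalars.
-/
theorem gradeSubstB_vertexWeight (b : ℕ) :
    gradeSubstB b (vertexWeight b) = PowerSeries.C (vertexWeight b : MvPowerSeries ℕ ℚ) := by
  unfold vertexWeight
  split_ifs with hb
  · subst hb
    rw [map_add, map_one, MvPolynomial.coe_add, map_add, MvPolynomial.coe_one, map_one]
    congr 1
    change gradeHom (MvPolynomial.aeval _ (MvPolynomial.X 0)) = _
    rw [MvPolynomial.aeval_X, linearForm_substB_self, MvPolynomial.coe_X]
    refine grade_of_forall fun e he => ?_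
    rw [coeff_X] at he
    rw [of_not_not fun h => he (if_neg h), Finsupp.weight_single, smul_zero]
  · rw [map_one, MvPolynomial.coe_one, map_one]

theorem gradeSubstB_X {b m : ℕ} (h : b ≤ m) : gradeSubstB b (MvPolynomial.X m) =
    PowerSeries.X ^ m * leafExp b (MvPolynomial.X (m, 0)) := by
  ext n e
  rw [PowerSeries.coeff_X_pow_mul']
  change coeff e (PowerSeries.coeff n (gradeHom (MvPolynomial.aeval _ (MvPolynomial.X m)))) = _
  rw [MvPolynomial.aeval_X, coeff_coeff_grade]
  have h₁ : ∀ ℓ c, coeff e (C (σ := ℕ) (R := ℚ) c * X ℓ) = if e = Finsupp.single ℓ 1 then c else 0 :=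
    fun ℓ c => by rw [coeff_C_mul, coeff_X]; simp
  by_cases he : ∃ ℓ, e = Finsupp.single ℓ 1
  · obtain ⟨ℓ, rfl⟩ := he
    rw [coeff_linearForm_single, Finsupp.weight_single, one_smul]
    split_ifs with h₂ h₃ h₃
    · rw [coeff_leafExp_X h, h₁, show m + (n - m) = n by omega, if_pos (by rw [h₂]), h₂]
    · rw [substB_eq_zero (by omega), map_zero]
    · rw [coeff_leafExp_X h, h₁, show m + (n - m) = n by omega, if_neg]
      exact fun h => h₂ (Finsupp.single_left_injective one_ne_zero h)
    · rw [map_zero]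
  · push Not at he
    rw [coeff_linearForm_of_ne he, ite_self]
    split_ifs
    · rw [coeff_leafExp_X h, h₁, if_neg (he _)]
    · rw [map_zero]

/-- Both sides are multiplicative over the faces, so the comparison reduces to a single variable.
The powers t^m multiply to t^n, because the half-degrees of the faces sum to the number of edges. -/
theorem gradeSubstB_partitionPart (g b n : ℕ) : gradeSubstB b (partitionPart g b n) =
    PowerSeries.X ^ n * leafExp b (leafPart g b 0 n) := by
  classical
  rw [partitionPart_eq, leafPart, map_mul, map_mul, leafExp_C, gradeSubstB_C, mul_left_comm,
    leafSum]
  congr 1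
  rw [map_sum (gradeSubstB b), map_sum (leafExp b), mul_sum]
  refine sum_congr rfl fun M _ => ?_
  simp only [card_eq_zero]
  rw [sum_ite_eq', if_pos (mem_univ _), leafWeight, HasLeaves]
  simp only [notMem_empty, false_implies, implies_true, and_true, filter_empty, card_empty, tsub_zero]
  split_ifs with hM
  · rw [map_mul, map_mul, leafExp_C, map_pow, gradeSubstB_vertexWeight, MvPolynomial.coe_pow,
      map_pow, mul_left_comm, faceWeight, map_prod, map_prod]
    congr 1
    have hn : ∑ f : M.Face, M.fdeg f / 2 = n := by
      have h := sum_fdeg M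
      have h₁ : 2 * ∑ f : M.Face, M.fdeg f / 2 = 2 * n := by
        refine Eq.trans ?_ h
        rw [mul_sum]
        exact sum_congr rfl fun f _ => Nat.two_mul_div_two_of_even ((inMaps_iff.2 hM).2.2.1 f)
      omega
    have hX : (PowerSeries.X : PowerSeries (MvPowerSeries ℕ ℚ)) ^ n =
        ∏ f : M.Face, PowerSeries.X ^ (M.fdeg f / 2) := by
      rw [prod_pow_eq_pow_sum]
      exact congrArg _ hn.symm
    rw [hX, ← prod_mul_distrib]
    refine prod_congr rfl fun f _ => gradeSubstB_X ?_
    have := hM.two_mul_le_fdeg f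
    omega
  · rw [map_zero, map_zero, mul_zero]

theorem le_weightedOrder_linearForm {c : ℕ → ℚ} {ℓ : ℕ} (hc : ∀ p, p < ℓ → c p = 0) :
    (ℓ : ℕ∞) ≤ weightedOrder (fun ℓ : ℕ => ℓ) (linearForm c) := by
  refine nat_le_weightedOrder _ fun e he => ?_
  by_cases h : ∃ p, e = Finsupp.single p 1
  · obtain ⟨p, rfl⟩ := h
    rw [Finsupp.weight_single, one_smul] at he
    rw [coeff_linearForm_single, hc p he]
  · push Not at h
    exact coeff_linearForm_of_ne h

/-- The image of x_ℓ involves only variables of index at least ℓ, so the substitution never lowers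
the weight. -/
theorem coeff_subst_substB_eq_zero {b : ℕ} {f : MvPowerSeries ℕ ℚ} {e : ℕ →₀ ℕ}
    (hf : ∀ d, Finsupp.weight (fun ℓ : ℕ => ℓ) d ≤ Finsupp.weight (fun ℓ : ℕ => ℓ) e →
      coeff d f = 0) :
    coeff e (subst (fun ℓ : ℕ => linearForm fun p => substB b p ℓ) f) = 0 := by
  refine coeff_eq_zero_of_lt_weightedOrder (fun ℓ : ℕ => ℓ) ?_
  refine lt_of_lt_of_le ?_ (le_weightedOrder_subst _ (hasSubst_substB b) f)
  refine lt_of_lt_of_le (b := ((Finsupp.weight (fun ℓ : ℕ => ℓ) e + 1 : ℕ) : ℕ∞))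
    (by exact_mod_cast Nat.lt_succ_self _) ?_
  refine le_iInf fun d => le_iInf fun hd => ?_
  have h₁ : Finsupp.weight (fun ℓ : ℕ => ℓ) e + 1 ≤ Finsupp.weight (fun ℓ : ℕ => ℓ) d := by
    by_contra h
    exact hd (hf d (by omega))
  refine (Nat.cast_le.2 h₁).trans ?_
  rw [Finsupp.weight_apply, Finsupp.weight_apply, Finsupp.sum, Finsupp.sum, Nat.cast_sum]
  refine sum_le_sum fun ℓ _ => ?_
  rw [smul_eq_mul, Nat.cast_mul, nsmul_eq_mul]
  gcongr
  exact le_weightedOrder_linearForm fun p hp => substB_eq_zero hp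

theorem hatPartitionF_eq_subst (g b : ℕ) : hatPartitionF g b =
    subst (fun ℓ : ℕ => linearForm fun p => substB b p ℓ) (partitionF g b) := by
  ext e
  set N := Finsupp.weight (fun ℓ : ℕ => ℓ) e with hN
  -- Parts of weight above N do not affect the coefficient of `e`; truncating leaves a polynomial,
  -- to which the ring homomorphism `gradeSubstB` applies.
  set P : MvPolynomial ℕ ℚ := ∑ n ∈ range (N + 1), partitionPart g b n with hP
  have h₁ : coeff e (subst (fun ℓ : ℕ => linearForm fun p => substB b p ℓ)
      (partitionF g b - (P : MvPowerSeries ℕ ℚ))) = 0 := by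
    refine coeff_subst_substB_eq_zero fun d hd => ?_
    rw [map_sub, coeff_partitionF, MvPolynomial.coeff_coe, hP, MvPolynomial.coeff_sum,
      sum_eq_single_of_mem _ (mem_range.2 (Nat.lt_succ_of_le hd)), sub_self]
    intro n _ hn
    by_contra h
    exact hn (partitionPart_homogeneous g b n h).symm
  rw [subst_sub (hasSubst_substB b), map_sub, sub_eq_zero] at h₁
  rw [h₁, coeff_hatPartitionF, ← hN, hatPartitionPart_eq_sum_derivation, subst_coe, hP, map_sum,
    map_sum, MvPolynomial.coeff_sum, ← sum_range_reflect]
  refine sum_congr rfl fun n hn => ?_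
  have hn : n ≤ N := Nat.lt_succ_iff.1 (mem_range.1 hn)
  -- The coefficient of t^N selects the N - n insertions that lead from n to N edges.
  have h₂ := congrArg (fun f => coeff e (PowerSeries.coeff N f)) (gradeSubstB_partitionPart g b n)
  beta_reduce at h₂
  rw [PowerSeries.coeff_X_pow_mul', if_pos hn, coeff_leafExp] at h₂
  refine Eq.trans ?_ (h₂.symm.trans ((coeff_coeff_grade _ _ _).trans (if_pos rfl)))
  rw [MvPolynomial.coeff_coe, show N + 1 - 1 - n = N - n by omega, show N - (N - n) = n by omega]

end Grade

end Enumeration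

theorem mainTheorem9 (g b : ℕ) :
    -- `F` is obtained from `F̂` by the substitution `x̂_p = ∑_ℓ x_ℓ A_{ℓ,p}`
    (MvPowerSeries.HasSubst (fun p : ℕ => linearForm fun ℓ => substA b ℓ p) ∧
      partitionF g b =
        MvPowerSeries.subst (fun p : ℕ => linearForm fun ℓ => substA b ℓ p) (hatPartitionF g b)) ∧
    -- `F̂` is obtained from `F` by the substitution `x_ℓ = ∑_p x̂_p B_{p,ℓ}`
    (MvPowerSeries.HasSubst (fun ℓ : ℕ => linearForm fun p => substB b p ℓ) ∧
      hatPartitionF g b =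
        MvPowerSeries.subst (fun ℓ : ℕ => linearForm fun p => substB b p ℓ) (partitionF g b)) ∧
    -- the truncated matrices `A` and `B` are inverse to each other
    ∀ m : ℕ,
      (Matrix.of fun ℓ p : Finset.Icc b m => substA b ℓ p) *
          (Matrix.of fun p ℓ : Finset.Icc b m => substB b p ℓ) = 1 ∧
      (Matrix.of fun p ℓ : Finset.Icc b m => substB b p ℓ) *
          (Matrix.of fun ℓ p : Finset.Icc b m => substA b ℓ p) = 1 := by
  refine ⟨⟨hasSubst_substA b, ?_⟩, ⟨hasSubst_substB b, hatPartitionF_eq_subst g b⟩, fun m =>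
    ⟨matrix_substA_mul_substB b m, matrix_substB_mul_substA b m⟩⟩
  rw [hatPartitionF_eq_subst, subst_substA_subst_substB]
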